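/- Consider the equations $u_t+\varepsilon(u^m)_x+f(t)u_{xxx}=0$, where $m\in\mathbb R\setminus\{0,1\}$ is fixed, $\varepsilon=\pm1$, and $f$ is a smooth nonvanishing real function on a nonempty open interval $I$; let $t\in I$, $x\in J$, $u\in U$, where $J,U$ are nonempty open intervals such that $U\subseteq(0,\infty)$, or $m$ is an integer and $0\notin U$, or $m$ is a natural number. A smooth vector field $\Gamma=\tau(t,x,u)\partial_t+\xi(t,x,u)\partial_x+\eta(t,x,u)\partial_u$ on $I\times J\times U$ is a Lie symmetry operator if its third prolongation satisfies $\Gamma^{(3)}[u_t+\varepsilon m u^{m-1}u_x+f(t)u_{xxx}]=0$ at all jets satisfying the equation. All these operators form the maximal Lie invariance algebra $A^{\max}$. The kernel algebra consists of the operators that belong to $A^{\max}$ for all $f$ (with $m,\varepsilon,I,J,U$ fixed). **Equivalence.** The group $G^\sim$ consists of the transformations $$\tilde t=\pm\delta_1\delta_3^{1-m}t+\delta_0,\quad \tilde x=\delta_1x+\delta_2,\quad \tilde u=\delta_3u,\quad \tilde f=\pm\delta_1^2\delta_3^{m-1}f,\quad \tilde\varepsilon=\pm\varepsilon,\quad\tilde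 m=m,$$ with $\delta_1\delta_3\neq0$ (and $\delta_3>0$ unless $m$ is an integer). For $m=2$, the group $G^\sim_{(1,2)}$ consists of the transformations $$\tilde t=\frac{\alpha t+\beta}{\gamma t+\delta},\quad \tilde x=\frac{\kappa x+\mu_1t+\mu_0}{\gamma t+\delta},\quad \tilde u=\pm\frac{2\varepsilon\kappa(\gamma t+\delta)u-\kappa\gamma x+\mu_1\delta-\mu_0\gamma}{2\varepsilon(\alpha\delta-\beta\gamma)},\quad \tilde f=\frac{\kappa^3}{\alpha\delta-\beta\gamma}\,\frac{f}{\gamma t+\delta},\quad\tilde\varepsilon=\pm\varepsilon,$$ with $\kappa(\alpha\delta-\beta\gamma)\neq0$. In each family the signs $\pm$ are the same. The pair $(\varepsilon,f)$ on $I$ is equivalent to $(\tilde\varepsilon,\tilde f)$ on $\tilde I$ if some transformation of the group with $\tilde t$ defined on all of $I$ maps $I$ onto $\tilde I$ and relates the pairs as displayed. The function $t^k$ is considered on intervals in $(0,\infty)$, or also in $(-\infty,0)$ if $k$ is an integer. **Case $m\ne2$ (up to $G^\sim$).** The kernel algebra has the basis $\partial_x$. Bases of $A^{\max}$ are: * $f=1$: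 $\ \partial_t,\ \partial_x,\ 3(m-1)t\partial_t+(m-1)x\partial_x-2u\partial_u$; * $f=t^k$, $k\neq0$: $\ \partial_x,\ 3(m-1)t\partial_t+(m-1)(k+1)x\partial_x+(k-2)u\partial_u$; * $f=e^t$: $\ \partial_x,\ 3(m-1)\partial_t+(m-1)x\partial_x+u\partial_u$. For every $f$, the algebra $A^{\max}$ is strictly larger than the kernel algebra if and only if $(\varepsilon,f)$ is $G^\sim$-equivalent to $(\tilde\varepsilon,\tilde f)$ for one of the listed functions $\tilde f$ and some $\tilde\varepsilon$; distinct listed functions (for any signs and on any intervals on which they are considered) are $G^\sim$-inequivalent. **Case $m=2$ (up to $G^\sim_{(1,2)}$).** The kernel algebra has the basis $\partial_x,\ 2\varepsilon t\partial_x+\partial_u$. Bases of $A^{\max}$ are: * $f=1$: $\ \partial_t,\ 2\varepsilon t\partial_x+\partial_u,\ \partial_x,\ 3t\partial_t+x\partial_x-2u\partial_u$; * $f=t^k$, $k\neq0,1$: $\ \partial_x,\ 2\varepsilon t\partial_x+\partial_u,\ 3t\partial_t+(k+1)x\partial_x+(k-2)u\partial_u$; * $f=e^t$: $\ \partial_x,\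 2\varepsilon t\partial_x+\partial_u,\ 3\partial_t+x\partial_x+u\partial_u$; * $f=e^{k\arctan t}\sqrt{t^2+1}$, $k\in\mathbb R$: $\ \partial_x,\ 2\varepsilon t\partial_x+\partial_u,\ 6\varepsilon(t^2+1)\partial_t+2\varepsilon(3t+k)x\partial_x+\bigl(2\varepsilon(k-3t)u+3x\bigr)\partial_u$. For every $f$, the algebra $A^{\max}$ is strictly larger than the kernel algebra if and only if $(\varepsilon,f)$ is $G^\sim_{(1,2)}$-equivalent to $(\tilde\varepsilon,\tilde f)$ for some $\tilde\varepsilon$ and one of the functions $\tilde f=1$; $\ t^k$ with $k\ge1/2$, $k\ne1$; $\ e^t$; $\ e^{k\arctan t}\sqrt{t^2+1}$ with $k\ge0$. With these constraints on $k$, distinct functions of the list (for any signs and on any intervals on which they are considered) are $G^\sim_{(1,2)}$-inequivalent. -/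

import Mathlib

open scoped ContDiff

namespace KmnSymmetry

noncomputable section

/-! The class `u_t + ε (u ^ m)_x + f(t) u_xxx = 0`.  Points of the space of variables are triples
`(t, x, u)`; smooth functions `u = w(t, x)` are maps `w : ℝ × ℝ → ℝ`. -/

/-- Vector fields `τ ∂_t + ξ ∂_x + η ∂_u`, as maps `(t, x, u) ↦ (τ, ξ, η)`. -/
abbrev VectorField : Type := ℝ × ℝ × ℝ → ℝ × ℝ × ℝ

/-- The vector field with components `g t x u = (τ, ξ, η)`. -/
def vf (g : ℝ → ℝ → ℝ → ℝ × ℝ × ℝ) : VectorField := fun p => g p.1 p.2.1 p.2.2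

/-- The partial derivative with respect to `t`. -/
def partialT (w : ℝ × ℝ → ℝ) : ℝ × ℝ → ℝ := fun q => deriv (fun s => w (s, q.2)) q.1

/-- The partial derivative with respect to `x`. -/
def partialX (w : ℝ × ℝ → ℝ) : ℝ × ℝ → ℝ := fun q => deriv (fun y => w (q.1, y)) q.2

/-- The point `(t, x, w(t, x))` of the graph of `w`. -/
def graphPt (w : ℝ × ℝ → ℝ) (q : ℝ × ℝ) : ℝ × ℝ × ℝ := (q.1, q.2, w q)

/-- The characteristic `Q = η - τ u_t - ξ u_x` of a vector field, evaluated along `u = w(t, x)`. -/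
def characteristic (Γ : VectorField) (w : ℝ × ℝ → ℝ) : ℝ × ℝ → ℝ := fun q =>
  (Γ (graphPt w q)).2.2 - (Γ (graphPt w q)).1 * partialT w q
    - (Γ (graphPt w q)).2.1 * partialX w q

/-- The coefficient `D_α Q + τ u_{α,t} + ξ u_{α,x}` of `∂/∂u_α` in the prolongation of `Γ`, at the
jet of `w` at `q`.  Here `Dα` is the iterated partial derivative belonging to `α`: along `u = w(t, x)`
total derivatives are ordinary partial derivatives.  For `Dα = id` this is `η`. -/
def prolongCoeff (Γ : VectorField) (Dα : (ℝ × ℝ → ℝ) → (ℝ × ℝ → ℝ)) (w : ℝ × ℝ → ℝ)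
    (q : ℝ × ℝ) : ℝ :=
  Dα (characteristic Γ w) q + (Γ (graphPt w q)).1 * partialT (Dα w) q
    + (Γ (graphPt w q)).2.1 * partialX (Dα w) q

/-- The left-hand side `u_t + ε m u^(m-1) u_x + f(t) u_xxx` as a function of jet coordinates. -/
def lhs (m ε : ℝ) (f : ℝ → ℝ) (t u ut ux uxxx : ℝ) : ℝ :=
  ut + ε * (m * u ^ (m - 1) * ux) + f t * uxxx

/-- The infinitesimal invariance criterion on an open set `D` of the space of variables `(t, x, u)`:
`Γ` is smooth on `D`, and the third prolongation of `Γ`, applied to the left-hand side of the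
equation, vanishes at every jet over `D` that satisfies the equation.  Every jet at a point is the
jet of a smooth function `w`; the equation is required at the single point `q` only. -/
def IsLieSymmetry (m ε : ℝ) (f : ℝ → ℝ) (D : Set (ℝ × ℝ × ℝ)) (Γ : VectorField) : Prop :=
  ContDiffOn ℝ ∞ Γ D ∧
  ∀ w : ℝ × ℝ → ℝ, ContDiff ℝ ∞ w → ∀ q : ℝ × ℝ, graphPt w q ∈ D →
    lhs m ε f q.1 (w q) (partialT w q) (partialX w q) ((partialX^[3]) w q) = 0 →
    deriv (fun s : ℝ => lhs m ε f
      (q.1 + s * (Γ (graphPt w q)).1)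
      (w q + s * (Γ (graphPt w q)).2.2)
      (partialT w q + s * prolongCoeff Γ partialT w q)
      (partialX w q + s * prolongCoeff Γ partialX w q)
      ((partialX^[3]) w q + s * prolongCoeff Γ (partialX^[3]) w q)) 0 = 0

/-- The maximal Lie invariance algebra `A^max` of the equation on `D`: all Lie symmetry operators,
regarded as vector fields on `D`. -/
def maximalAlgebra (m ε : ℝ) (f : ℝ → ℝ) (D : Set (ℝ × ℝ × ℝ)) : Set (D → ℝ × ℝ × ℝ) :=
  {v | ∃ Γ : VectorField, IsLieSymmetry m ε f D Γ ∧ D.domRestrict Γ = v}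

/-- Nonempty open intervals of the real line, possibly unbounded. -/
structure IsOpenInterval (I : Set ℝ) : Prop where
  isOpen : IsOpen I
  nonempty : I.Nonempty
  isPreconnected : IsPreconnected I

/-- The coefficient functions of the class on a time interval: smooth and nonvanishing. -/
structure IsCoefficient (I : Set ℝ) (f : ℝ → ℝ) : Prop where
  smooth : ContDiffOn ℝ ∞ f I
  ne_zero : ∀ t ∈ I, f t ≠ 0

/-- The power `u ^ m` has its usual meaning on `U` and is smooth there: `U` is arbitrary if `m` is a
natural number, avoids `0` if `m` is an integer, and is positive otherwise. -/
def IsPowerDomain (m : ℝ) (U : Set ℝ) : Prop :=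
  (∃ n : ℕ, m = n) ∨ ((∃ n : ℤ, m = n) ∧ (0 : ℝ) ∉ U) ∨ U ⊆ Set.Ioi 0

/-- The kernel algebra: operators that are Lie symmetries for all coefficient functions `f`. -/
def kernelAlgebra (m ε : ℝ) (I J U : Set ℝ) : Set (↥(I ×ˢ J ×ˢ U) → ℝ × ℝ × ℝ) :=
  {v | ∀ f : ℝ → ℝ, IsCoefficient I f → v ∈ maximalAlgebra m ε f (I ×ˢ J ×ˢ U)}

/-- The vector fields `b i`, restricted to `D`, form a basis of the space `A` of vector fields. -/
def IsBasisOf {D : Set (ℝ × ℝ × ℝ)} {n : ℕ} (b : Fin n → VectorField)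
    (A : Set (D → ℝ × ℝ × ℝ)) : Prop :=
  LinearIndependent ℝ (fun i => D.domRestrict (b i)) ∧
  (Submodule.span ℝ (Set.range fun i => D.domRestrict (b i)) : Set (D → ℝ × ℝ × ℝ)) = A

/-- The point transformations `(t, x, u) ↦ (t', x', u')` of the usual equivalence group. -/
def usualMap (m s δ₀ δ₁ δ₂ δ₃ : ℝ) : ℝ × ℝ × ℝ → ℝ × ℝ × ℝ := fun p =>
  (s * δ₁ * δ₃ ^ (1 - m) * p.1 + δ₀, δ₁ * p.2.1 + δ₂, δ₃ * p.2.2)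

/-- Equivalence with respect to the usual equivalence group `G^∼` (for `n = 1`): a transformation of
the group takes the equation with `(ε, f)` for `t ∈ I` to the one with `(ε', f')` for `t' ∈ I'`.
A negative `δ₃` makes sense only if `m` is an integer. -/
def UsualEquivalent (m ε : ℝ) (I : Set ℝ) (f : ℝ → ℝ) (ε' : ℝ) (I' : Set ℝ) (f' : ℝ → ℝ) : Prop :=
  ∃ s δ₀ δ₁ δ₂ δ₃ : ℝ, (s = 1 ∨ s = -1) ∧ δ₁ ≠ 0 ∧
    (0 < δ₃ ∨ (δ₃ < 0 ∧ ∃ n : ℤ, m = n)) ∧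
    ε' = s * ε ∧
    (fun p => (usualMap m s δ₀ δ₁ δ₂ δ₃ p).1) '' {p | p.1 ∈ I} = I' ∧
    ∀ p : ℝ × ℝ × ℝ, p.1 ∈ I →
      f' (usualMap m s δ₀ δ₁ δ₂ δ₃ p).1 = s * δ₁ ^ 2 * δ₃ ^ (m - 1) * f p.1

/-- The point transformations `(t, x, u) ↦ (t', x', u')` of the generalized equivalence group of the
subclass with `m = 2`. -/
def quadraticMap (ε s α β γ δ κ μ₁ μ₀ : ℝ) : ℝ × ℝ × ℝ → ℝ × ℝ × ℝ := fun p =>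
  ((α * p.1 + β) / (γ * p.1 + δ),
   (κ * p.2.1 + μ₁ * p.1 + μ₀) / (γ * p.1 + δ),
   s * ((2 * ε * κ * (γ * p.1 + δ) * p.2.2 - κ * γ * p.2.1 + μ₁ * δ - μ₀ * γ)
     / (2 * ε * (α * δ - β * γ))))

/-- Equivalence with respect to the generalized equivalence group `G^∼_(1,2)`: a transformation of
the group, defined for all `t ∈ I`, takes the equation with `m = 2` and `(ε, f)` for `t ∈ I` to the
one with `m = 2` and `(ε', f')` for `t' ∈ I'`. -/
def QuadraticEquivalent (ε : ℝ) (I : Set ℝ) (f : ℝ → ℝ) (ε' : ℝ) (I' : Set ℝ) (f' : ℝ → ℝ) : Prop :=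
  ∃ s α β γ δ κ μ₁ μ₀ : ℝ, (s = 1 ∨ s = -1) ∧ κ * (α * δ - β * γ) ≠ 0 ∧
    (∀ t ∈ I, γ * t + δ ≠ 0) ∧
    ε' = s * ε ∧
    (fun p => (quadraticMap ε s α β γ δ κ μ₁ μ₀ p).1) '' {p | p.1 ∈ I} = I' ∧
    ∀ p : ℝ × ℝ × ℝ, p.1 ∈ I →
      f' (quadraticMap ε s α β γ δ κ μ₁ μ₀ p).1
        = κ ^ 3 / (α * δ - β * γ) * (f p.1 / (γ * p.1 + δ))

/-- Names for the special coefficient functions. -/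
inductive NormalForm : Type
  | one : NormalForm
  | power (k : ℝ) : NormalForm
  | exp : NormalForm
  | arctan (k : ℝ) : NormalForm

/-- The special coefficient functions `1`, `t ^ k`, `e ^ t`, `e ^ (k arctan t) √(t² + 1)`. -/
def NormalForm.fn : NormalForm → ℝ → ℝ
  | .one => fun _ => 1
  | .power k => fun t => t ^ k
  | .exp => fun t => Real.exp t
  | .arctan k => fun t => Real.exp (k * Real.arctan t) * Real.sqrt (t ^ 2 + 1)

/-- Where the special coefficient functions are defined, smooth and nonvanishing: for `t ^ k` this is
`t > 0`, and also `t < 0` if `k` is an integer. -/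
def NormalForm.domain : NormalForm → Set ℝ
  | .power k => {t | 0 < t ∨ (t < 0 ∧ ∃ n : ℤ, k = n)}
  | _ => Set.univ

/-- The normal forms for `m ≠ 2`: `1`, `t ^ k` with `k ≠ 0`, `e ^ t`. -/
def NormalForm.IsUsual : NormalForm → Prop
  | .one => True
  | .power k => k ≠ 0
  | .exp => True
  | .arctan _ => False

/-- The normal forms for `m = 2`: `1`, `t ^ k` with `k ≥ 1/2` and `k ≠ 0, 1`, `e ^ t`,
`e ^ (k arctan t) √(t² + 1)` with `k ≥ 0`. -/
def NormalForm.IsQuadratic : NormalForm → Prop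
  | .one => True
  | .power k => k ≠ 0 ∧ k ≠ 1 ∧ 1 / 2 ≤ k
  | .exp => True
  | .arctan k => 0 ≤ k

end

end KmnSymmetry

open KmnSymmetry

/-!
The invariance criterion is a polynomial identity in the jet coordinates `u_tx`, `u_txx`, `u_x`,
`u_xx`, `u_xxx`, once `u_t` is eliminated by means of the equation (`isLieSymmetry_iff`): along
`u = w(t, x)` the prolongation coefficients follow from the chain rule and the symmetry of second
derivatives, and every jet is the jet of a polynomial.  Splitting this identity gives
`τ = τ(t)`, `ξ_u = 0`, `η_uu = 0`, `(τ f)' = 3 ξ_x f`, the coefficient of `u_x`, and the equation of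
the class for `η` (`determiningEquations_of_prolongedLhs`).  Hence `ξ` is affine in `x` with
coefficients depending on `t`.  For `m ≠ 2` the functions `u ^ (m - 1)`, `u ^ (m - 2)`, `1` are
linearly independent, which leaves constant coefficients; for `m = 2` the coefficient of `u_x`
gives `η`, and the equation for `η` makes `ξ_x` affine and `τ` quadratic in `t`.

Thus the whole algebra is governed by one linear equation (`SolvesODE`)
`(a t² + b t + c) f' = (a t + e) f`, with `a = 0` if `m ≠ 2` (`mem_maximalAlgebra_iff`,
`mem_maximalAlgebra_two_iff`).  The kernel algebra is found from `f = 1` and `f = e^t`, and it is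
extended exactly if `f` solves such an equation with `(a, b, c) ≠ 0`.

On these equations the equivalence groups act by affine and by fractional linear changes of `t`
(`SolvesODE.mobius`).  The quadratic polynomial is brought to `t`, `1` or `t² + 1` according to its
zeros on the projective line; an equation determines its nonvanishing solution up to a factor
(`SolvesODE.proportional`), and factors are absorbed by the group.  Exchanging two real zeros
replaces the exponent `k` by `1 - k`, a reflection replaces `k` by `-k` in the complex case, and for
the exponent `1` the solution is equivalent to a constant; hence the constraints on `k`.
Inequivalence follows from the uniqueness of the equation of a normal form up to a factor: for
`m = 2` the numbers `2 e - b` and `b² - 4 a c` are multiplied by `Δ` and `Δ²` under a substitution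
with determinant `Δ`, so that they separate the normal forms (`NormalForm.eq_of_invariants`).
-/

namespace KmnSymmetry

/-! ### Partial derivatives on the space of variables -/

/-- The partial derivative in `t` of a function of `(t, x, u)`. -/
noncomputable def dT (g : ℝ × ℝ × ℝ → ℝ) : ℝ × ℝ × ℝ → ℝ := fun P => fderiv ℝ g P (1, 0, 0)

/-- The partial derivative in `x` of a function of `(t, x, u)`. -/
noncomputable def dX (g : ℝ × ℝ × ℝ → ℝ) : ℝ × ℝ × ℝ → ℝ := fun P => fderiv ℝ g P (0, 1, 0)

/-- The partial derivative in `u` of a function of `(t, x, u)`. -/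
noncomputable def dU (g : ℝ × ℝ × ℝ → ℝ) : ℝ × ℝ × ℝ → ℝ := fun P => fderiv ℝ g P (0, 0, 1)

theorem two_le_infty : (2 : WithTop ℕ∞) ≤ ∞ := ENat.LEInfty.out

section Partials

variable {D : Set (ℝ × ℝ × ℝ)} {g : ℝ × ℝ × ℝ → ℝ}

theorem contDiffOn_fderiv_apply (hD : IsOpen D) (hg : ContDiffOn ℝ ∞ g D) (v : ℝ × ℝ × ℝ) :
    ContDiffOn ℝ ∞ (fun P => fderiv ℝ g P v) D :=
  (hg.fderiv_of_isOpen hD (by simp)).clm_apply contDiffOn_const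

theorem contDiffOn_dX (hD : IsOpen D) (hg : ContDiffOn ℝ ∞ g D) : ContDiffOn ℝ ∞ (dX g) D :=
  contDiffOn_fderiv_apply hD hg _

theorem contDiffOn_dU (hD : IsOpen D) (hg : ContDiffOn ℝ ∞ g D) : ContDiffOn ℝ ∞ (dU g) D :=
  contDiffOn_fderiv_apply hD hg _

theorem differentiableAt_of_smoothOn (hD : IsOpen D) (hg : ContDiffOn ℝ ∞ g D) {P : ℝ × ℝ × ℝ}
    (hP : P ∈ D) : DifferentiableAt ℝ g P :=
  (hg.contDiffAt (hD.mem_nhds hP)).differentiableAt (by simp)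

/-- Mixed partial derivatives in `x` and `u` commute. -/
theorem dU_dX (hD : IsOpen D) (hg : ContDiffOn ℝ ∞ g D) {P : ℝ × ℝ × ℝ} (hP : P ∈ D) :
    dU (dX g) P = dX (dU g) P := by
  have hs : IsSymmSndFDerivAt ℝ g P :=
    (hg.contDiffAt (hD.mem_nhds hP)).isSymmSndFDerivAt (by simpa using two_le_infty)
  have hd : DifferentiableAt ℝ (fderiv ℝ g) P :=
    ((hg.fderiv_of_isOpen (m := ∞) hD (by simp)).contDiffAt (hD.mem_nhds hP)).differentiableAt
      (by simp)
  have key : ∀ v w : ℝ × ℝ × ℝ,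
      fderiv ℝ (fun P => fderiv ℝ g P v) P w = fderiv ℝ (fderiv ℝ g) P w v := by
    intro v w
    rw [fderiv_clm_apply hd (differentiableAt_const v)]
    simp
  change fderiv ℝ (fun P => fderiv ℝ g P (0, 1, 0)) P (0, 0, 1)
    = fderiv ℝ (fun P => fderiv ℝ g P (0, 0, 1)) P (0, 1, 0)
  rw [key, key]
  exact hs _ _

theorem hasDerivAt_comp_x (hD : IsOpen D) (hg : ContDiffOn ℝ ∞ g D) {t y p' : ℝ} {p : ℝ → ℝ}
    (hp : HasDerivAt p p' y) (hP : (t, y, p y) ∈ D) :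
    HasDerivAt (fun y => g (t, y, p y)) (dX g (t, y, p y) + dU g (t, y, p y) * p') y := by
  have h1 : HasDerivAt (fun y => (t, y, p y)) ((0, 1, p') : ℝ × ℝ × ℝ) y :=
    (hasDerivAt_const y t).prodMk ((hasDerivAt_id y).prodMk hp)
  have h2 := (differentiableAt_of_smoothOn hD hg hP).hasFDerivAt.comp_hasDerivAt y h1
  have h3 : ((0, 1, p') : ℝ × ℝ × ℝ) = (0, 1, 0) + p' • (0, 0, 1) := by simp
  rw [h3, map_add, map_smul, smul_eq_mul, mul_comm] at h2
  exact h2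

theorem hasDerivAt_comp_t (hD : IsOpen D) (hg : ContDiffOn ℝ ∞ g D) {s x p' : ℝ} {p : ℝ → ℝ}
    (hp : HasDerivAt p p' s) (hP : (s, x, p s) ∈ D) :
    HasDerivAt (fun s => g (s, x, p s)) (dT g (s, x, p s) + dU g (s, x, p s) * p') s := by
  have h1 : HasDerivAt (fun s => (s, x, p s)) ((1, 0, p') : ℝ × ℝ × ℝ) s :=
    (hasDerivAt_id s).prodMk ((hasDerivAt_const s x).prodMk hp)
  have h2 := (differentiableAt_of_smoothOn hD hg hP).hasFDerivAt.comp_hasDerivAt s h1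
  have h3 : ((1, 0, p') : ℝ × ℝ × ℝ) = (1, 0, 0) + p' • (0, 0, 1) := by simp
  rw [h3, map_add, map_smul, smul_eq_mul, mul_comm] at h2
  exact h2

theorem hasDerivAt_t (hD : IsOpen D) (hg : ContDiffOn ℝ ∞ g D) {t x u : ℝ} (hP : (t, x, u) ∈ D) :
    HasDerivAt (fun s => g (s, x, u)) (dT g (t, x, u)) t := by
  simpa using hasDerivAt_comp_t hD hg (hasDerivAt_const t u) hP

theorem hasDerivAt_x (hD : IsOpen D) (hg : ContDiffOn ℝ ∞ g D) {t x u : ℝ} (hP : (t, x, u) ∈ D) :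
    HasDerivAt (fun y => g (t, y, u)) (dX g (t, x, u)) x := by
  simpa using hasDerivAt_comp_x hD hg (hasDerivAt_const x u) hP

theorem hasDerivAt_u (hD : IsOpen D) (hg : ContDiffOn ℝ ∞ g D) {t x u : ℝ} (hP : (t, x, u) ∈ D) :
    HasDerivAt (fun v => g (t, x, v)) (dU g (t, x, u)) u :=
  (differentiableAt_of_smoothOn hD hg hP).hasFDerivAt.comp_hasDerivAt u
    ((hasDerivAt_const u t).prodMk ((hasDerivAt_const u x).prodMk (hasDerivAt_id u)))

end Partials

/-! ### Partial derivatives of functions of `(t, x)` -/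

section PartialsTX

variable {w : ℝ × ℝ → ℝ}

theorem hasDerivAt_fderiv_t (hw : ContDiff ℝ ∞ w) (t x : ℝ) :
    HasDerivAt (fun s => w (s, x)) (fderiv ℝ w (t, x) (1, 0)) t :=
  (hw.differentiable (by simp) (t, x)).hasFDerivAt.comp_hasDerivAt t
    ((hasDerivAt_id t).prodMk (hasDerivAt_const t x))

theorem hasDerivAt_fderiv_x (hw : ContDiff ℝ ∞ w) (t x : ℝ) :
    HasDerivAt (fun y => w (t, y)) (fderiv ℝ w (t, x) (0, 1)) x :=
  (hw.differentiable (by simp) (t, x)).hasFDerivAt.comp_hasDerivAt x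
    ((hasDerivAt_const x t).prodMk (hasDerivAt_id x))

theorem partialT_eq (hw : ContDiff ℝ ∞ w) : partialT w = fun q => fderiv ℝ w q (1, 0) := by
  funext ⟨t, x⟩
  exact (hasDerivAt_fderiv_t hw t x).deriv

theorem partialX_eq (hw : ContDiff ℝ ∞ w) : partialX w = fun q => fderiv ℝ w q (0, 1) := by
  funext ⟨t, x⟩
  exact (hasDerivAt_fderiv_x hw t x).deriv

theorem contDiff_partialT (hw : ContDiff ℝ ∞ w) : ContDiff ℝ ∞ (partialT w) := by
  rw [partialT_eq hw]
  exact (hw.fderiv_right (by simp)).clm_apply contDiff_const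

theorem contDiff_partialX (hw : ContDiff ℝ ∞ w) : ContDiff ℝ ∞ (partialX w) := by
  rw [partialX_eq hw]
  exact (hw.fderiv_right (by simp)).clm_apply contDiff_const

theorem hasDerivAt_partialT (hw : ContDiff ℝ ∞ w) (t x : ℝ) :
    HasDerivAt (fun s => w (s, x)) (partialT w (t, x)) t := by
  rw [partialT_eq hw]
  exact hasDerivAt_fderiv_t hw t x

theorem hasDerivAt_partialX (hw : ContDiff ℝ ∞ w) (t x : ℝ) :
    HasDerivAt (fun y => w (t, y)) (partialX w (t, x)) x := by
  rw [partialX_eq hw]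
  exact hasDerivAt_fderiv_x hw t x

theorem partialT_partialX (hw : ContDiff ℝ ∞ w) :
    partialT (partialX w) = partialX (partialT w) := by
  funext q
  have hs : IsSymmSndFDerivAt ℝ w q := hw.contDiffAt.isSymmSndFDerivAt (by simpa using two_le_infty)
  have hd : DifferentiableAt ℝ (fderiv ℝ w) q :=
    (hw.fderiv_right (m := ∞) (by simp)).differentiable (by simp) q
  have key : ∀ v v' : ℝ × ℝ,
      fderiv ℝ (fun P => fderiv ℝ w P v) q v' = fderiv ℝ (fderiv ℝ w) q v' v := by
    intro v v'
    rw [fderiv_clm_apply hd (differentiableAt_const v)]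
    simp
  rw [partialT_eq (contDiff_partialX hw), partialX_eq (contDiff_partialT hw), partialX_eq hw,
    partialT_eq hw]
  simp only [key]
  exact hs _ _

theorem partialT_partialX_iterate (hw : ContDiff ℝ ∞ w) :
    partialT ((partialX^[3]) w) = (partialX^[3]) (partialT w) := by
  have h1 := contDiff_partialX hw
  have h2 := contDiff_partialX h1
  change partialT (partialX (partialX (partialX w))) = partialX (partialX (partialX (partialT w)))
  rw [partialT_partialX h2, partialT_partialX h1, partialT_partialX hw]

end PartialsTX

/-! ### Third derivatives along curves -/

/-- `F₁`, `F₂`, `F₃` are the first three derivatives of `F` on `V`. -/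
structure ThreeDerivs (V : Set ℝ) (F F₁ F₂ F₃ : ℝ → ℝ) : Prop where
  one : ∀ y ∈ V, HasDerivAt F (F₁ y) y
  two : ∀ y ∈ V, HasDerivAt F₁ (F₂ y) y
  three : ∀ y ∈ V, HasDerivAt F₂ (F₃ y) y

namespace ThreeDerivs

variable {V : Set ℝ} {F F₁ F₂ F₃ G G₁ G₂ G₃ : ℝ → ℝ}

theorem deriv_deriv_deriv (hV : IsOpen V) (h : ThreeDerivs V F F₁ F₂ F₃) {y : ℝ} (hy : y ∈ V) :
    deriv (deriv (deriv F)) y = F₃ y := by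
  have e1 : ∀ z ∈ V, deriv F =ᶠ[nhds z] F₁ := fun z hz =>
    Filter.eventually_of_mem (hV.mem_nhds hz) fun x hx => (h.one x hx).deriv
  have e2 : ∀ z ∈ V, deriv (deriv F) =ᶠ[nhds z] F₂ := fun z hz =>
    Filter.eventually_of_mem (hV.mem_nhds hz) fun x hx =>
      ((e1 x hx).deriv_eq).trans (h.two x hx).deriv
  exact ((e2 y hy).deriv_eq).trans (h.three y hy).deriv

theorem sub (hF : ThreeDerivs V F F₁ F₂ F₃) (hG : ThreeDerivs V G G₁ G₂ G₃) :
    ThreeDerivs V (fun y => F y - G y) (fun y => F₁ y - G₁ y) (fun y => F₂ y - G₂ y)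
      (fun y => F₃ y - G₃ y) :=
  ⟨fun y hy => (hF.one y hy).sub (hG.one y hy), fun y hy => (hF.two y hy).sub (hG.two y hy),
    fun y hy => (hF.three y hy).sub (hG.three y hy)⟩

theorem mul (hF : ThreeDerivs V F F₁ F₂ F₃) (hG : ThreeDerivs V G G₁ G₂ G₃) :
    ThreeDerivs V (fun y => F y * G y) (fun y => F₁ y * G y + F y * G₁ y)
      (fun y => F₂ y * G y + 2 * (F₁ y * G₁ y) + F y * G₂ y)
      (fun y => F₃ y * G y + 3 * (F₂ y * G₁ y) + 3 * (F₁ y * G₂ y) + F y * G₃ y) := by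
  refine ⟨fun y hy => (hF.one y hy).mul (hG.one y hy), fun y hy => ?_, fun y hy => ?_⟩
  · exact (((hF.two y hy).mul (hG.one y hy)).add
      ((hF.one y hy).mul (hG.two y hy))).congr_deriv (by ring)
  · exact ((((hF.three y hy).mul (hG.one y hy)).add
      (((hF.two y hy).mul (hG.two y hy)).const_mul 2)).add
      ((hF.one y hy).mul (hG.three y hy))).congr_deriv (by ring)

end ThreeDerivs

/-- The total derivative `D_x g` at a jet. -/
noncomputable def total₁ (g : ℝ × ℝ × ℝ → ℝ) (P : ℝ × ℝ × ℝ) (p₁ : ℝ) : ℝ := dX g P + dU g P * p₁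

/-- The total derivative `D_x² g` at a jet. -/
noncomputable def total₂ (g : ℝ × ℝ × ℝ → ℝ) (P : ℝ × ℝ × ℝ) (p₁ p₂ : ℝ) : ℝ :=
  dX (dX g) P + 2 * dX (dU g) P * p₁ + dU (dU g) P * p₁ ^ 2 + dU g P * p₂

/-- The total derivative `D_x³ g` at a jet. -/
noncomputable def total₃ (g : ℝ × ℝ × ℝ → ℝ) (P : ℝ × ℝ × ℝ) (p₁ p₂ p₃ : ℝ) : ℝ :=
  dX (dX (dX g)) P + 3 * dX (dX (dU g)) P * p₁ + 3 * dX (dU (dU g)) P * p₁ ^ 2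
    + dU (dU (dU g)) P * p₁ ^ 3 + 3 * (dX (dU g) P + dU (dU g) P * p₁) * p₂ + dU g P * p₃

theorem threeDerivs_comp {D : Set (ℝ × ℝ × ℝ)} {g : ℝ × ℝ × ℝ → ℝ} (hD : IsOpen D)
    (hg : ContDiffOn ℝ ∞ g D) {p p₁ p₂ p₃ : ℝ → ℝ} {V : Set ℝ} (t : ℝ)
    (hV : ∀ y ∈ V, (t, y, p y) ∈ D) (hp : ThreeDerivs V p p₁ p₂ p₃) :
    ThreeDerivs V (fun y => g (t, y, p y)) (fun y => total₁ g (t, y, p y) (p₁ y))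
      (fun y => total₂ g (t, y, p y) (p₁ y) (p₂ y))
      (fun y => total₃ g (t, y, p y) (p₁ y) (p₂ y) (p₃ y)) := by
  have hx := contDiffOn_dX hD hg
  have hu := contDiffOn_dU hD hg
  have hxx := contDiffOn_dX hD hx
  have hxu := contDiffOn_dX hD hu
  have huu := contDiffOn_dU hD hu
  -- the mixed derivatives agree on `D`, hence so do their derivatives
  have hc : ∀ P ∈ D, dU (dX g) =ᶠ[nhds P] dX (dU g) := fun P hP =>
    Filter.eventually_of_mem (hD.mem_nhds hP) fun P' hP' => dU_dX hD hg hP'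
  have e1 : ∀ P ∈ D, dU (dX (dX g)) P = dX (dX (dU g)) P := fun P hP => by
    rw [dU_dX hD hx hP]
    simp only [dX] at hc ⊢
    rw [(hc P hP).fderiv_eq]
  have e2 : ∀ P ∈ D, dU (dX (dU g)) P = dX (dU (dU g)) P := fun P hP => dU_dX hD hu hP
  refine ⟨fun y hy => hasDerivAt_comp_x hD hg (hp.one y hy) (hV y hy), fun y hy => ?_,
    fun y hy => ?_⟩
  · have hP := hV y hy
    have h1 := hp.one y hy
    refine ((hasDerivAt_comp_x hD hx h1 hP).add
      ((hasDerivAt_comp_x hD hu h1 hP).mul (hp.two y hy))).congr_deriv ?_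
    simp only [total₂, dU_dX hD hg hP]
    ring
  · have hP := hV y hy
    have h1 := hp.one y hy
    have h2 := hp.two y hy
    refine ((((hasDerivAt_comp_x hD hxx h1 hP).add
      (((hasDerivAt_comp_x hD hxu h1 hP).const_mul 2).mul h2)).add
      ((hasDerivAt_comp_x hD huu h1 hP).mul (h2.pow 2))).add
      ((hasDerivAt_comp_x hD hu h1 hP).mul (hp.three y hy))).congr_deriv ?_
    simp only [total₃, e1 _ hP, e2 _ hP, Pi.pow_apply]
    ring

/-! ### The prolonged vector field in jet coordinates -/

section Prolongation

variable {D : Set (ℝ × ℝ × ℝ)} {Γ : VectorField} {w : ℝ × ℝ → ℝ} {q : ℝ × ℝ}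

theorem prolongCoeff_partialT (hD : IsOpen D) (hτ : ContDiffOn ℝ ∞ (fun P => (Γ P).1) D)
    (hξ : ContDiffOn ℝ ∞ (fun P => (Γ P).2.1) D) (hη : ContDiffOn ℝ ∞ (fun P => (Γ P).2.2) D)
    (hw : ContDiff ℝ ∞ w) (hq : graphPt w q ∈ D) :
    prolongCoeff Γ partialT w q =
      dT (fun P => (Γ P).2.2) (graphPt w q) + dU (fun P => (Γ P).2.2) (graphPt w q) * partialT w q
      - (dT (fun P => (Γ P).1) (graphPt w q)
          + dU (fun P => (Γ P).1) (graphPt w q) * partialT w q) * partialT w q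
      - (dT (fun P => (Γ P).2.1) (graphPt w q)
          + dU (fun P => (Γ P).2.1) (graphPt w q) * partialT w q) * partialX w q := by
  obtain ⟨t, x⟩ := q
  have hwt := contDiff_partialT hw
  have hwx := contDiff_partialX hw
  have h0 := hasDerivAt_partialT hw t x
  have h : HasDerivAt (fun s => characteristic Γ w (s, x)) _ t :=
    ((hasDerivAt_comp_t hD hη h0 hq).sub ((hasDerivAt_comp_t hD hτ h0 hq).mul
      (hasDerivAt_partialT hwt t x))).sub ((hasDerivAt_comp_t hD hξ h0 hq).mul
      (hasDerivAt_partialT hwx t x))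
  have e : partialT (characteristic Γ w) (t, x) = _ := h.deriv
  rw [prolongCoeff, e, partialT_partialX hw]
  simp only [graphPt]
  ring

theorem prolongCoeff_partialX (hD : IsOpen D) (hτ : ContDiffOn ℝ ∞ (fun P => (Γ P).1) D)
    (hξ : ContDiffOn ℝ ∞ (fun P => (Γ P).2.1) D) (hη : ContDiffOn ℝ ∞ (fun P => (Γ P).2.2) D)
    (hw : ContDiff ℝ ∞ w) (hq : graphPt w q ∈ D) :
    prolongCoeff Γ partialX w q =
      total₁ (fun P => (Γ P).2.2) (graphPt w q) (partialX w q)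
      - total₁ (fun P => (Γ P).1) (graphPt w q) (partialX w q) * partialT w q
      - total₁ (fun P => (Γ P).2.1) (graphPt w q) (partialX w q) * partialX w q := by
  obtain ⟨t, x⟩ := q
  have hwt := contDiff_partialT hw
  have hwx := contDiff_partialX hw
  have h0 := hasDerivAt_partialX hw t x
  have h : HasDerivAt (fun y => characteristic Γ w (t, y)) _ x :=
    ((hasDerivAt_comp_x hD hη h0 hq).sub ((hasDerivAt_comp_x hD hτ h0 hq).mul
      (hasDerivAt_partialX hwt t x))).sub ((hasDerivAt_comp_x hD hξ h0 hq).mul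
      (hasDerivAt_partialX hwx t x))
  have e : partialX (characteristic Γ w) (t, x) = _ := h.deriv
  rw [prolongCoeff, e, partialT_partialX hw]
  simp only [graphPt, total₁]
  ring

theorem threeDerivs_partialX (hw : ContDiff ℝ ∞ w) (t : ℝ) (V : Set ℝ) :
    ThreeDerivs V (fun y => w (t, y)) (fun y => partialX w (t, y))
      (fun y => (partialX^[2]) w (t, y)) (fun y => (partialX^[3]) w (t, y)) :=
  ⟨fun y _ => hasDerivAt_partialX hw t y,
    fun y _ => hasDerivAt_partialX (contDiff_partialX hw) t y,
    fun y _ => hasDerivAt_partialX (contDiff_partialX (contDiff_partialX hw)) t y⟩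

theorem prolongCoeff_partialX_three (hD : IsOpen D)
    (hτ : ContDiffOn ℝ ∞ (fun P => (Γ P).1) D)
    (hξ : ContDiffOn ℝ ∞ (fun P => (Γ P).2.1) D) (hη : ContDiffOn ℝ ∞ (fun P => (Γ P).2.2) D)
    (hw : ContDiff ℝ ∞ w) (hq : graphPt w q ∈ D) :
    prolongCoeff Γ (partialX^[3]) w q =
      total₃ (fun P => (Γ P).2.2) (graphPt w q) (partialX w q) ((partialX^[2]) w q)
        ((partialX^[3]) w q)
      - (3 * total₁ (fun P => (Γ P).1) (graphPt w q) (partialX w q)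
            * (partialX^[2]) (partialT w) q
        + 3 * total₂ (fun P => (Γ P).1) (graphPt w q) (partialX w q) ((partialX^[2]) w q)
            * partialX (partialT w) q
        + total₃ (fun P => (Γ P).1) (graphPt w q) (partialX w q) ((partialX^[2]) w q)
            ((partialX^[3]) w q) * partialT w q)
      - (3 * total₁ (fun P => (Γ P).2.1) (graphPt w q) (partialX w q) * (partialX^[3]) w q
        + 3 * total₂ (fun P => (Γ P).2.1) (graphPt w q) (partialX w q) ((partialX^[2]) w q)
            * (partialX^[2]) w q
        + total₃ (fun P => (Γ P).2.1) (graphPt w q) (partialX w q) ((partialX^[2]) w q)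
            ((partialX^[3]) w q) * partialX w q) := by
  obtain ⟨t, x⟩ := q
  have hwt := contDiff_partialT hw
  have hwx := contDiff_partialX hw
  have hV : IsOpen {y : ℝ | (t, y, w (t, y)) ∈ D} :=
    hD.preimage (by have := hw.continuous; fun_prop)
  set V := {y : ℝ | (t, y, w (t, y)) ∈ D}
  have h0 := threeDerivs_partialX hw t V
  have hVD : ∀ y ∈ V, (t, y, w (t, y)) ∈ D := fun y hy => hy
  have h := ((threeDerivs_comp hD hη t hVD h0).sub ((threeDerivs_comp hD hτ t hVD h0).mul
    (threeDerivs_partialX hwt t V))).sub ((threeDerivs_comp hD hξ t hVD h0).mul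
    (threeDerivs_partialX hwx t V))
  have e : (partialX^[3]) (characteristic Γ w) (t, x) = _ := h.deriv_deriv_deriv hV hq
  rw [prolongCoeff, e, partialT_partialX_iterate hw]
  simp only [graphPt, Function.iterate_succ, Function.iterate_zero, Function.comp_apply, id_eq]
  ring

end Prolongation

/-- The third prolongation of `τ ∂_t + ξ ∂_x + η ∂_u`, applied to `u_t + ε m u^(m-1) u_x + f u_xxx`,
at the jet over `P = (t, x, u)` with `u_t = r₀`, `u_tx = r₁`, `u_txx = r₂`, `u_x = p₁`, `u_xx = p₂`,
`u_xxx = p₃`. -/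
noncomputable def prolongedLhs (m ε : ℝ) (f : ℝ → ℝ) (τ ξ η : ℝ × ℝ × ℝ → ℝ) (P : ℝ × ℝ × ℝ)
    (r₀ r₁ r₂ p₁ p₂ p₃ : ℝ) : ℝ :=
  (dT η P + dU η P * r₀ - (dT τ P + dU τ P * r₀) * r₀ - (dT ξ P + dU ξ P * r₀) * p₁)
  + ε * m * ((m - 1) * P.2.2 ^ (m - 1 - 1) * η P * p₁
    + P.2.2 ^ (m - 1) * (total₁ η P p₁ - total₁ τ P p₁ * r₀ - total₁ ξ P p₁ * p₁))
  + deriv f P.1 * τ P * p₃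
  + f P.1 * (total₃ η P p₁ p₂ p₃
    - (3 * total₁ τ P p₁ * r₂ + 3 * total₂ τ P p₁ p₂ * r₁ + total₃ τ P p₁ p₂ p₃ * r₀)
    - (3 * total₁ ξ P p₁ * p₃ + 3 * total₂ ξ P p₁ p₂ * p₂ + total₃ ξ P p₁ p₂ p₃ * p₁))

/-- The condition under which `u ^ (m - 1)` is differentiable with the usual derivative. -/
theorem IsPowerDomain.ne_zero_or {m : ℝ} {U : Set ℝ} (h : IsPowerDomain m U) (hm₀ : m ≠ 0)
    (hm₁ : m ≠ 1) {u : ℝ} (hu : u ∈ U) : u ≠ 0 ∨ 1 ≤ m - 1 := by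
  rcases h with ⟨n, rfl⟩ | ⟨-, h⟩ | h
  · right
    have h0 : n ≠ 0 := by exact_mod_cast hm₀
    have h1 : n ≠ 1 := by exact_mod_cast hm₁
    have : (2 : ℝ) ≤ n := by exact_mod_cast (by omega : 2 ≤ n)
    linarith
  · left
    rintro rfl
    exact h hu
  · left
    exact (Set.mem_Ioi.1 (h hu)).ne'

theorem hasDerivAt_lhs {m ε : ℝ} {f : ℝ → ℝ} {t u : ℝ} (hf : DifferentiableAt ℝ f t)
    (hu : u ≠ 0 ∨ 1 ≤ m - 1) (ut ux uxxx a b c d e : ℝ) :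
    HasDerivAt (fun s : ℝ => lhs m ε f (t + s * a) (u + s * b) (ut + s * c) (ux + s * d)
        (uxxx + s * e))
      (c + ε * m * ((m - 1) * u ^ (m - 1 - 1) * b * ux + u ^ (m - 1) * d) + deriv f t * a * uxxx
        + f t * e) 0 := by
  have lin : ∀ z v : ℝ, HasDerivAt (fun s : ℝ => z + s * v) v 0 := fun z v => by
    simpa using ((hasDerivAt_id (0 : ℝ)).mul_const v).const_add z
  have hf' : HasDerivAt (fun s : ℝ => f (t + s * a)) (deriv f t * a) 0 := by
    refine HasDerivAt.comp (0 : ℝ) (h₂ := f) ?_ (lin t a)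
    simpa using hf.hasDerivAt
  have hp : HasDerivAt (fun s : ℝ => (u + s * b) ^ (m - 1)) ((m - 1) * u ^ (m - 1 - 1) * b) 0 := by
    refine HasDerivAt.comp (0 : ℝ) (h₂ := fun v : ℝ => v ^ (m - 1)) ?_ (lin u b)
    simpa using Real.hasDerivAt_rpow_const hu
  refine (((lin ut c).add (((hp.const_mul m).mul (lin ux d)).const_mul ε)).add
    (hf'.mul (lin uxxx e))).congr_deriv ?_
  simp
  ring

/-- A smooth function with a prescribed jet. -/
noncomputable def jetFn (t₀ x₀ u₀ r₀ r₁ r₂ p₁ p₂ p₃ : ℝ) : ℝ × ℝ → ℝ := fun q =>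
  u₀ + p₁ * (q.2 - x₀) + p₂ / 2 * (q.2 - x₀) ^ 2 + p₃ / 6 * (q.2 - x₀) ^ 3
    + (q.1 - t₀) * (r₀ + r₁ * (q.2 - x₀) + r₂ / 2 * (q.2 - x₀) ^ 2)

theorem contDiff_jetFn (t₀ x₀ u₀ r₀ r₁ r₂ p₁ p₂ p₃ : ℝ) :
    ContDiff ℝ ∞ (jetFn t₀ x₀ u₀ r₀ r₁ r₂ p₁ p₂ p₃) := by
  unfold jetFn
  fun_prop

theorem partialT_jetFn (t₀ x₀ u₀ r₀ r₁ r₂ p₁ p₂ p₃ : ℝ) :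
    partialT (jetFn t₀ x₀ u₀ r₀ r₁ r₂ p₁ p₂ p₃) = jetFn t₀ x₀ r₀ 0 0 0 r₁ r₂ 0 := by
  funext ⟨t, x⟩
  have h := (hasDerivAt_id t).sub_const t₀
  refine HasDerivAt.deriv (((h.mul_const (r₀ + r₁ * (x - x₀) + r₂ / 2 * (x - x₀) ^ 2)).const_add
    (u₀ + p₁ * (x - x₀) + p₂ / 2 * (x - x₀) ^ 2 + p₃ / 6 * (x - x₀) ^ 3)).congr_deriv ?_)
  simp only [jetFn]
  ring

theorem partialX_jetFn (t₀ x₀ u₀ r₀ r₁ r₂ p₁ p₂ p₃ : ℝ) :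
    partialX (jetFn t₀ x₀ u₀ r₀ r₁ r₂ p₁ p₂ p₃) = jetFn t₀ x₀ p₁ r₁ r₂ 0 p₂ p₃ 0 := by
  funext ⟨t, x⟩
  have h := (hasDerivAt_id x).sub_const x₀
  refine HasDerivAt.deriv (((((h.const_mul p₁).const_add u₀).add ((h.pow 2).const_mul (p₂ / 2))).add
    ((h.pow 3).const_mul (p₃ / 6))).add ((((h.const_mul r₁).const_add r₀).add
    ((h.pow 2).const_mul (r₂ / 2))).const_mul (t - t₀)) |>.congr_deriv ?_)
  simp only [jetFn, id_eq]
  ring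

/-- The infinitesimal invariance criterion in jet coordinates.  The derivatives of `w` of fourth
order, as well as `u_tt` and `u_txxx`, cancel in the prolongation, and the remaining jet is
prescribed by `jetFn`. -/
theorem isLieSymmetry_iff {m ε : ℝ} {f : ℝ → ℝ} {I J U : Set ℝ} (hm₀ : m ≠ 0) (hm₁ : m ≠ 1)
    (hI : IsOpen I) (hJ : IsOpen J) (hU : IsOpen U) (hmU : IsPowerDomain m U)
    (hf : ContDiffOn ℝ ∞ f I) {Γ : VectorField} :
    IsLieSymmetry m ε f (I ×ˢ J ×ˢ U) Γ ↔ ContDiffOn ℝ ∞ Γ (I ×ˢ J ×ˢ U) ∧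
      ∀ P ∈ I ×ˢ J ×ˢ U, ∀ r₀ r₁ r₂ p₁ p₂ p₃ : ℝ, lhs m ε f P.1 P.2.2 r₀ p₁ p₃ = 0 →
        prolongedLhs m ε f (fun P => (Γ P).1) (fun P => (Γ P).2.1) (fun P => (Γ P).2.2) P
          r₀ r₁ r₂ p₁ p₂ p₃ = 0 := by
  have hD : IsOpen (I ×ˢ J ×ˢ U) := hI.prod (hJ.prod hU)
  refine and_congr_right fun hΓ => ?_
  have hτ : ContDiffOn ℝ ∞ (fun P => (Γ P).1) (I ×ˢ J ×ˢ U) := hΓ.fst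
  have hξ : ContDiffOn ℝ ∞ (fun P => (Γ P).2.1) (I ×ˢ J ×ˢ U) := hΓ.snd.fst
  have hη : ContDiffOn ℝ ∞ (fun P => (Γ P).2.2) (I ×ˢ J ×ˢ U) := hΓ.snd.snd
  have key : ∀ w : ℝ × ℝ → ℝ, ContDiff ℝ ∞ w → ∀ q : ℝ × ℝ, graphPt w q ∈ I ×ˢ J ×ˢ U →
      deriv (fun s : ℝ => lhs m ε f
      (q.1 + s * (Γ (graphPt w q)).1)
      (w q + s * (Γ (graphPt w q)).2.2)
      (partialT w q + s * prolongCoeff Γ partialT w q)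
      (partialX w q + s * prolongCoeff Γ partialX w q)
      ((partialX^[3]) w q + s * prolongCoeff Γ (partialX^[3]) w q)) 0 =
      prolongedLhs m ε f (fun P => (Γ P).1) (fun P => (Γ P).2.1) (fun P => (Γ P).2.2)
        (graphPt w q) (partialT w q) (partialX (partialT w) q) ((partialX^[2]) (partialT w) q)
        (partialX w q) ((partialX^[2]) w q) ((partialX^[3]) w q) := by
    intro w hw q hq
    have hft : DifferentiableAt ℝ f q.1 :=
      (hf.contDiffAt (hI.mem_nhds hq.1)).differentiableAt (by simp)
    have hu : w q ≠ 0 ∨ 1 ≤ m - 1 := hmU.ne_zero_or hm₀ hm₁ hq.2.2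
    rw [(hasDerivAt_lhs hft hu _ _ _ _ _ _ _ _).deriv, prolongCoeff_partialT hD hτ hξ hη hw hq, prolongCoeff_partialX hD hτ hξ hη hw hq,
      prolongCoeff_partialX_three hD hτ hξ hη hw hq]
    rfl
  constructor
  · rintro h ⟨t, x, u⟩ hP r₀ r₁ r₂ p₁ p₂ p₃ h0
    have hv : ∀ u₀ r₀ r₁ r₂ p₁ p₂ p₃, jetFn t x u₀ r₀ r₁ r₂ p₁ p₂ p₃ (t, x) = u₀ := by
      intros
      simp [jetFn]
    have hg : graphPt (jetFn t x u r₀ r₁ r₂ p₁ p₂ p₃) (t, x) = (t, x, u) := by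
      simp [graphPt, hv]
    have h1 := h (jetFn t x u r₀ r₁ r₂ p₁ p₂ p₃) (contDiff_jetFn _ _ _ _ _ _ _ _ _) (t, x)
      (hg ▸ hP)
    rw [key _ (contDiff_jetFn _ _ _ _ _ _ _ _ _) _ (hg ▸ hP), hg] at h1
    simp only [Function.iterate_succ, Function.iterate_zero, Function.comp_apply, id_eq,
      partialT_jetFn, partialX_jetFn, hv] at h1
    exact h1 h0
  · intro h w hw q hq h0
    rw [key w hw q hq]
    exact h _ hq _ _ _ _ _ _ h0

/-! ### Functions with prescribed derivatives on an interval -/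

section Integration

variable {I : Set ℝ} {g : ℝ → ℝ}

theorem IsOpenInterval.eq_of_hasDerivAt_zero (hI : IsOpenInterval I)
    (h : ∀ y ∈ I, HasDerivAt g 0 y) {y z : ℝ} (hy : y ∈ I) (hz : z ∈ I) : g y = g z :=
  hI.isOpen.is_const_of_deriv_eq_zero hI.isPreconnected
    (fun y hy => (h y hy).differentiableAt.differentiableWithinAt) (fun y hy => (h y hy).deriv) hy hz

theorem IsOpenInterval.exists_quadratic (hI : IsOpenInterval I) {a b : ℝ}
    (h : ∀ y ∈ I, HasDerivAt g (2 * a * y + b) y) : ∃ c, ∀ y ∈ I, g y = a * y ^ 2 + b * y + c := by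
  obtain ⟨z, hz⟩ := hI.nonempty
  refine ⟨g z - (a * z ^ 2 + b * z), fun y hy => ?_⟩
  have h' : ∀ y ∈ I, HasDerivAt (fun y => g y - (a * y ^ 2 + b * y)) 0 y := fun y hy =>
    ((h y hy).sub (((hasDerivAt_pow 2 y).const_mul a).add
      ((hasDerivAt_id y).const_mul b))).congr_deriv (by norm_num; ring)
  have := hI.eq_of_hasDerivAt_zero h' hy hz
  linarith

theorem IsOpenInterval.exists_linear (hI : IsOpenInterval I) {b : ℝ}
    (h : ∀ y ∈ I, HasDerivAt g b y) : ∃ c, ∀ y ∈ I, g y = b * y + c := by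
  obtain ⟨c, hc⟩ := hI.exists_quadratic (a := 0) (b := b) (g := g) (by simpa using h)
  exact ⟨c, fun y hy => by rw [hc y hy]; ring⟩

theorem IsOpenInterval.infinite (hI : IsOpenInterval I) : I.Infinite :=
  have ⟨_, hz⟩ := hI.nonempty
  infinite_of_mem_nhds _ (hI.isOpen.mem_nhds hz)

theorem IsOpenInterval.exists_ne (hI : IsOpenInterval I) (z : ℝ) : ∃ y ∈ I, y ≠ z :=
  have ⟨y, hy, hyz⟩ := hI.infinite.exists_notMem_finset {z}
  ⟨y, hy, by simpa using hyz⟩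

/-- A quadratic polynomial vanishing on an infinite set is zero. -/
theorem coeffs_eq_zero_of_infinite {S : Set ℝ} (hS : S.Infinite) {a b c : ℝ}
    (h : ∀ y ∈ S, a * y ^ 2 + b * y + c = 0) : a = 0 ∧ b = 0 ∧ c = 0 := by
  obtain ⟨y₁, h₁, -⟩ := hS.exists_notMem_finset ∅
  obtain ⟨y₂, h₂, h₁₂⟩ := hS.exists_notMem_finset {y₁}
  obtain ⟨y₃, h₃, h₁₃⟩ := hS.exists_notMem_finset {y₁, y₂}
  simp only [Finset.mem_insert, Finset.mem_singleton, not_or] at h₁₂ h₁₃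
  have e₁ := h y₁ h₁
  have e₂ := h y₂ h₂
  have e₃ := h y₃ h₃
  have d₂ : a * (y₂ + y₁) + b = 0 :=
    mul_left_cancel₀ (sub_ne_zero.2 h₁₂) (by linear_combination e₂ - e₁)
  have d₃ : a * (y₃ + y₁) + b = 0 :=
    mul_left_cancel₀ (sub_ne_zero.2 h₁₃.1) (by linear_combination e₃ - e₁)
  have ha : a = 0 := mul_left_cancel₀ (sub_ne_zero.2 h₁₃.2) (by linear_combination d₃ - d₂)
  have hb : b = 0 := by simpa [ha] using d₂
  exact ⟨ha, hb, by simpa [ha, hb] using e₁⟩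

end Integration

/-! ### The determining equations -/

/-- The determining equations for the components of a Lie symmetry operator. -/
structure DeterminingEquations (m ε : ℝ) (f : ℝ → ℝ) (D : Set (ℝ × ℝ × ℝ))
    (τ ξ η : ℝ × ℝ × ℝ → ℝ) : Prop where
  dX_τ : ∀ P ∈ D, dX τ P = 0
  dU_τ : ∀ P ∈ D, dU τ P = 0
  dU_ξ : ∀ P ∈ D, dU ξ P = 0
  dU_dU_η : ∀ P ∈ D, dU (dU η) P = 0
  coeff : ∀ P ∈ D, f P.1 * dT τ P + τ P * deriv f P.1 = 3 * f P.1 * dX ξ P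
  convection : ∀ P ∈ D, ε * m * P.2.2 ^ (m - 1) * (dT τ P - dX ξ P) - dT ξ P
    + ε * m * (m - 1) * P.2.2 ^ (m - 1 - 1) * η P = 0
  evolution : ∀ P ∈ D, dT η P + ε * m * P.2.2 ^ (m - 1) * dX η P + f P.1 * dX (dX (dX η)) P = 0

section Determining

variable {I J U : Set ℝ} {g : ℝ × ℝ × ℝ → ℝ}

/-- The derivative in `x` of a function that depends on `t` only. -/
theorem dX_eq_zero {D : Set (ℝ × ℝ × ℝ)} (hD : IsOpen D) (hg : ContDiffOn ℝ ∞ g D) {A : ℝ → ℝ}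
    (h : ∀ P ∈ D, g P = A P.1) {P : ℝ × ℝ × ℝ} (hP : P ∈ D) : dX g P = 0 := by
  obtain ⟨t, x, u⟩ := P
  refine (hasDerivAt_x hD hg hP).unique ((hasDerivAt_const x (A t)).congr_of_eventuallyEq ?_)
  have : Continuous fun y : ℝ => (t, y, u) := by fun_prop
  filter_upwards [(hD.preimage this).mem_nhds hP] with y hy using h _ hy

theorem dU_eq_zero {D : Set (ℝ × ℝ × ℝ)} (hD : IsOpen D) (hg : ContDiffOn ℝ ∞ g D) {A : ℝ → ℝ}
    (h : ∀ P ∈ D, g P = A P.1) {P : ℝ × ℝ × ℝ} (hP : P ∈ D) : dU g P = 0 := by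
  obtain ⟨t, x, u⟩ := P
  refine (hasDerivAt_u hD hg hP).unique ((hasDerivAt_const u (A t)).congr_of_eventuallyEq ?_)
  have : Continuous fun v : ℝ => (t, x, v) := by fun_prop
  filter_upwards [(hD.preimage this).mem_nhds hP] with y hy using h _ hy

/-- A function whose derivatives in `x` and `u` vanish depends on `t` only. -/
theorem eq_of_dX_dU_eq_zero (hI : IsOpen I) (hJ : IsOpenInterval J) (hU : IsOpenInterval U)
    (hg : ContDiffOn ℝ ∞ g (I ×ˢ J ×ˢ U)) (hx : ∀ P ∈ I ×ˢ J ×ˢ U, dX g P = 0)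
    (hu : ∀ P ∈ I ×ˢ J ×ˢ U, dU g P = 0) {t x u x' u' : ℝ} (ht : t ∈ I) (hxJ : x ∈ J)
    (hxJ' : x' ∈ J) (huU : u ∈ U) (huU' : u' ∈ U) : g (t, x, u) = g (t, x', u') := by
  have hD : IsOpen (I ×ˢ J ×ˢ U) := hI.prod (hJ.isOpen.prod hU.isOpen)
  have h1 : g (t, x, u) = g (t, x', u) :=
    hJ.eq_of_hasDerivAt_zero (g := fun y => g (t, y, u)) (fun y hy => by
      simpa [hx (t, y, u) ⟨ht, hy, huU⟩] using hasDerivAt_x hD hg (x := y) ⟨ht, hy, huU⟩) hxJ hxJ'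
  have h2 : g (t, x', u) = g (t, x', u') :=
    hU.eq_of_hasDerivAt_zero (g := fun v => g (t, x', v)) (fun v hv => by
      simpa [hu (t, x', v) ⟨ht, hxJ', hv⟩] using hasDerivAt_u hD hg (u := v) ⟨ht, hxJ', hv⟩)
      huU huU'
  rw [h1, h2]

theorem dT_congr {D : Set (ℝ × ℝ × ℝ)} (hD : IsOpen D) (hg : ContDiffOn ℝ ∞ g D)
    {t x u a : ℝ} {A : ℝ → ℝ} (hP : (t, x, u) ∈ D) (h : ∀ P ∈ D, P.2.1 = x → P.2.2 = u → g P = A P.1)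
    (hA : HasDerivAt A a t) : dT g (t, x, u) = a := by
  refine (hasDerivAt_t hD hg hP).unique (hA.congr_of_eventuallyEq ?_)
  have : Continuous fun s : ℝ => (s, x, u) := by fun_prop
  filter_upwards [(hD.preimage this).mem_nhds hP] with y hy using h _ hy rfl rfl

/-- Splitting the invariance criterion with respect to the derivatives of `u`. -/
theorem determiningEquations_of_prolongedLhs {m ε : ℝ} {f : ℝ → ℝ} {τ ξ η : ℝ × ℝ × ℝ → ℝ}
    (hI : IsOpen I) (hJ : IsOpenInterval J) (hU : IsOpenInterval U) (hf : IsCoefficient I f)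
    (hτ : ContDiffOn ℝ ∞ τ (I ×ˢ J ×ˢ U)) (hξ : ContDiffOn ℝ ∞ ξ (I ×ˢ J ×ˢ U))
    (hη : ContDiffOn ℝ ∞ η (I ×ˢ J ×ˢ U))
    (h : ∀ P ∈ I ×ˢ J ×ˢ U, ∀ r₀ r₁ r₂ p₁ p₂ p₃ : ℝ, lhs m ε f P.1 P.2.2 r₀ p₁ p₃ = 0 →
      prolongedLhs m ε f τ ξ η P r₀ r₁ r₂ p₁ p₂ p₃ = 0) :
    DeterminingEquations m ε f (I ×ˢ J ×ˢ U) τ ξ η := by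
  have hD : IsOpen (I ×ˢ J ×ˢ U) := hI.prod (hJ.isOpen.prod hU.isOpen)
  set D := I ×ˢ J ×ˢ U with hDdef
  have hf0 : ∀ P ∈ D, f P.1 ≠ 0 := fun P hP => hf.ne_zero _ hP.1
  -- `u_t` is eliminated by means of the equation
  have h' : ∀ P ∈ D, ∀ r₁ r₂ p₁ p₂ p₃ : ℝ, prolongedLhs m ε f τ ξ η P
      (-(ε * (m * P.2.2 ^ (m - 1) * p₁) + f P.1 * p₃)) r₁ r₂ p₁ p₂ p₃ = 0 :=
    fun P hP r₁ r₂ p₁ p₂ p₃ => h P hP _ r₁ r₂ p₁ p₂ p₃ (by rw [lhs]; ring)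
  have zX : ∀ g, ContDiffOn ℝ ∞ g D → (∀ P ∈ D, g P = 0) → ∀ P ∈ D, dX g P = 0 :=
    fun g hg h0 P hP => dX_eq_zero hD hg (A := fun _ => 0) h0 hP
  have zU : ∀ g, ContDiffOn ℝ ∞ g D → (∀ P ∈ D, g P = 0) → ∀ P ∈ D, dU g P = 0 :=
    fun g hg h0 P hP => dU_eq_zero hD hg (A := fun _ => 0) h0 hP
  have sX : ∀ {g}, ContDiffOn ℝ ∞ g D → ContDiffOn ℝ ∞ (dX g) D := fun hg => contDiffOn_dX hD hg
  have sU : ∀ {g}, ContDiffOn ℝ ∞ g D → ContDiffOn ℝ ∞ (dU g) D := fun hg => contDiffOn_dU hD hg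
  -- coefficients of `u_txx`
  have τx : ∀ P ∈ D, dX τ P = 0 := fun P hP => by
    have e0 := h' P hP 0 0 0 0 0
    have e1 := h' P hP 0 1 0 0 0
    simp only [prolongedLhs, total₁] at e0 e1
    exact mul_left_cancel₀ (hf0 P hP) (by linear_combination (e0 - e1) / 3)
  have τu : ∀ P ∈ D, dU τ P = 0 := fun P hP => by
    have e0 := h' P hP 0 0 1 0 0
    have e1 := h' P hP 0 1 1 0 0
    simp only [prolongedLhs, total₁] at e0 e1
    exact mul_left_cancel₀ (hf0 P hP)
      (by linear_combination (e0 - e1) / 3 - f P.1 * τx P hP)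
  have τxx := zX _ (sX hτ) τx
  have τxu := zX _ (sU hτ) τu
  have τuu := zU _ (sU hτ) τu
  have τxxx := zX _ (sX (sX hτ)) τxx
  have τxxu := zX _ (sX (sU hτ)) τxu
  have τxuu := zX _ (sU (sU hτ)) τuu
  have τuuu := zU _ (sU (sU hτ)) τuu
  have t1 : ∀ P ∈ D, ∀ p₁, total₁ τ P p₁ = 0 := fun P hP p₁ => by
    simp [total₁, τx P hP, τu P hP]
  have t2 : ∀ P ∈ D, ∀ p₁ p₂, total₂ τ P p₁ p₂ = 0 := fun P hP p₁ p₂ => by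
    simp [total₂, τu P hP, τxx P hP, τxu P hP, τuu P hP]
  have t3 : ∀ P ∈ D, ∀ p₁ p₂ p₃, total₃ τ P p₁ p₂ p₃ = 0 := fun P hP p₁ p₂ p₃ => by
    simp [total₃, τu P hP, τxu P hP, τuu P hP, τxxx P hP, τxxu P hP, τxuu P hP, τuuu P hP]
  have h2 : ∀ P ∈ D, ∀ p₁ p₂ p₃ : ℝ,
      dT η P + (dU η P - dT τ P + -dU ξ P * p₁)
          * -(ε * (m * P.2.2 ^ (m - 1) * p₁) + f P.1 * p₃) - dT ξ P * p₁
        + ε * m * ((m - 1) * P.2.2 ^ (m - 1 - 1) * η P * p₁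
          + P.2.2 ^ (m - 1) * (total₁ η P p₁ - total₁ ξ P p₁ * p₁))
        + deriv f P.1 * τ P * p₃
        + f P.1 * (total₃ η P p₁ p₂ p₃ - (3 * total₁ ξ P p₁ * p₃ + 3 * total₂ ξ P p₁ p₂ * p₂
          + total₃ ξ P p₁ p₂ p₃ * p₁)) = 0 := fun P hP p₁ p₂ p₃ => by
    have e := h' P hP 0 0 p₁ p₂ p₃
    simp only [prolongedLhs, t1 P hP, t2 P hP, t3 P hP, τu P hP] at e
    linear_combination e
  -- coefficients of `u_xxx`
  have hco : ∀ P ∈ D, f P.1 * dT τ P + τ P * deriv f P.1 = 3 * f P.1 * dX ξ P := fun P hP => by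
    have e0 := h2 P hP 0 0 0
    have e1 := h2 P hP 0 0 1
    simp only [total₁, total₂, total₃] at e0 e1
    linear_combination e1 - e0
  have ξu : ∀ P ∈ D, dU ξ P = 0 := fun P hP => by
    have e0 := h2 P hP 1 0 0
    have e1 := h2 P hP 1 0 1
    simp only [total₁, total₂, total₃] at e0 e1
    exact mul_left_cancel₀ (hf0 P hP)
      (by linear_combination (e0 - e1) / 3 + hco P hP / 3)
  have ξxu := zX _ (sU hξ) ξu
  have ξuu := zU _ (sU hξ) ξu
  have ξxxu := zX _ (sX (sU hξ)) ξxu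
  have ξxuu := zX _ (sU (sU hξ)) ξuu
  have ξuuu := zU _ (sU (sU hξ)) ξuu
  -- `ξ_x` depends on `t` only
  have ξxx : ∀ P ∈ D, dX (dX ξ) P = 0 := by
    obtain ⟨x₀, hx₀⟩ := hJ.nonempty
    obtain ⟨u₀, hu₀⟩ := hU.nonempty
    refine fun P hP => dX_eq_zero hD (sX hξ) (A := fun t => dX ξ (t, x₀, u₀)) ?_ hP
    rintro ⟨t, x, u⟩ hP
    have hP₀ : (t, x₀, u₀) ∈ D := ⟨hP.1, hx₀, hu₀⟩
    have e1 := hco _ hP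
    have e2 := hco _ hP₀
    have e3 : τ (t, x, u) = τ (t, x₀, u₀) :=
      eq_of_dX_dU_eq_zero hI hJ hU hτ τx τu hP.1 hP.2.1 hx₀ hP.2.2 hu₀
    have e4 : dT τ (t, x, u) = dT τ (t, x₀, u₀) := by
      refine dT_congr hD hτ hP (A := fun t => τ (t, x₀, u₀)) ?_ (hasDerivAt_t hD hτ hP₀)
      rintro ⟨s, y, v⟩ hs rfl rfl
      exact eq_of_dX_dU_eq_zero hI hJ hU hτ τx τu hs.1 hP.2.1 hx₀ hP.2.2 hu₀
    simp only at e1 e2 ⊢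
    rw [e3, e4, e2] at e1
    exact (mul_left_cancel₀ (mul_ne_zero three_ne_zero (hf0 _ hP)) e1).symm
  have ξxxx := zX _ (sX (sX hξ)) ξxx
  -- coefficients of `u_xx` and `u_x u_xx`
  have ηxu : ∀ P ∈ D, dX (dU η) P = 0 := fun P hP => by
    have e0 := h2 P hP 0 0 0
    have e1 := h2 P hP 0 1 0
    simp only [total₁, total₂, total₃, ξu P hP, ξxx P hP]
      at e0 e1
    exact mul_left_cancel₀ (hf0 P hP) (by linear_combination (e1 - e0) / 3)
  have ηuu : ∀ P ∈ D, dU (dU η) P = 0 := fun P hP => by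
    have e0 := h2 P hP 1 0 0
    have e1 := h2 P hP 1 1 0
    simp only [total₁, total₂, total₃, ξu P hP, ξxx P hP,
      ξxu P hP, ξuu P hP, ηxu P hP] at e0 e1
    exact mul_left_cancel₀ (hf0 P hP) (by linear_combination (e1 - e0) / 3)
  have ηxxu := zX _ (sX (sU hη)) ηxu
  have ηxuu := zX _ (sU (sU hη)) ηuu
  have ηuuu := zU _ (sU (sU hη)) ηuu
  have hev : ∀ P ∈ D,
      dT η P + ε * m * P.2.2 ^ (m - 1) * dX η P + f P.1 * dX (dX (dX η)) P = 0 := fun P hP => by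
    have e0 := h2 P hP 0 0 0
    simp only [total₁, total₂, total₃] at e0
    linear_combination e0
  refine ⟨τx, τu, ξu, ηuu, hco, fun P hP => ?_, hev⟩
  have e1 := h2 P hP 1 0 0
  simp only [total₁, total₂, total₃, ξu P hP, ξxx P hP,
    ξxu P hP, ξuu P hP, ξxxx P hP, ξxxu P hP, ξxuu P hP, ξuuu P hP, ηxu P hP, ηuu P hP, ηxxu P hP,
    ηxuu P hP, ηuuu P hP] at e1
  linear_combination e1 - hev P hP

end Determining

/-! ### Solution of the determining equations -/

/-- `f` solves the linear equation `(a t² + b t + c) f' = (a t + e) f` on `I`. -/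
def SolvesODE (I : Set ℝ) (f : ℝ → ℝ) (a b c e : ℝ) : Prop :=
  ∀ t ∈ I, (a * t ^ 2 + b * t + c) * deriv f t = (a * t + e) * f t

/-- The polynomial vector fields among which all Lie symmetry operators are found. -/
def polyField (a₁ c₁ c₀ a₀ b₁ b₀ h n₁ n₀ : ℝ) : VectorField := vf fun t x u =>
  (a₁ * t ^ 2 + c₁ * t + c₀, (a₁ * t + a₀) * x + b₁ * t + b₀, (h - a₁ * t) * u + n₁ * x + n₀)

/-- A polynomial in `t`, `x`, `u` that is affine in `(x, u)`; this class is closed under partial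
derivatives. -/
def affinePoly (a b c d e k l : ℝ) : ℝ × ℝ × ℝ → ℝ := fun P =>
  a * P.1 ^ 2 + b * P.1 + c + (d * P.1 + e) * P.2.1 + (k * P.1 + l) * P.2.2

section AffinePoly

variable (a b c d e k l : ℝ)

theorem contDiff_affinePoly : ContDiff ℝ ∞ (affinePoly a b c d e k l) := by
  unfold affinePoly
  fun_prop

theorem dT_affinePoly : dT (affinePoly a b c d e k l) = affinePoly 0 (2 * a) b 0 d 0 k := by
  funext ⟨t, x, u⟩
  refine (hasDerivAt_t isOpen_univ (contDiff_affinePoly a b c d e k l).contDiffOn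
    (Set.mem_univ (t, x, u))).unique ((((((hasDerivAt_pow 2 t).const_mul a).add
    ((hasDerivAt_id t).const_mul b)).add_const c).add
    ((((hasDerivAt_id t).const_mul d).add_const e).mul_const x)).add
    ((((hasDerivAt_id t).const_mul k).add_const l).mul_const u) |>.congr_deriv ?_)
  simp only [affinePoly]
  norm_num
  ring

theorem dX_affinePoly : dX (affinePoly a b c d e k l) = affinePoly 0 d e 0 0 0 0 := by
  funext ⟨t, x, u⟩
  refine (hasDerivAt_x isOpen_univ (contDiff_affinePoly a b c d e k l).contDiffOn
    (Set.mem_univ (t, x, u))).unique ((((hasDerivAt_id x).const_mul (d * t + e)).const_add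
    (a * t ^ 2 + b * t + c)).add_const ((k * t + l) * u) |>.congr_deriv ?_)
  simp only [affinePoly]
  ring

theorem dU_affinePoly : dU (affinePoly a b c d e k l) = affinePoly 0 k l 0 0 0 0 := by
  funext ⟨t, x, u⟩
  refine (hasDerivAt_u isOpen_univ (contDiff_affinePoly a b c d e k l).contDiffOn
    (Set.mem_univ (t, x, u))).unique (((hasDerivAt_id u).const_mul (k * t + l)).const_add
    (a * t ^ 2 + b * t + c + (d * t + e) * x) |>.congr_deriv ?_)
  simp only [affinePoly]
  ring

end AffinePoly

theorem prolongedLhs_polyField (m ε : ℝ) (f : ℝ → ℝ) (a₁ c₁ c₀ a₀ b₁ b₀ h n₁ n₀ : ℝ)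
    (P : ℝ × ℝ × ℝ) (r₀ r₁ r₂ p₁ p₂ p₃ : ℝ) :
    prolongedLhs m ε f (fun P => (polyField a₁ c₁ c₀ a₀ b₁ b₀ h n₁ n₀ P).1)
      (fun P => (polyField a₁ c₁ c₀ a₀ b₁ b₀ h n₁ n₀ P).2.1)
      (fun P => (polyField a₁ c₁ c₀ a₀ b₁ b₀ h n₁ n₀ P).2.2) P r₀ r₁ r₂ p₁ p₂ p₃ =
    -a₁ * P.2.2 + (h - a₁ * P.1 - (2 * a₁ * P.1 + c₁)) * r₀ - (a₁ * P.2.1 + b₁) * p₁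
    + ε * m * ((m - 1) * P.2.2 ^ (m - 1 - 1) * ((h - a₁ * P.1) * P.2.2 + n₁ * P.2.1 + n₀) * p₁
      + P.2.2 ^ (m - 1) * (n₁ + (h - a₁ * P.1) * p₁ - (a₁ * P.1 + a₀) * p₁))
    + deriv f P.1 * (a₁ * P.1 ^ 2 + c₁ * P.1 + c₀) * p₃
    + f P.1 * ((h - a₁ * P.1) * p₃ - 3 * (a₁ * P.1 + a₀) * p₃) := by
  have eτ : (fun P => (polyField a₁ c₁ c₀ a₀ b₁ b₀ h n₁ n₀ P).1)
      = affinePoly a₁ c₁ c₀ 0 0 0 0 := by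
    funext P
    simp only [polyField, vf, affinePoly]
    ring
  have eξ : (fun P => (polyField a₁ c₁ c₀ a₀ b₁ b₀ h n₁ n₀ P).2.1)
      = affinePoly 0 b₁ b₀ a₁ a₀ 0 0 := by
    funext P
    simp only [polyField, vf, affinePoly]
    ring
  have eη : (fun P => (polyField a₁ c₁ c₀ a₀ b₁ b₀ h n₁ n₀ P).2.2)
      = affinePoly 0 0 n₀ 0 n₁ (-a₁) h := by
    funext P
    simp only [polyField, vf, affinePoly]
    ring
  rw [eτ, eξ, eη]
  simp only [prolongedLhs, total₁, total₂, total₃, dT_affinePoly, dX_affinePoly, dU_affinePoly]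
  simp only [affinePoly]
  ring

theorem contDiff_polyField (a₁ c₁ c₀ a₀ b₁ b₀ h n₁ n₀ : ℝ) :
    ContDiff ℝ ∞ (polyField a₁ c₁ c₀ a₀ b₁ b₀ h n₁ n₀) := by
  unfold polyField vf
  fun_prop

theorem IsPowerDomain.rpow_ne_zero {m : ℝ} {U : Set ℝ} (h : IsPowerDomain m U) {u : ℝ}
    (hu : u ∈ U) (hu0 : u ≠ 0) (n : ℤ) : u ^ (m - n) ≠ 0 := by
  have key : ∀ k : ℤ, m = k → u ^ (m - n) ≠ 0 := by
    rintro k rfl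
    rw [← Int.cast_sub, Real.rpow_intCast]
    exact zpow_ne_zero _ hu0
  rcases h with ⟨k, hk⟩ | ⟨⟨k, hk⟩, -⟩ | h
  · exact key k (by simpa using hk)
  · exact key k hk
  · exact (Real.rpow_pos_of_pos (h hu) _).ne'

/-- This holds at `u = 0` as well, since `0 ^ (m - 1) = 0` for `m ≠ 1`. -/
theorem rpow_sub_two_mul {m u : ℝ} (hm₁ : m ≠ 1) :
    u ^ (m - 1 - 1) * u = u ^ (m - 1) := by
  rcases eq_or_ne u 0 with rfl | hu
  · rw [mul_zero, Real.zero_rpow (sub_ne_zero.2 hm₁)]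
  · rw [Real.rpow_sub_one hu, div_mul_cancel₀ _ hu]

/-- The powers `u ^ (m - 1)`, `u ^ (m - 2)`, `1` are linearly independent if `m ≠ 1, 2`. -/
theorem IsPowerDomain.linearIndependent_powers {m : ℝ} {U : Set ℝ} (h : IsPowerDomain m U)
    (hU : IsOpenInterval U) (hm₁ : m ≠ 1) (hm₂ : m ≠ 2) {a b c : ℝ}
    (h0 : ∀ u ∈ U, a * u ^ (m - 1) + b * u ^ (m - 1 - 1) + c = 0) : a = 0 ∧ b = 0 ∧ c = 0 := by
  have h1 : ∀ u ∈ U \ {0}, 0 * u ^ 2 + a * (m - 1) * u + b * (m - 2) = 0 := by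
    rintro u ⟨hu, hu0⟩
    have hu0' : u ≠ 0 := hu0
    have hd : HasDerivAt (fun u : ℝ => a * u ^ (m - 1) + b * u ^ (m - 1 - 1) + c)
        (a * ((m - 1) * u ^ (m - 1 - 1)) + b * ((m - 1 - 1) * u ^ (m - 1 - 1 - 1))) u :=
      (((Real.hasDerivAt_rpow_const (Or.inl hu0')).const_mul a).add
        ((Real.hasDerivAt_rpow_const (Or.inl hu0')).const_mul b)).add_const c
    have hz := hd.unique ((hasDerivAt_const u (0 : ℝ)).congr_of_eventuallyEq
      (Filter.eventually_of_mem (hU.isOpen.mem_nhds hu) h0))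
    have hne : u ^ (m - 1 - 1 - 1) ≠ 0 := by
      have := h.rpow_ne_zero hu hu0' 3
      rwa [show m - 1 - 1 - 1 = m - ((3 : ℤ) : ℝ) by push_cast; ring]
    rw [Real.rpow_sub_one hu0' (m - 1 - 1)] at hz hne
    have hne' : u ^ (m - 1 - 1) ≠ 0 := fun h => hne (by rw [h, zero_div])
    field_simp at hz
    exact mul_left_cancel₀ hne' (by linear_combination hz)
  obtain ⟨-, ha, hb⟩ := coeffs_eq_zero_of_infinite (hU.infinite.sdiff (Set.finite_singleton 0)) h1
  have ha' : a = 0 := (mul_eq_zero.1 ha).resolve_right (sub_ne_zero.2 hm₁)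
  have hb' : b = 0 := (mul_eq_zero.1 hb).resolve_right (sub_ne_zero.2 hm₂)
  obtain ⟨u, hu⟩ := hU.nonempty
  exact ⟨ha', hb', by simpa [ha', hb'] using h0 u hu⟩

theorem hasDerivAt_of_smoothOn {I : Set ℝ} (hI : IsOpen I) {g : ℝ → ℝ} (hg : ContDiffOn ℝ ∞ g I) {t : ℝ}
    (ht : t ∈ I) : HasDerivAt g (deriv g t) t :=
  ((hg.contDiffAt (hI.mem_nhds ht)).differentiableAt (by simp)).hasDerivAt

theorem contDiffOn_deriv {I : Set ℝ} (hI : IsOpen I) {g : ℝ → ℝ} (hg : ContDiffOn ℝ ∞ g I) :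
    ContDiffOn ℝ ∞ (deriv g) I :=
  hg.deriv_of_isOpen hI (by simp)

section Solve

variable {m ε : ℝ} {f : ℝ → ℝ} {I J U : Set ℝ} {τ ξ η : ℝ × ℝ × ℝ → ℝ}

/-- First integration of the determining equations: `τ` depends on `t` only, and `ξ` is affine
in `x`. -/
theorem DeterminingEquations.exists_coefficients (hI : IsOpen I) (hJ : IsOpenInterval J)
    (hU : IsOpenInterval U) (hf : IsCoefficient I f)
    (hτ : ContDiffOn ℝ ∞ τ (I ×ˢ J ×ˢ U)) (hξ : ContDiffOn ℝ ∞ ξ (I ×ˢ J ×ˢ U))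
    (h : DeterminingEquations m ε f (I ×ˢ J ×ˢ U) τ ξ η) :
    ∃ T A B : ℝ → ℝ, ContDiffOn ℝ ∞ T I ∧ ContDiffOn ℝ ∞ A I ∧ ContDiffOn ℝ ∞ B I ∧
      (∀ P ∈ I ×ˢ J ×ˢ U, τ P = T P.1) ∧ (∀ P ∈ I ×ˢ J ×ˢ U, ξ P = A P.1 * P.2.1 + B P.1) ∧
      (∀ P ∈ I ×ˢ J ×ˢ U, dT τ P = deriv T P.1) ∧ (∀ P ∈ I ×ˢ J ×ˢ U, dX ξ P = A P.1) ∧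
      (∀ P ∈ I ×ˢ J ×ˢ U, dT ξ P = deriv A P.1 * P.2.1 + deriv B P.1) ∧
      ∀ t ∈ I, T t * deriv f t = (3 * A t - deriv T t) * f t := by
  have hD : IsOpen (I ×ˢ J ×ˢ U) := hI.prod (hJ.isOpen.prod hU.isOpen)
  obtain ⟨x₀, hx₀⟩ := hJ.nonempty
  obtain ⟨u₀, hu₀⟩ := hU.nonempty
  have slice : ∀ {g : ℝ × ℝ × ℝ → ℝ}, ContDiffOn ℝ ∞ g (I ×ˢ J ×ˢ U) →
      ContDiffOn ℝ ∞ (fun t => g (t, x₀, u₀)) I := fun hg =>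
    hg.comp (f := fun t : ℝ => ((t, x₀, u₀) : ℝ × ℝ × ℝ)) (by fun_prop)
      fun t ht => ⟨ht, hx₀, hu₀⟩
  have sT := slice hτ
  have sA := slice (contDiffOn_dX hD hξ)
  have sB := slice hξ
  set T := fun t => τ (t, x₀, u₀)
  set A := fun t => dX ξ (t, x₀, u₀)
  have hd : ∀ {g : ℝ → ℝ}, ContDiffOn ℝ ∞ g I → ∀ t ∈ I, HasDerivAt g (deriv g t) t :=
    fun hg _ ht => hasDerivAt_of_smoothOn hI hg ht
  have hτT : ∀ P ∈ I ×ˢ J ×ˢ U, τ P = T P.1 := fun P hP =>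
    eq_of_dX_dU_eq_zero hI hJ hU hτ h.dX_τ h.dU_τ hP.1 hP.2.1 hx₀ hP.2.2 hu₀
  have hτt : ∀ P ∈ I ×ˢ J ×ˢ U, dT τ P = deriv T P.1 := fun P hP =>
    dT_congr hD hτ hP (fun P' hP' _ _ => hτT P' hP') (hd sT _ hP.1)
  have hξx : ∀ P ∈ I ×ˢ J ×ˢ U, dX ξ P = A P.1 := by
    intro P hP
    have hP₀ : (P.1, x₀, u₀) ∈ I ×ˢ J ×ˢ U := ⟨hP.1, hx₀, hu₀⟩
    have e1 := h.coeff _ hP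
    have e2 := h.coeff _ hP₀
    rw [hτt _ hP, hτT _ hP] at e1
    rw [hτt _ hP₀, hτT _ hP₀, e1] at e2
    exact mul_left_cancel₀ (mul_ne_zero three_ne_zero (hf.ne_zero _ hP.1)) e2
  set B := fun t => ξ (t, x₀, u₀) - A t * x₀
  have sB' : ContDiffOn ℝ ∞ B I := sB.sub (sA.mul contDiffOn_const)
  have hξe : ∀ P ∈ I ×ˢ J ×ˢ U, ξ P = A P.1 * P.2.1 + B P.1 := by
    rintro ⟨t, x, u⟩ ⟨ht, hx, hu⟩
    have h1 : ξ (t, x, u) = ξ (t, x, u₀) :=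
      hU.eq_of_hasDerivAt_zero (g := fun v => ξ (t, x, v)) (fun v hv => by
        simpa [h.dU_ξ (t, x, v) ⟨ht, hx, hv⟩] using hasDerivAt_u hD hξ (u := v) ⟨ht, hx, hv⟩)
        hu hu₀
    obtain ⟨c, hc⟩ := hJ.exists_linear (g := fun y => ξ (t, y, u₀)) (b := A t) (fun y hy => by
      simpa [hξx (t, y, u₀) ⟨ht, hy, hu₀⟩] using hasDerivAt_x hD hξ (x := y) ⟨ht, hy, hu₀⟩)
    have h2 := hc x hx
    have h3 := hc x₀ hx₀
    simp only [B] at h2 h3 ⊢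
    linear_combination h1 + h2 - h3
  refine ⟨T, A, B, sT, sA, sB', hτT, hξe, hτt, hξx, ?_, ?_⟩
  · rintro ⟨t, x, u⟩ hP
    refine dT_congr hD hξ hP (A := fun t => A t * x + B t) ?_
      (((hd sA _ hP.1).mul_const x).add (hd sB' _ hP.1))
    rintro ⟨s, y, v⟩ hP' rfl rfl
    exact hξe _ hP'
  · intro t ht
    have hP₀ : (t, x₀, u₀) ∈ I ×ˢ J ×ˢ U := ⟨ht, hx₀, hu₀⟩
    have e := h.coeff _ hP₀
    rw [hτt _ hP₀, hτT _ hP₀, hξx _ hP₀] at e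
    simp only at e
    linear_combination e

/-- For `m ≠ 2` every Lie symmetry operator is polynomial. -/
theorem DeterminingEquations.exists_polyField (hm₀ : m ≠ 0) (hm₁ : m ≠ 1) (hm₂ : m ≠ 2)
    (hε : ε = 1 ∨ ε = -1) (hI : IsOpenInterval I) (hJ : IsOpenInterval J)
    (hU : IsOpenInterval U) (hmU : IsPowerDomain m U) (hf : IsCoefficient I f)
    (hτ : ContDiffOn ℝ ∞ τ (I ×ˢ J ×ˢ U)) (hξ : ContDiffOn ℝ ∞ ξ (I ×ˢ J ×ˢ U))
    (hη : ContDiffOn ℝ ∞ η (I ×ˢ J ×ˢ U))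
    (h : DeterminingEquations m ε f (I ×ˢ J ×ˢ U) τ ξ η) :
    ∃ c₁ c₀ a₀ b₀ : ℝ, SolvesODE I f 0 c₁ c₀ (3 * a₀ - c₁) ∧ ∀ P ∈ I ×ˢ J ×ˢ U,
      (τ P, ξ P, η P) = polyField 0 c₁ c₀ a₀ 0 b₀ ((a₀ - c₁) / (m - 1)) 0 0 P := by
  have hD : IsOpen (I ×ˢ J ×ˢ U) := hI.isOpen.prod (hJ.isOpen.prod hU.isOpen)
  have hε0 : ε ≠ 0 := by rcases hε with rfl | rfl <;> norm_num
  have hm1 : m - 1 ≠ 0 := sub_ne_zero.2 hm₁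
  obtain ⟨T, A, B, sT, sA, sB, hτT, hξe, hτt, hξx, hξt, hfT⟩ :=
    h.exists_coefficients hI.isOpen hJ hU hf hτ hξ
  have sT' := contDiffOn_deriv hI.isOpen sT
  obtain ⟨t₀, ht₀⟩ := hI.nonempty
  -- `η` is affine in `u`, so that the convection equation splits with respect to `u`
  have split : ∀ t ∈ I, ∀ x ∈ J, deriv A t * x + deriv B t = 0 ∧
      ∀ u ∈ U, η (t, x, u) = (A t - deriv T t) / (m - 1) * u := by
    intro t ht x hx
    obtain ⟨u₀, hu₀⟩ := hU.nonempty
    have hηu : ∀ u ∈ U, dU η (t, x, u) = dU η (t, x, u₀) := fun u hu =>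
      hU.eq_of_hasDerivAt_zero (g := fun v => dU η (t, x, v)) (fun v hv => by
        simpa [h.dU_dU_η (t, x, v) ⟨ht, hx, hv⟩] using
          hasDerivAt_u hD (contDiffOn_dU hD hη) (u := v) ⟨ht, hx, hv⟩) hu hu₀
    obtain ⟨β, hβ⟩ := hU.exists_linear (g := fun v => η (t, x, v)) (b := dU η (t, x, u₀))
      (fun v hv => by
        have := hasDerivAt_u hD hη (u := v) ⟨ht, hx, hv⟩
        rwa [hηu v hv] at this)
    set α := dU η (t, x, u₀)
    have e : ∀ u ∈ U, (ε * m * (deriv T t - A t) + ε * m * (m - 1) * α) * u ^ (m - 1)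
        + ε * m * (m - 1) * β * u ^ (m - 1 - 1) + -(deriv A t * x + deriv B t) = 0 := by
      intro u hu
      have hP : (t, x, u) ∈ I ×ˢ J ×ˢ U := ⟨ht, hx, hu⟩
      have e := h.convection _ hP
      rw [hτt _ hP, hξx _ hP, hξt _ hP] at e
      simp only at e
      rw [hβ u hu] at e
      linear_combination e - ε * m * (m - 1) * α * rpow_sub_two_mul (u := u) hm₁
    obtain ⟨e1, e2, e3⟩ := hmU.linearIndependent_powers hU hm₁ hm₂ e
    have hβ0 : β = 0 := by simpa [hε0, hm₀, hm1] using e2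
    have hα : α = (A t - deriv T t) / (m - 1) := by
      rw [eq_div_iff hm1]
      exact mul_left_cancel₀ (mul_ne_zero hε0 hm₀) (by linear_combination e1)
    refine ⟨by linear_combination -e3, fun u hu => ?_⟩
    rw [hβ u hu, hβ0, hα, add_zero]
  have hA' : ∀ t ∈ I, HasDerivAt A 0 t ∧ HasDerivAt B 0 t := by
    intro t ht
    obtain ⟨-, e1, e2⟩ := coeffs_eq_zero_of_infinite hJ.infinite (a := 0) (b := deriv A t)
      (c := deriv B t) (fun x hx => by linear_combination (split t ht x hx).1)
    exact ⟨e1 ▸ hasDerivAt_of_smoothOn hI.isOpen sA ht,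
      e2 ▸ hasDerivAt_of_smoothOn hI.isOpen sB ht⟩
  have hA : ∀ t ∈ I, A t = A t₀ := fun t ht =>
    hI.eq_of_hasDerivAt_zero (fun t ht => (hA' t ht).1) ht ht₀
  have hB : ∀ t ∈ I, B t = B t₀ := fun t ht =>
    hI.eq_of_hasDerivAt_zero (fun t ht => (hA' t ht).2) ht ht₀
  -- the evolution equation makes `τ` affine
  have hT' : ∀ t ∈ I, HasDerivAt (deriv T) 0 t := by
    intro t ht
    obtain ⟨x, hx⟩ := hJ.nonempty
    obtain ⟨u, hu, hu0⟩ := hU.exists_ne 0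
    have hP : (t, x, u) ∈ I ×ˢ J ×ˢ U := ⟨ht, hx, hu⟩
    have hηx : ∀ P ∈ I ×ˢ J ×ˢ U, dX η P = 0 := by
      rintro ⟨t, x, u⟩ hP
      refine (hasDerivAt_x hD hη hP).unique ((hasDerivAt_const x
        ((A t - deriv T t) / (m - 1) * u)).congr_of_eventuallyEq ?_)
      filter_upwards [hJ.isOpen.mem_nhds hP.2.1] with y hy using (split t hP.1 y hy).2 u hP.2.2
    have hηxx : ∀ P ∈ I ×ˢ J ×ˢ U, dX (dX η) P = 0 := fun P hP =>
      dX_eq_zero hD (contDiffOn_dX hD hη) (A := fun _ => 0) hηx hP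
    have hηxxx : ∀ P ∈ I ×ˢ J ×ˢ U, dX (dX (dX η)) P = 0 := fun P hP =>
      dX_eq_zero hD (contDiffOn_dX hD (contDiffOn_dX hD hη)) (A := fun _ => 0) hηxx hP
    have hTt := hasDerivAt_of_smoothOn hI.isOpen sT' ht
    have hηt : dT η (t, x, u) = (0 - deriv (deriv T) t) / (m - 1) * u := by
      refine dT_congr hD hη hP (A := fun t => (A t - deriv T t) / (m - 1) * u) ?_
        ((((hA' t ht).1.sub hTt).div_const (m - 1)).mul_const u)
      rintro ⟨s, y, v⟩ hP' rfl rfl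
      exact (split s hP'.1 y hP'.2.1).2 v hP'.2.2
    have e := h.evolution _ hP
    rw [hηx _ hP, hηxxx _ hP, hηt] at e
    have : deriv (deriv T) t = 0 := by
      field_simp at e
      simpa [hu0, hm1] using e
    exact this ▸ hTt
  have hT : ∀ t ∈ I, deriv T t = deriv T t₀ := fun t ht =>
    hI.eq_of_hasDerivAt_zero hT' ht ht₀
  obtain ⟨c₀, hc₀⟩ := hI.exists_linear (g := T) (b := deriv T t₀) fun t ht =>
    hT t ht ▸ hasDerivAt_of_smoothOn hI.isOpen sT ht
  refine ⟨deriv T t₀, c₀, A t₀, B t₀, fun t ht => ?_, ?_⟩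
  · have e := hfT t ht
    rw [hc₀ t ht, hT t ht, hA t ht] at e
    linear_combination e
  · rintro ⟨t, x, u⟩ hP
    rw [hτT _ hP, hξe _ hP, (split t hP.1 x hP.2.1).2 u hP.2.2, hc₀ _ hP.1, hA _ hP.1, hB _ hP.1,
      hT _ hP.1]
    simp only [polyField, vf, Prod.mk.injEq]
    exact ⟨by ring, by ring, by ring⟩

/-- For `m = 2` every Lie symmetry operator is polynomial. -/
theorem DeterminingEquations.exists_polyField_two
    (hε : ε = 1 ∨ ε = -1) (hI : IsOpenInterval I) (hJ : IsOpenInterval J)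
    (hU : IsOpenInterval U) (hf : IsCoefficient I f)
    (hτ : ContDiffOn ℝ ∞ τ (I ×ˢ J ×ˢ U)) (hξ : ContDiffOn ℝ ∞ ξ (I ×ˢ J ×ˢ U))
    (hη : ContDiffOn ℝ ∞ η (I ×ˢ J ×ˢ U))
    (h : DeterminingEquations 2 ε f (I ×ˢ J ×ˢ U) τ ξ η) :
    ∃ a₁ c₁ c₀ a₀ b₁ b₀ : ℝ, SolvesODE I f a₁ c₁ c₀ (3 * a₀ - c₁) ∧ ∀ P ∈ I ×ˢ J ×ˢ U,
      (τ P, ξ P, η P) =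
        polyField a₁ c₁ c₀ a₀ b₁ b₀ (a₀ - c₁) (ε / 2 * a₁) (ε / 2 * b₁) P := by
  have hD : IsOpen (I ×ˢ J ×ˢ U) := hI.isOpen.prod (hJ.isOpen.prod hU.isOpen)
  have hε2 : ε * ε = 1 := by rcases hε with rfl | rfl <;> norm_num
  obtain ⟨T, A, B, sT, sA, sB, hτT, hξe, hτt, hξx, hξt, hfT⟩ :=
    h.exists_coefficients hI.isOpen hJ hU hf hτ hξ
  have sT' := contDiffOn_deriv hI.isOpen sT
  have sA' := contDiffOn_deriv hI.isOpen sA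
  have sB' := contDiffOn_deriv hI.isOpen sB
  obtain ⟨t₀, ht₀⟩ := hI.nonempty
  -- the convection equation determines `η`
  have hηe : ∀ P ∈ I ×ˢ J ×ˢ U, η P = (A P.1 - deriv T P.1) * P.2.2
      + ε / 2 * (deriv A P.1 * P.2.1 + deriv B P.1) := by
    intro P hP
    have e := h.convection _ hP
    rw [hτt _ hP, hξx _ hP, hξt _ hP, show (2 : ℝ) - 1 = 1 by norm_num, sub_self, Real.rpow_one,
      Real.rpow_zero] at e
    linear_combination ε / 2 * e + (P.2.2 * (A P.1 - deriv T P.1) - η P) * hε2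
  have hηx : ∀ P ∈ I ×ˢ J ×ˢ U, dX η P = ε / 2 * deriv A P.1 := by
    rintro ⟨t, x, u⟩ hP
    refine (hasDerivAt_x hD hη hP).unique ((((((hasDerivAt_id x).const_mul (deriv A t)).add_const
      (deriv B t)).const_mul (ε / 2)).const_add ((A t - deriv T t) * u)
      |>.congr_of_eventuallyEq ?_).congr_deriv (by simp))
    filter_upwards [hJ.isOpen.mem_nhds hP.2.1] with y hy using hηe (t, y, u) ⟨hP.1, hy, hP.2.2⟩
  have hηxx : ∀ P ∈ I ×ˢ J ×ˢ U, dX (dX η) P = 0 := fun P hP =>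
    dX_eq_zero hD (contDiffOn_dX hD hη) (A := fun t => ε / 2 * deriv A t) hηx hP
  have hηxxx : ∀ P ∈ I ×ˢ J ×ˢ U, dX (dX (dX η)) P = 0 := fun P hP =>
    dX_eq_zero hD (contDiffOn_dX hD (contDiffOn_dX hD hη)) (A := fun _ => 0) hηxx hP
  have hev : ∀ P ∈ I ×ˢ J ×ˢ U, P.2.2 * (2 * deriv A P.1 - deriv (deriv T) P.1)
      + ε / 2 * (deriv (deriv A) P.1 * P.2.1 + deriv (deriv B) P.1) = 0 := by
    rintro ⟨t, x, u⟩ hP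
    have hd : ∀ {g : ℝ → ℝ}, ContDiffOn ℝ ∞ g I → HasDerivAt g (deriv g t) t :=
      fun hg => hasDerivAt_of_smoothOn hI.isOpen hg hP.1
    have hηt : dT η (t, x, u) = (deriv A t - deriv (deriv T) t) * u
        + ε / 2 * (deriv (deriv A) t * x + deriv (deriv B) t) := by
      refine dT_congr hD hη hP
        (A := fun t => (A t - deriv T t) * u + ε / 2 * (deriv A t * x + deriv B t)) ?_
        ((((hd sA).sub (hd sT')).mul_const u).add
          ((((hd sA').mul_const x).add (hd sB')).const_mul (ε / 2)))
      rintro ⟨s, y, v⟩ hP' rfl rfl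
      exact hηe _ hP'
    have e := h.evolution _ hP
    rw [hηx _ hP, hηxxx _ hP, hηt, show (2 : ℝ) - 1 = 1 by norm_num, Real.rpow_one] at e
    linear_combination e - u * deriv A t * hε2
  have hev' : ∀ t ∈ I, deriv (deriv A) t = 0 ∧ deriv (deriv B) t = 0 ∧
      2 * deriv A t - deriv (deriv T) t = 0 := by
    intro t ht
    have hx : ∀ x ∈ J, 2 * deriv A t - deriv (deriv T) t = 0 ∧
        ε / 2 * (deriv (deriv A) t * x + deriv (deriv B) t) = 0 := fun x hx =>
      (coeffs_eq_zero_of_infinite hU.infinite (a := 0) fun u hu => by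
        linear_combination hev (t, x, u) ⟨ht, hx, hu⟩).2
    obtain ⟨x₀, hx₀⟩ := hJ.nonempty
    obtain ⟨-, e1, e2⟩ := coeffs_eq_zero_of_infinite hJ.infinite (a := 0)
      (b := deriv (deriv A) t) (c := deriv (deriv B) t) fun x hxJ => by
        linear_combination 2 * ε * (hx x hxJ).2
          - (deriv (deriv A) t * x + deriv (deriv B) t) * hε2
    exact ⟨e1, e2, (hx x₀ hx₀).1⟩
  have hA' : ∀ t ∈ I, deriv A t = deriv A t₀ := fun t ht =>
    hI.eq_of_hasDerivAt_zero (fun t ht =>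
      (hev' t ht).1 ▸ hasDerivAt_of_smoothOn hI.isOpen sA' ht) ht ht₀
  have hB' : ∀ t ∈ I, deriv B t = deriv B t₀ := fun t ht =>
    hI.eq_of_hasDerivAt_zero (fun t ht =>
      (hev' t ht).2.1 ▸ hasDerivAt_of_smoothOn hI.isOpen sB' ht) ht ht₀
  obtain ⟨a₀, hA⟩ := hI.exists_linear fun t ht =>
    hA' t ht ▸ hasDerivAt_of_smoothOn hI.isOpen sA ht
  obtain ⟨b₀, hB⟩ := hI.exists_linear fun t ht =>
    hB' t ht ▸ hasDerivAt_of_smoothOn hI.isOpen sB ht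
  set a₁ := deriv A t₀
  set b₁ := deriv B t₀
  obtain ⟨c₁, hT'⟩ := hI.exists_linear (g := deriv T) (b := 2 * a₁) fun t ht =>
    (hasDerivAt_of_smoothOn hI.isOpen sT' ht).congr_deriv (by
      have := (hev' t ht).2.2
      rw [hA' t ht] at this
      linear_combination -this)
  obtain ⟨c₀, hT⟩ := hI.exists_quadratic (g := T) (a := a₁) (b := c₁) fun t ht =>
    hT' t ht ▸ hasDerivAt_of_smoothOn hI.isOpen sT ht
  refine ⟨a₁, c₁, c₀, a₀, b₁, b₀, fun t ht => ?_, ?_⟩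
  · have e := hfT t ht
    rw [hT t ht, hT' t ht, hA t ht] at e
    linear_combination e
  · rintro ⟨t, x, u⟩ hP
    rw [hτT _ hP, hξe _ hP, hηe _ hP, hT _ hP.1, hT' _ hP.1, hA _ hP.1, hB _ hP.1, hA' _ hP.1,
      hB' _ hP.1]
    simp only [polyField, vf, Prod.mk.injEq]
    exact ⟨trivial, by ring, by ring⟩

end Solve

/-! ### The maximal Lie invariance algebra -/

section MaximalAlgebra

variable {m ε : ℝ} {f : ℝ → ℝ} {I J U : Set ℝ}

/-- The maximal algebra for `m ≠ 2`.  The linear equation is `(τ f)' = 3 ξ_x f` with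
`τ = c₁ t + c₀` and `ξ_x = a₀`. -/
theorem mem_maximalAlgebra_iff (hm₀ : m ≠ 0) (hm₁ : m ≠ 1) (hm₂ : m ≠ 2)
    (hε : ε = 1 ∨ ε = -1) (hI : IsOpenInterval I) (hJ : IsOpenInterval J)
    (hU : IsOpenInterval U) (hmU : IsPowerDomain m U) (hf : IsCoefficient I f)
    {v : ↥(I ×ˢ J ×ˢ U) → ℝ × ℝ × ℝ} :
    v ∈ maximalAlgebra m ε f (I ×ˢ J ×ˢ U) ↔ ∃ c₁ c₀ a₀ b₀ : ℝ,
      SolvesODE I f 0 c₁ c₀ (3 * a₀ - c₁) ∧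
      v = (I ×ˢ J ×ˢ U).domRestrict (polyField 0 c₁ c₀ a₀ 0 b₀ ((a₀ - c₁) / (m - 1)) 0 0) := by
  have iff := @isLieSymmetry_iff m ε f I J U hm₀ hm₁ hI.isOpen hJ.isOpen hU.isOpen hmU hf.smooth
  constructor
  · rintro ⟨Γ, hΓ, rfl⟩
    obtain ⟨hs, hΓ⟩ := iff.1 hΓ
    obtain ⟨c₁, c₀, a₀, b₀, h1, h2⟩ := (determiningEquations_of_prolongedLhs hI.isOpen hJ hU hf
      hs.fst hs.snd.fst hs.snd.snd hΓ).exists_polyField hm₀ hm₁ hm₂ hε hI hJ hU hmU hf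
      hs.fst hs.snd.fst hs.snd.snd
    exact ⟨c₁, c₀, a₀, b₀, h1, funext fun P => h2 P P.2⟩
  · rintro ⟨c₁, c₀, a₀, b₀, h1, rfl⟩
    refine ⟨_, iff.2 ⟨(contDiff_polyField ..).contDiffOn, fun P hP r₀ r₁ r₂ p₁ p₂ p₃ h0 => ?_⟩, rfl⟩
    rw [prolongedLhs_polyField]
    have e := h1 P.1 hP.1
    have hh : (a₀ - c₁) / (m - 1) * (m - 1) = a₀ - c₁ := div_mul_cancel₀ _ (sub_ne_zero.2 hm₁)
    have hp := rpow_sub_two_mul (u := P.2.2) hm₁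
    rw [lhs] at h0
    set h := (a₀ - c₁) / (m - 1)
    linear_combination (h - c₁) * h0 + p₃ * e + ε * m * (m - 1) * h * p₁ * hp
      + ε * m * p₁ * P.2.2 ^ (m - 1) * hh

/-- The maximal algebra for `m = 2`.  The linear equation is `(τ f)' = 3 ξ_x f` with
`τ = a₁ t² + c₁ t + c₀` and `ξ_x = a₁ t + a₀`; moreover, `1 / (2 ε) = ε / 2`. -/
theorem mem_maximalAlgebra_two_iff
    (hε : ε = 1 ∨ ε = -1) (hI : IsOpenInterval I) (hJ : IsOpenInterval J)
    (hU : IsOpenInterval U) (hf : IsCoefficient I f)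
    {v : ↥(I ×ˢ J ×ˢ U) → ℝ × ℝ × ℝ} :
    v ∈ maximalAlgebra 2 ε f (I ×ˢ J ×ˢ U) ↔ ∃ a₁ c₁ c₀ a₀ b₁ b₀ : ℝ,
      SolvesODE I f a₁ c₁ c₀ (3 * a₀ - c₁) ∧
      v = (I ×ˢ J ×ˢ U).domRestrict
        (polyField a₁ c₁ c₀ a₀ b₁ b₀ (a₀ - c₁) (ε / 2 * a₁) (ε / 2 * b₁)) := by
  have iff := @isLieSymmetry_iff 2 ε f I J U two_ne_zero (by norm_num) hI.isOpen hJ.isOpen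
    hU.isOpen (Or.inl ⟨2, by norm_num⟩) hf.smooth
  constructor
  · rintro ⟨Γ, hΓ, rfl⟩
    obtain ⟨hs, hΓ⟩ := iff.1 hΓ
    obtain ⟨a₁, c₁, c₀, a₀, b₁, b₀, h1, h2⟩ := (determiningEquations_of_prolongedLhs hI.isOpen hJ
      hU hf hs.fst hs.snd.fst hs.snd.snd hΓ).exists_polyField_two hε hI hJ hU hf
      hs.fst hs.snd.fst hs.snd.snd
    exact ⟨a₁, c₁, c₀, a₀, b₁, b₀, h1, funext fun P => h2 P P.2⟩
  · rintro ⟨a₁, c₁, c₀, a₀, b₁, b₀, h1, rfl⟩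
    refine ⟨_, iff.2 ⟨(contDiff_polyField ..).contDiffOn, fun P hP r₀ r₁ r₂ p₁ p₂ p₃ h0 => ?_⟩, rfl⟩
    rw [prolongedLhs_polyField]
    have e := h1 P.1 hP.1
    have hε2 : ε * ε = 1 := by rcases hε with rfl | rfl <;> norm_num
    rw [lhs, show (2 : ℝ) - 1 = 1 by norm_num, Real.rpow_one] at h0
    rw [show (2 : ℝ) - 1 = 1 by norm_num, sub_self, Real.rpow_one, Real.rpow_zero]
    linear_combination (a₀ - c₁ - a₁ * P.1 - (2 * a₁ * P.1 + c₁)) * h0 + p₃ * e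
      + (P.2.2 * a₁ + a₁ * P.2.1 * p₁ + b₁ * p₁) * hε2

end MaximalAlgebra

/-! ### The linear equations satisfied by the special coefficient functions -/

section NormalForms

variable {I : Set ℝ} {f : ℝ → ℝ}

/-- If `q f' = p f` with `q` nonvanishing, then the equation `(a t² + b t + c) f' = (a t + e) f`
reduces to an identity between functions of `t`. -/
theorem solvesODE_iff_of_logDeriv {p q : ℝ → ℝ} (hf : ∀ t ∈ I, f t ≠ 0) (hq : ∀ t ∈ I, q t ≠ 0)
    (h : ∀ t ∈ I, q t * deriv f t = p t * f t) {a b c e : ℝ} :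
    SolvesODE I f a b c e ↔
      ∀ t ∈ I, (a * t ^ 2 + b * t + c) * p t = (a * t + e) * q t := by
  refine forall₂_congr fun t ht => ⟨fun h1 => ?_, fun h1 => ?_⟩
  · exact mul_right_cancel₀ (hf t ht)
      (by linear_combination q t * h1 - (a * t ^ 2 + b * t + c) * h t ht)
  · exact mul_left_cancel₀ (hq t ht)
      (by linear_combination f t * h1 + (a * t ^ 2 + b * t + c) * h t ht)

theorem power_ne_zero {k t : ℝ} (ht : t ∈ (NormalForm.power k).domain) :
    t ≠ 0 ∧ (NormalForm.power k).fn t ≠ 0 := by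
  rcases ht with h | ⟨h, n, rfl⟩
  · exact ⟨h.ne', (Real.rpow_pos_of_pos h k).ne'⟩
  · refine ⟨h.ne, ?_⟩
    change t ^ (n : ℝ) ≠ 0
    rw [Real.rpow_intCast]
    exact zpow_ne_zero _ h.ne

theorem deriv_power {k t : ℝ} (ht : t ≠ 0) :
    t * deriv (NormalForm.power k).fn t = k * (NormalForm.power k).fn t := by
  change t * deriv (fun t : ℝ => t ^ k) t = k * t ^ k
  rw [(Real.hasDerivAt_rpow_const (Or.inl ht)).deriv, Real.rpow_sub_one ht]
  field_simp

theorem deriv_arctan (k t : ℝ) :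
    (t ^ 2 + 1) * deriv (NormalForm.arctan k).fn t = (t + k) * (NormalForm.arctan k).fn t := by
  have hpos : 0 < t ^ 2 + 1 := by positivity
  have h1 : HasDerivAt (fun t : ℝ => Real.exp (k * Real.arctan t))
      (Real.exp (k * Real.arctan t) * (k * (1 / (1 + t ^ 2)))) t :=
    ((Real.hasDerivAt_arctan t).const_mul k).exp
  have h2 : HasDerivAt (fun t : ℝ => Real.sqrt (t ^ 2 + 1))
      (2 * t / (2 * Real.sqrt (t ^ 2 + 1))) t := by
    simpa using ((hasDerivAt_pow 2 t).add_const 1).sqrt hpos.ne'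
  have h3 := (h1.mul h2).deriv
  change (t ^ 2 + 1) * deriv ((fun t : ℝ => Real.exp (k * Real.arctan t)) *
    fun t : ℝ => Real.sqrt (t ^ 2 + 1)) t
    = (t + k) * (Real.exp (k * Real.arctan t) * Real.sqrt (t ^ 2 + 1))
  rw [h3]
  have hs : Real.sqrt (t ^ 2 + 1) ≠ 0 := (Real.sqrt_pos.2 hpos).ne'
  have hs2 : Real.sqrt (t ^ 2 + 1) ^ 2 = t ^ 2 + 1 := Real.sq_sqrt hpos.le
  have hp' : 1 + t ^ 2 ≠ 0 := by positivity
  field_simp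
  rw [hs2]
  ring

theorem NormalForm.fn_ne_zero {c : NormalForm} {t : ℝ} (ht : t ∈ c.domain) : c.fn t ≠ 0 := by
  cases c with
  | one => exact one_ne_zero
  | power k => exact (power_ne_zero ht).2
  | exp => exact (Real.exp_pos t).ne'
  | arctan k =>
    have : 0 < t ^ 2 + 1 := by positivity
    exact mul_ne_zero (Real.exp_pos _).ne' (Real.sqrt_pos.2 this).ne'

theorem NormalForm.contDiffAt_fn {c : NormalForm} {t : ℝ} (ht : t ∈ c.domain) :
    ContDiffAt ℝ ∞ c.fn t := by
  cases c with
  | one => exact contDiffAt_const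
  | power k => exact Real.contDiffAt_rpow_const_of_ne (power_ne_zero ht).1
  | exp => exact Real.contDiff_exp.contDiffAt
  | arctan k =>
    have : t ^ 2 + 1 ≠ 0 := by positivity
    exact (contDiffAt_const.mul Real.contDiff_arctan.contDiffAt).exp.mul
      (((contDiffAt_id.pow 2).add contDiffAt_const).sqrt this)

theorem NormalForm.isCoefficient {c : NormalForm} (h : I ⊆ c.domain) : IsCoefficient I c.fn :=
  ⟨fun _ ht => (contDiffAt_fn (h ht)).contDiffWithinAt, fun _ ht => fn_ne_zero (h ht)⟩

variable (hI : IsOpenInterval I) {a b c e : ℝ}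
include hI

theorem solvesODE_one_iff : SolvesODE I NormalForm.one.fn a b c e ↔ a = 0 ∧ e = 0 := by
  rw [solvesODE_iff_of_logDeriv (f := NormalForm.one.fn) (q := fun _ => 1) (p := fun _ => 0) (fun _ _ => one_ne_zero)
    (fun _ _ => one_ne_zero) (fun t _ => by
      change 1 * deriv (fun _ : ℝ => (1 : ℝ)) t = 0 * 1
      simp)]
  constructor
  · intro h
    exact (coeffs_eq_zero_of_infinite hI.infinite (a := 0) fun t ht => by
      linear_combination -h t ht).2
  · rintro ⟨rfl, rfl⟩ t -
    ring

theorem solvesODE_power_iff {k : ℝ} (hk : k ≠ 0) (hd : I ⊆ (NormalForm.power k).domain) :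
    SolvesODE I (NormalForm.power k).fn a b c e ↔ a * (k - 1) = 0 ∧ e = k * b ∧ c = 0 := by
  rw [solvesODE_iff_of_logDeriv (q := fun t => t) (p := fun _ => k)
    (fun t ht => NormalForm.fn_ne_zero (hd ht)) (fun t ht => (power_ne_zero (hd ht)).1)
    (fun t ht => deriv_power (power_ne_zero (hd ht)).1)]
  constructor
  · intro h
    obtain ⟨h1, h2, h3⟩ := coeffs_eq_zero_of_infinite hI.infinite (a := a * (k - 1))
      (b := k * b - e) (c := c * k) fun t ht => by linear_combination h t ht
    exact ⟨h1, by linear_combination -h2, (mul_eq_zero.1 h3).resolve_right hk⟩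
  · rintro ⟨h1, rfl, rfl⟩ t -
    linear_combination t ^ 2 * h1

theorem solvesODE_exp_iff : SolvesODE I NormalForm.exp.fn a b c e ↔ a = 0 ∧ b = 0 ∧ e = c := by
  rw [solvesODE_iff_of_logDeriv (f := NormalForm.exp.fn) (q := fun _ => 1) (p := fun _ => 1)
    (fun t _ => (Real.exp_pos t).ne') (fun _ _ => one_ne_zero) (fun t _ => by
      change 1 * deriv Real.exp t = 1 * Real.exp t
      rw [Real.deriv_exp])]
  constructor
  · intro h
    obtain ⟨rfl, h2, h3⟩ := coeffs_eq_zero_of_infinite hI.infinite (a := a) (b := b - a)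
      (c := c - e) fun t ht => by linear_combination h t ht
    exact ⟨rfl, by linear_combination h2, by linear_combination -h3⟩
  · rintro ⟨rfl, rfl, rfl⟩ t -
    ring

theorem solvesODE_arctan_iff {k : ℝ} :
    SolvesODE I (NormalForm.arctan k).fn a b c e ↔ b = 0 ∧ c = a ∧ e = a * k := by
  rw [solvesODE_iff_of_logDeriv (q := fun t => t ^ 2 + 1) (p := fun t => t + k)
    (fun t _ => NormalForm.fn_ne_zero (Set.mem_univ t)) (fun t _ => by positivity)
    (fun t _ => deriv_arctan k t)]
  constructor
  · intro h
    obtain ⟨h1, h2, h3⟩ := coeffs_eq_zero_of_infinite hI.infinite (a := a * k + b - e)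
      (b := b * k + c - a) (c := c * k - e) fun t ht => by linear_combination h t ht
    have h4 : (k ^ 2 + 1) * b = 0 := by linear_combination h1 - h3 + k * h2
    have hb : b = 0 := (mul_eq_zero.1 h4).resolve_left (by positivity)
    subst hb
    exact ⟨rfl, by linear_combination h2, by linear_combination -h1⟩
  · rintro ⟨rfl, rfl, rfl⟩ t -
    ring

end NormalForms

/-! ### Bases of the invariance algebras -/

section Bases

variable {m ε : ℝ} {f : ℝ → ℝ} {I J U : Set ℝ}

/-- On a product of open intervals a polynomial vector field determines its coefficients. -/
theorem polyField_injective (hI : IsOpenInterval I) (hJ : IsOpenInterval J)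
    (hU : IsOpenInterval U) {a₁ c₁ c₀ a₀ b₁ b₀ h n₁ n₀ a₁' c₁' c₀' a₀' b₁' b₀' h' n₁' n₀' : ℝ}
    (e : ∀ P ∈ I ×ˢ J ×ˢ U, polyField a₁ c₁ c₀ a₀ b₁ b₀ h n₁ n₀ P
      = polyField a₁' c₁' c₀' a₀' b₁' b₀' h' n₁' n₀' P) :
    (a₁ = a₁' ∧ c₁ = c₁' ∧ c₀ = c₀' ∧ a₀ = a₀' ∧ b₁ = b₁' ∧ b₀ = b₀') ∧
      h = h' ∧ n₁ = n₁' ∧ n₀ = n₀' := by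
  have e' : ∀ t ∈ I, ∀ x ∈ J, ∀ u ∈ U,
      (a₁ * t ^ 2 + c₁ * t + c₀ = a₁' * t ^ 2 + c₁' * t + c₀' ∧
      (a₁ * t + a₀) * x + b₁ * t + b₀ = (a₁' * t + a₀') * x + b₁' * t + b₀') ∧
      (h - a₁ * t) * u + n₁ * x + n₀ = (h' - a₁' * t) * u + n₁' * x + n₀' :=
    fun t ht x hx u hu => by
      have := e (t, x, u) ⟨ht, hx, hu⟩
      simp only [polyField, vf, Prod.mk.injEq] at this
      exact ⟨⟨this.1, this.2.1⟩, this.2.2⟩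
  obtain ⟨t₀, ht₀⟩ := hI.nonempty
  obtain ⟨x₀, hx₀⟩ := hJ.nonempty
  obtain ⟨u₀, hu₀⟩ := hU.nonempty
  obtain ⟨h1, h2, h3⟩ := coeffs_eq_zero_of_infinite hI.infinite (a := a₁ - a₁') (b := c₁ - c₁')
    (c := c₀ - c₀') fun t ht => by linear_combination (e' t ht x₀ hx₀ u₀ hu₀).1.1
  have hx : ∀ t ∈ I, _ := fun t ht =>
    (coeffs_eq_zero_of_infinite hJ.infinite (a := 0) (b := (a₁ - a₁') * t + (a₀ - a₀'))
      (c := (b₁ - b₁') * t + (b₀ - b₀')) fun x hx => by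
        linear_combination (e' t ht x hx u₀ hu₀).1.2).2
  obtain ⟨-, h5, h6⟩ := coeffs_eq_zero_of_infinite hI.infinite (a := 0) (b := b₁ - b₁')
    (c := b₀ - b₀') fun t ht => by linear_combination (hx t ht).2
  have h4 := (hx t₀ ht₀).1
  rw [h1, zero_mul, zero_add] at h4
  have hu : ∀ x ∈ J, h - h' = 0 ∧ (n₁ - n₁') * x + (n₀ - n₀') = 0 := fun x hx =>
    (coeffs_eq_zero_of_infinite hU.infinite (a := 0) fun u hu => by
        linear_combination (e' t₀ ht₀ x hx u hu).2 + t₀ * u * h1).2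
  obtain ⟨-, h8, h9⟩ := coeffs_eq_zero_of_infinite hJ.infinite (a := 0) (b := n₁ - n₁')
    (c := n₀ - n₀') fun x hx => by linear_combination (hu x hx).2
  have h7 := (hu x₀ hx₀).1
  simp only [sub_eq_zero] at *
  exact ⟨⟨h1, h2, h3, h4, h5, h6⟩, h7, h8, h9⟩

theorem polyField_zero : polyField 0 0 0 0 0 0 0 0 0 = 0 := by
  funext P
  simp [polyField, vf]

theorem polyField_eq_zero (hI : IsOpenInterval I) (hJ : IsOpenInterval J)
    (hU : IsOpenInterval U) {a₁ c₁ c₀ a₀ b₁ b₀ h n₁ n₀ : ℝ}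
    (e : ∀ P ∈ I ×ˢ J ×ˢ U, polyField a₁ c₁ c₀ a₀ b₁ b₀ h n₁ n₀ P = 0) :
    a₁ = 0 ∧ c₁ = 0 ∧ c₀ = 0 ∧ a₀ = 0 ∧ b₁ = 0 ∧ b₀ = 0 :=
  (polyField_injective hI hJ hU fun P hP => (e P hP).trans (by rw [polyField_zero]; rfl)).1

/-- Linear independence and spanning, expressed by explicit linear combinations. -/
theorem isBasisOf_iff {D : Set (ℝ × ℝ × ℝ)} {n : ℕ} {b : Fin n → VectorField}
    {A : Set (D → ℝ × ℝ × ℝ)} :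
    IsBasisOf b A ↔ (∀ g : Fin n → ℝ, (∀ P ∈ D, ∑ i, g i • b i P = 0) → ∀ i, g i = 0) ∧
      ∀ v, v ∈ A ↔ ∃ g : Fin n → ℝ, v = D.domRestrict fun P => ∑ i, g i • b i P := by
  have hs : ∀ g : Fin n → ℝ, ∑ i, g i • D.domRestrict (b i)
      = D.domRestrict fun P => ∑ i, g i • b i P := by
    intro g
    funext P
    simp [Set.domRestrict]
  refine and_congr ?_ ?_
  · rw [Fintype.linearIndependent_iff]
    refine forall_congr' fun g => imp_congr ?_ Iff.rfl
    rw [hs, funext_iff, Subtype.forall]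
    rfl
  · rw [Set.ext_iff]
    refine forall_congr' fun v => ?_
    rw [SetLike.mem_coe, Submodule.mem_span_range_iff_exists_fun]
    simp only [hs, eq_comm (b := v)]
    exact iff_comm

variable (hε : ε = 1 ∨ ε = -1) (hI : IsOpenInterval I) (hJ : IsOpenInterval J)
  (hU : IsOpenInterval U)
include hε hI hJ hU

section Generic

variable (hm₀ : m ≠ 0) (hm₁ : m ≠ 1) (hm₂ : m ≠ 2) (hmU : IsPowerDomain m U)
include hm₀ hm₁ hm₂ hmU

/-- For `f = 1` and `f = e^t` together, the linear equations leave only `τ = 0`, `ξ_x = 0`. -/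
theorem mem_kernelAlgebra_iff {v : ↥(I ×ˢ J ×ˢ U) → ℝ × ℝ × ℝ} :
    v ∈ kernelAlgebra m ε I J U ↔
      ∃ b₀ : ℝ, v = (I ×ˢ J ×ˢ U).domRestrict (polyField 0 0 0 0 0 b₀ 0 0 0) := by
  constructor
  · intro hv
    obtain ⟨c₁, c₀, a₀, b₀, h1, rfl⟩ := (mem_maximalAlgebra_iff hm₀ hm₁ hm₂ hε hI hJ hU hmU
      (NormalForm.isCoefficient (c := .one) (Set.subset_univ I))).1
      (hv _ (NormalForm.isCoefficient (Set.subset_univ I)))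
    obtain ⟨c₁', c₀', a₀', b₀', h2, h3⟩ := (mem_maximalAlgebra_iff hm₀ hm₁ hm₂ hε hI hJ hU hmU
      (NormalForm.isCoefficient (c := .exp) (Set.subset_univ I))).1
      (hv _ (NormalForm.isCoefficient (Set.subset_univ I)))
    obtain ⟨⟨-, rfl, rfl, rfl, -, rfl⟩, -⟩ :=
      polyField_injective hI hJ hU fun P hP => congr_fun h3 ⟨P, hP⟩
    obtain ⟨-, h1⟩ := (solvesODE_one_iff hI).1 h1
    obtain ⟨-, rfl, h2⟩ := (solvesODE_exp_iff hI).1 h2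
    obtain rfl : a₀ = 0 := by linarith
    obtain rfl : c₀ = 0 := by linarith
    exact ⟨b₀, by simp⟩
  · rintro ⟨b₀, rfl⟩ f hf
    exact (mem_maximalAlgebra_iff hm₀ hm₁ hm₂ hε hI hJ hU hmU hf).2
      ⟨0, 0, 0, b₀, fun t _ => by simp, by simp⟩

/-- The kernel algebra is extended exactly if `f` solves a nontrivial linear equation of first
degree; if `τ = 0`, then the equation forces `ξ_x = 0`, since `f` does not vanish. -/
theorem kernelAlgebra_ssubset_iff (hf : IsCoefficient I f) :
    kernelAlgebra m ε I J U ⊂ maximalAlgebra m ε f (I ×ˢ J ×ˢ U) ↔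
      ∃ b c e : ℝ, ¬(b = 0 ∧ c = 0) ∧ SolvesODE I f 0 b c e := by
  have hsub : kernelAlgebra m ε I J U ⊆ maximalAlgebra m ε f (I ×ˢ J ×ˢ U) :=
    fun v hv => hv f hf
  rw [Set.ssubset_iff_of_subset hsub]
  constructor
  · rintro ⟨v, hv, hv'⟩
    obtain ⟨c₁, c₀, a₀, b₀, h1, rfl⟩ :=
      (mem_maximalAlgebra_iff hm₀ hm₁ hm₂ hε hI hJ hU hmU hf).1 hv
    refine ⟨c₁, c₀, _, ?_, h1⟩
    rintro ⟨rfl, rfl⟩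
    obtain ⟨t, ht⟩ := hI.nonempty
    have h2 := h1 t ht
    obtain rfl : a₀ = 0 := by simpa [hf.ne_zero t ht] using h2
    exact hv' ((mem_kernelAlgebra_iff hε hI hJ hU hm₀ hm₁ hm₂ hmU).2 ⟨b₀, by simp⟩)
  · rintro ⟨b, c, e, hbc, h⟩
    refine ⟨_, (mem_maximalAlgebra_iff hm₀ hm₁ hm₂ hε hI hJ hU hmU hf).2
      ⟨b, c, (e + b) / 3, 0, ?_, rfl⟩, fun hv => ?_⟩
    · convert h using 1
      ring
    · obtain ⟨b₀, hb⟩ := (mem_kernelAlgebra_iff hε hI hJ hU hm₀ hm₁ hm₂ hmU).1 hv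
      obtain ⟨⟨-, h1, h2, -⟩, -⟩ :=
        polyField_injective hI hJ hU fun P hP => congr_fun hb ⟨P, hP⟩
      exact hbc ⟨h1, h2⟩

theorem isBasisOf_kernelAlgebra :
    IsBasisOf ![vf fun _ _ _ => (0, 1, 0)] (kernelAlgebra m ε I J U) := by
  have hs : ∀ g : Fin 1 → ℝ, (fun P => ∑ i, g i • (![vf fun _ _ _ => (0, 1, 0)] : Fin 1 → _) i P)
      = polyField 0 0 0 0 0 (g 0) 0 0 0 := by
    intro g
    funext P
    simp [polyField, vf]
  refine isBasisOf_iff.2 ⟨fun g hg => ?_, fun v => ?_⟩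
  · have := polyField_eq_zero hI hJ hU fun P hP => (congr_fun (hs g) P).symm.trans (hg P hP)
    simp [Fin.forall_fin_succ, this]
  · rw [mem_kernelAlgebra_iff hε hI hJ hU hm₀ hm₁ hm₂ hmU]
    simp only [hs]
    exact ⟨fun ⟨b, hb⟩ => ⟨fun _ => b, hb⟩, fun ⟨g, hg⟩ => ⟨g 0, hg⟩⟩

theorem isBasisOf_maximalAlgebra_one :
    IsBasisOf ![vf fun _ _ _ => (1, 0, 0), vf fun _ _ _ => (0, 1, 0),
          vf fun t x u => (3 * (m - 1) * t, (m - 1) * x, -2 * u)]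
        (maximalAlgebra m ε (NormalForm.one.fn) (I ×ˢ J ×ˢ U)) := by
  have hm1 : m - 1 ≠ 0 := sub_ne_zero.2 hm₁
  have hs : ∀ g : Fin 3 → ℝ, (fun P => ∑ i, g i • (![vf fun _ _ _ => (1, 0, 0),
      vf fun _ _ _ => (0, 1, 0),
      vf fun t x u => (3 * (m - 1) * t, (m - 1) * x, -2 * u)] : Fin 3 → _) i P)
      = polyField 0 (3 * (m - 1) * g 2) (g 0) ((m - 1) * g 2) 0 (g 1) (-2 * g 2) 0 0 := by
    intro g
    funext P
    simp only [Fin.sum_univ_three, polyField, vf, Matrix.cons_val, Prod.smul_mk, Prod.mk_add_mk,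
      smul_eq_mul, Prod.mk.injEq]
    exact ⟨by ring, by ring, by ring⟩
  refine isBasisOf_iff.2 ⟨fun g hg => ?_, fun v => ?_⟩
  · have := polyField_eq_zero hI hJ hU fun P hP => (congr_fun (hs g) P).symm.trans (hg P hP)
    simp_all [Fin.forall_fin_succ]
  · rw [mem_maximalAlgebra_iff hm₀ hm₁ hm₂ hε hI hJ hU hmU
      (NormalForm.isCoefficient (c := .one) (Set.subset_univ I))]
    simp only [hs, solvesODE_one_iff hI]
    constructor
    · rintro ⟨c₁, c₀, a₀, b₀, ⟨-, h⟩, rfl⟩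
      refine ⟨![c₀, b₀, a₀ / (m - 1)], ?_⟩
      obtain rfl : c₁ = 3 * a₀ := by linarith
      congr 2 <;> simp <;> field_simp
      ring
    · rintro ⟨g, rfl⟩
      refine ⟨3 * (m - 1) * g 2, g 0, (m - 1) * g 2, g 1, ⟨trivial, by ring⟩, ?_⟩
      congr 2
      field_simp
      ring

theorem isBasisOf_maximalAlgebra_power {k : ℝ} (hk : k ≠ 0)
    (hd : I ⊆ (NormalForm.power k).domain) :
    IsBasisOf ![vf fun _ _ _ => (0, 1, 0),
            vf fun t x u => (3 * (m - 1) * t, (m - 1) * (k + 1) * x, (k - 2) * u)]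
          (maximalAlgebra m ε (NormalForm.power k).fn (I ×ˢ J ×ˢ U)) := by
  have hm1 : m - 1 ≠ 0 := sub_ne_zero.2 hm₁
  have hs : ∀ g : Fin 2 → ℝ, (fun P => ∑ i, g i • (![vf fun _ _ _ => (0, 1, 0),
      vf fun t x u => (3 * (m - 1) * t, (m - 1) * (k + 1) * x, (k - 2) * u)] : Fin 2 → _) i P)
      = polyField 0 (3 * (m - 1) * g 1) 0 ((m - 1) * (k + 1) * g 1) 0 (g 0) ((k - 2) * g 1)
        0 0 := by
    intro g
    funext P
    simp only [Fin.sum_univ_two, polyField, vf, Matrix.cons_val, Prod.smul_mk, Prod.mk_add_mk,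
      smul_eq_mul, Prod.mk.injEq]
    exact ⟨by ring, by ring, by ring⟩
  refine isBasisOf_iff.2 ⟨fun g hg => ?_, fun v => ?_⟩
  · have := polyField_eq_zero hI hJ hU fun P hP => (congr_fun (hs g) P).symm.trans (hg P hP)
    simp_all [Fin.forall_fin_succ]
  · rw [mem_maximalAlgebra_iff hm₀ hm₁ hm₂ hε hI hJ hU hmU (NormalForm.isCoefficient hd)]
    simp only [hs, solvesODE_power_iff hI hk hd]
    constructor
    · rintro ⟨c₁, c₀, a₀, b₀, ⟨-, h, rfl⟩, rfl⟩
      refine ⟨![b₀, c₁ / (3 * (m - 1))], ?_⟩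
      obtain rfl : a₀ = (k + 1) * c₁ / 3 := by linarith
      congr 2 <;> simp <;> field_simp
      ring
    · rintro ⟨g, rfl⟩
      refine ⟨3 * (m - 1) * g 1, 0, (m - 1) * (k + 1) * g 1, g 0, ⟨by ring, by ring, rfl⟩, ?_⟩
      congr 2
      field_simp
      ring

theorem isBasisOf_maximalAlgebra_exp :
    IsBasisOf ![vf fun _ _ _ => (0, 1, 0), vf fun _ x u => (3 * (m - 1), (m - 1) * x, u)]
        (maximalAlgebra m ε (NormalForm.exp.fn) (I ×ˢ J ×ˢ U)) := by
  have hm1 : m - 1 ≠ 0 := sub_ne_zero.2 hm₁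
  have hs : ∀ g : Fin 2 → ℝ, (fun P => ∑ i, g i • (![vf fun _ _ _ => (0, 1, 0),
      vf fun _ x u => (3 * (m - 1), (m - 1) * x, u)] : Fin 2 → _) i P)
      = polyField 0 0 (3 * (m - 1) * g 1) ((m - 1) * g 1) 0 (g 0) (g 1) 0 0 := by
    intro g
    funext P
    simp only [Fin.sum_univ_two, polyField, vf, Matrix.cons_val, Prod.smul_mk, Prod.mk_add_mk,
      smul_eq_mul, Prod.mk.injEq]
    exact ⟨by ring, by ring, by ring⟩
  refine isBasisOf_iff.2 ⟨fun g hg => ?_, fun v => ?_⟩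
  · have := polyField_eq_zero hI hJ hU fun P hP => (congr_fun (hs g) P).symm.trans (hg P hP)
    simp_all [Fin.forall_fin_succ]
  · rw [mem_maximalAlgebra_iff hm₀ hm₁ hm₂ hε hI hJ hU hmU
      (NormalForm.isCoefficient (c := .exp) (Set.subset_univ I))]
    simp only [hs, solvesODE_exp_iff hI]
    constructor
    · rintro ⟨c₁, c₀, a₀, b₀, ⟨-, rfl, h⟩, rfl⟩
      refine ⟨![b₀, a₀ / (m - 1)], ?_⟩
      obtain rfl : c₀ = 3 * a₀ := by linarith
      congr 2 <;> simp <;> field_simp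
    · rintro ⟨g, rfl⟩
      refine ⟨0, 3 * (m - 1) * g 1, (m - 1) * g 1, g 0, ⟨trivial, rfl, by ring⟩, ?_⟩
      congr 2
      field_simp
      ring

end Generic

section Quadratic

theorem mem_kernelAlgebra_two_iff {v : ↥(I ×ˢ J ×ˢ U) → ℝ × ℝ × ℝ} :
    v ∈ kernelAlgebra 2 ε I J U ↔
      ∃ b₁ b₀ : ℝ, v = (I ×ˢ J ×ˢ U).domRestrict (polyField 0 0 0 0 b₁ b₀ 0 0 (ε / 2 * b₁)) := by
  constructor
  · intro hv
    obtain ⟨a₁, c₁, c₀, a₀, b₁, b₀, h1, rfl⟩ := (mem_maximalAlgebra_two_iff hε hI hJ hU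
      (NormalForm.isCoefficient (c := .one) (Set.subset_univ I))).1
      (hv _ (NormalForm.isCoefficient (Set.subset_univ I)))
    obtain ⟨a₁', c₁', c₀', a₀', b₁', b₀', h2, h3⟩ := (mem_maximalAlgebra_two_iff hε hI hJ hU
      (NormalForm.isCoefficient (c := .exp) (Set.subset_univ I))).1
      (hv _ (NormalForm.isCoefficient (Set.subset_univ I)))
    obtain ⟨⟨rfl, rfl, rfl, rfl, rfl, rfl⟩, -⟩ :=
      polyField_injective hI hJ hU fun P hP => congr_fun h3 ⟨P, hP⟩
    obtain ⟨-, h1⟩ := (solvesODE_one_iff hI).1 h1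
    obtain ⟨rfl, rfl, h2⟩ := (solvesODE_exp_iff hI).1 h2
    obtain rfl : a₀ = 0 := by linarith
    obtain rfl : c₀ = 0 := by linarith
    exact ⟨b₁, b₀, by simp⟩
  · rintro ⟨b₁, b₀, rfl⟩ f hf
    exact (mem_maximalAlgebra_two_iff hε hI hJ hU hf).2
      ⟨0, 0, 0, 0, b₁, b₀, fun t _ => by simp, by simp⟩

theorem kernelAlgebra_two_ssubset_iff (hf : IsCoefficient I f) :
    kernelAlgebra 2 ε I J U ⊂ maximalAlgebra 2 ε f (I ×ˢ J ×ˢ U) ↔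
      ∃ a b c e : ℝ, ¬(a = 0 ∧ b = 0 ∧ c = 0) ∧ SolvesODE I f a b c e := by
  have hsub : kernelAlgebra 2 ε I J U ⊆ maximalAlgebra 2 ε f (I ×ˢ J ×ˢ U) :=
    fun v hv => hv f hf
  rw [Set.ssubset_iff_of_subset hsub]
  constructor
  · rintro ⟨v, hv, hv'⟩
    obtain ⟨a₁, c₁, c₀, a₀, b₁, b₀, h1, rfl⟩ := (mem_maximalAlgebra_two_iff hε hI hJ hU hf).1 hv
    refine ⟨a₁, c₁, c₀, _, ?_, h1⟩
    rintro ⟨rfl, rfl, rfl⟩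
    obtain ⟨t, ht⟩ := hI.nonempty
    have h2 := h1 t ht
    obtain rfl : a₀ = 0 := by simpa [hf.ne_zero t ht] using h2
    exact hv' ((mem_kernelAlgebra_two_iff hε hI hJ hU).2 ⟨b₁, b₀, by simp⟩)
  · rintro ⟨a, b, c, e, habc, h⟩
    refine ⟨_, (mem_maximalAlgebra_two_iff hε hI hJ hU hf).2
      ⟨a, b, c, (e + b) / 3, 0, 0, ?_, rfl⟩, fun hv => ?_⟩
    · convert h using 1
      ring
    · obtain ⟨b₁, b₀, hb⟩ := (mem_kernelAlgebra_two_iff hε hI hJ hU).1 hv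
      obtain ⟨⟨h0, h1, h2, -⟩, -⟩ :=
        polyField_injective hI hJ hU fun P hP => congr_fun hb ⟨P, hP⟩
      exact habc ⟨h0, h1, h2⟩

theorem isBasisOf_kernelAlgebra_two :
    IsBasisOf ![vf fun _ _ _ => (0, 1, 0), vf fun t _ _ => (0, 2 * ε * t, 1)]
        (kernelAlgebra 2 ε I J U) := by
  have hε2 : ε * ε = 1 := by rcases hε with rfl | rfl <;> norm_num
  have hε0 : ε ≠ 0 := by rintro rfl; simp at hε2
  have hs : ∀ g : Fin 2 → ℝ, (fun P => ∑ i, g i • (![vf fun _ _ _ => (0, 1, 0),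
      vf fun t _ _ => (0, 2 * ε * t, 1)] : Fin 2 → _) i P)
      = polyField 0 0 0 0 (2 * ε * g 1) (g 0) 0 0 (ε / 2 * (2 * ε * g 1)) := by
    intro g
    funext P
    simp only [Fin.sum_univ_two, polyField, vf, Matrix.cons_val, Prod.smul_mk, Prod.mk_add_mk,
      smul_eq_mul, Prod.mk.injEq]
    exact ⟨by ring, by ring, by linear_combination -g 1 * hε2⟩
  refine isBasisOf_iff.2 ⟨fun g hg => ?_, fun v => ?_⟩
  · have := polyField_eq_zero hI hJ hU fun P hP => (congr_fun (hs g) P).symm.trans (hg P hP)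
    simp_all [Fin.forall_fin_succ]
  · rw [mem_kernelAlgebra_two_iff hε hI hJ hU]
    simp only [hs]
    constructor
    · rintro ⟨b₁, b₀, rfl⟩
      refine ⟨![b₀, b₁ / (2 * ε)], ?_⟩
      congr 2 <;> simp <;> field_simp
      simp
    · rintro ⟨g, rfl⟩
      exact ⟨_, _, rfl⟩

theorem isBasisOf_maximalAlgebra_two_one :
    IsBasisOf ![vf fun _ _ _ => (1, 0, 0), vf fun t _ _ => (0, 2 * ε * t, 1),
          vf fun _ _ _ => (0, 1, 0), vf fun t x u => (3 * t, x, -2 * u)]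
        (maximalAlgebra 2 ε (NormalForm.one.fn) (I ×ˢ J ×ˢ U)) := by
  have hε2 : ε * ε = 1 := by rcases hε with rfl | rfl <;> norm_num
  have hε0 : ε ≠ 0 := by rintro rfl; simp at hε2
  have hs : ∀ g : Fin 4 → ℝ, (fun P => ∑ i, g i • (![vf fun _ _ _ => (1, 0, 0),
      vf fun t _ _ => (0, 2 * ε * t, 1), vf fun _ _ _ => (0, 1, 0),
      vf fun t x u => (3 * t, x, -2 * u)] : Fin 4 → _) i P)
      = polyField 0 (3 * g 3) (g 0) (g 3) (2 * ε * g 1) (g 2) (-2 * g 3) 0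
        (ε / 2 * (2 * ε * g 1)) := by
    intro g
    funext P
    simp only [Fin.sum_univ_four, polyField, vf, Matrix.cons_val, Prod.smul_mk, Prod.mk_add_mk,
      smul_eq_mul, Prod.mk.injEq]
    exact ⟨by ring, by ring, by linear_combination -g 1 * hε2⟩
  refine isBasisOf_iff.2 ⟨fun g hg => ?_, fun v => ?_⟩
  · have := polyField_eq_zero hI hJ hU fun P hP => (congr_fun (hs g) P).symm.trans (hg P hP)
    simp_all [Fin.forall_fin_succ]
  · rw [mem_maximalAlgebra_two_iff hε hI hJ hU
      (NormalForm.isCoefficient (c := .one) (Set.subset_univ I))]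
    simp only [hs, solvesODE_one_iff hI]
    constructor
    · rintro ⟨a₁, c₁, c₀, a₀, b₁, b₀, ⟨rfl, h⟩, rfl⟩
      refine ⟨![c₀, b₁ / (2 * ε), b₀, a₀], ?_⟩
      obtain rfl : c₁ = 3 * a₀ := by linarith
      congr 2 <;> simp <;> field_simp <;> first | ring1 | simp
    · rintro ⟨g, rfl⟩
      refine ⟨0, 3 * g 3, g 0, g 3, 2 * ε * g 1, g 2, ⟨rfl, by ring⟩, ?_⟩
      congr 2 <;> ring

theorem isBasisOf_maximalAlgebra_two_power {k : ℝ} (hk : k ≠ 0) (hk₁ : k ≠ 1)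
    (hd : I ⊆ (NormalForm.power k).domain) :
    IsBasisOf ![vf fun _ _ _ => (0, 1, 0), vf fun t _ _ => (0, 2 * ε * t, 1),
            vf fun t x u => (3 * t, (k + 1) * x, (k - 2) * u)]
          (maximalAlgebra 2 ε (NormalForm.power k).fn (I ×ˢ J ×ˢ U)) := by
  have hε2 : ε * ε = 1 := by rcases hε with rfl | rfl <;> norm_num
  have hε0 : ε ≠ 0 := by rintro rfl; simp at hε2
  have hs : ∀ g : Fin 3 → ℝ, (fun P => ∑ i, g i • (![vf fun _ _ _ => (0, 1, 0),
      vf fun t _ _ => (0, 2 * ε * t, 1),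
      vf fun t x u => (3 * t, (k + 1) * x, (k - 2) * u)] : Fin 3 → _) i P)
      = polyField 0 (3 * g 2) 0 ((k + 1) * g 2) (2 * ε * g 1) (g 0) ((k - 2) * g 2) 0
        (ε / 2 * (2 * ε * g 1)) := by
    intro g
    funext P
    simp only [Fin.sum_univ_three, polyField, vf, Matrix.cons_val, Prod.smul_mk, Prod.mk_add_mk,
      smul_eq_mul, Prod.mk.injEq]
    exact ⟨by ring, by ring, by linear_combination -g 1 * hε2⟩
  refine isBasisOf_iff.2 ⟨fun g hg => ?_, fun v => ?_⟩
  · have := polyField_eq_zero hI hJ hU fun P hP => (congr_fun (hs g) P).symm.trans (hg P hP)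
    simp_all [Fin.forall_fin_succ]
  · rw [mem_maximalAlgebra_two_iff hε hI hJ hU (NormalForm.isCoefficient hd)]
    simp only [hs, solvesODE_power_iff hI hk hd]
    constructor
    · rintro ⟨a₁, c₁, c₀, a₀, b₁, b₀, ⟨h0, h, rfl⟩, rfl⟩
      refine ⟨![b₀, b₁ / (2 * ε), c₁ / 3], ?_⟩
      obtain rfl : a₁ = 0 := (mul_eq_zero.1 h0).resolve_right (sub_ne_zero.2 hk₁)
      obtain rfl : a₀ = (k + 1) * c₁ / 3 := by linarith
      congr 2 <;> simp <;> field_simp <;> first | ring1 | simp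
    · rintro ⟨g, rfl⟩
      refine ⟨0, 3 * g 2, 0, (k + 1) * g 2, 2 * ε * g 1, g 0, ⟨by ring, by ring, rfl⟩, ?_⟩
      congr 2 <;> ring

theorem isBasisOf_maximalAlgebra_two_exp :
    IsBasisOf ![vf fun _ _ _ => (0, 1, 0), vf fun t _ _ => (0, 2 * ε * t, 1),
          vf fun _ x u => (3, x, u)]
        (maximalAlgebra 2 ε (NormalForm.exp.fn) (I ×ˢ J ×ˢ U)) := by
  have hε2 : ε * ε = 1 := by rcases hε with rfl | rfl <;> norm_num
  have hε0 : ε ≠ 0 := by rintro rfl; simp at hε2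
  have hs : ∀ g : Fin 3 → ℝ, (fun P => ∑ i, g i • (![vf fun _ _ _ => (0, 1, 0),
      vf fun t _ _ => (0, 2 * ε * t, 1), vf fun _ x u => (3, x, u)] : Fin 3 → _) i P)
      = polyField 0 0 (3 * g 2) (g 2) (2 * ε * g 1) (g 0) (g 2) 0
        (ε / 2 * (2 * ε * g 1)) := by
    intro g
    funext P
    simp only [Fin.sum_univ_three, polyField, vf, Matrix.cons_val, Prod.smul_mk, Prod.mk_add_mk,
      smul_eq_mul, Prod.mk.injEq]
    exact ⟨by ring, by ring, by linear_combination -g 1 * hε2⟩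
  refine isBasisOf_iff.2 ⟨fun g hg => ?_, fun v => ?_⟩
  · have := polyField_eq_zero hI hJ hU fun P hP => (congr_fun (hs g) P).symm.trans (hg P hP)
    simp_all [Fin.forall_fin_succ]
  · rw [mem_maximalAlgebra_two_iff hε hI hJ hU
      (NormalForm.isCoefficient (c := .exp) (Set.subset_univ I))]
    simp only [hs, solvesODE_exp_iff hI]
    constructor
    · rintro ⟨a₁, c₁, c₀, a₀, b₁, b₀, ⟨rfl, rfl, h⟩, rfl⟩
      refine ⟨![b₀, b₁ / (2 * ε), a₀], ?_⟩
      obtain rfl : c₀ = 3 * a₀ := by linarith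
      congr 2 <;> simp <;> field_simp
      simp
    · rintro ⟨g, rfl⟩
      refine ⟨0, 0, 3 * g 2, g 2, 2 * ε * g 1, g 0, ⟨rfl, rfl, by ring⟩, ?_⟩
      congr 2 <;> ring

theorem isBasisOf_maximalAlgebra_two_arctan (k : ℝ) :
    IsBasisOf ![vf fun _ _ _ => (0, 1, 0), vf fun t _ _ => (0, 2 * ε * t, 1),
            vf fun t x u => (6 * ε * (t ^ 2 + 1), 2 * ε * (3 * t + k) * x,
              2 * ε * (k - 3 * t) * u + 3 * x)]
          (maximalAlgebra 2 ε (NormalForm.arctan k).fn (I ×ˢ J ×ˢ U)) := by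
  have hε2 : ε * ε = 1 := by rcases hε with rfl | rfl <;> norm_num
  have hε0 : ε ≠ 0 := by rintro rfl; simp at hε2
  have hs : ∀ g : Fin 3 → ℝ, (fun P => ∑ i, g i • (![vf fun _ _ _ => (0, 1, 0),
      vf fun t _ _ => (0, 2 * ε * t, 1), vf fun t x u => (6 * ε * (t ^ 2 + 1),
        2 * ε * (3 * t + k) * x, 2 * ε * (k - 3 * t) * u + 3 * x)] : Fin 3 → _) i P)
      = polyField (6 * ε * g 2) 0 (6 * ε * g 2) (2 * ε * k * g 2) (2 * ε * g 1) (g 0)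
        (2 * ε * k * g 2) (ε / 2 * (6 * ε * g 2)) (ε / 2 * (2 * ε * g 1)) := by
    intro g
    funext P
    simp only [Fin.sum_univ_three, polyField, vf, Matrix.cons_val, Prod.smul_mk, Prod.mk_add_mk,
      smul_eq_mul, Prod.mk.injEq]
    exact ⟨by ring, by ring, by linear_combination (-g 1 - 3 * P.2.1 * g 2) * hε2⟩
  refine isBasisOf_iff.2 ⟨fun g hg => ?_, fun v => ?_⟩
  · have := polyField_eq_zero hI hJ hU fun P hP => (congr_fun (hs g) P).symm.trans (hg P hP)
    simp_all [Fin.forall_fin_succ]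
  · rw [mem_maximalAlgebra_two_iff hε hI hJ hU
      (NormalForm.isCoefficient (c := .arctan k) (Set.subset_univ I))]
    simp only [hs, solvesODE_arctan_iff hI]
    constructor
    · rintro ⟨a₁, c₁, c₀, a₀, b₁, b₀, ⟨rfl, rfl, h⟩, rfl⟩
      refine ⟨![b₀, b₁ / (2 * ε), c₀ / (6 * ε)], ?_⟩
      obtain rfl : a₀ = c₀ * k / 3 := by linarith
      congr 2 <;> simp <;> field_simp <;> first | ring1 | simp
    · rintro ⟨g, rfl⟩
      refine ⟨6 * ε * g 2, 0, 6 * ε * g 2, 2 * ε * k * g 2, 2 * ε * g 1, g 0,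
        ⟨rfl, rfl, by ring⟩, ?_⟩
      congr 2
      ring

end Quadratic

end Bases

/-! ### Fractional linear changes of time -/

section Mobius

variable {I S : Set ℝ} {f g F : ℝ → ℝ} {a b c e α β γ δ : ℝ}

theorem SolvesODE.scale (h : SolvesODE I f a b c e) (r : ℝ) :
    SolvesODE I f (r * a) (r * b) (r * c) (r * e) :=
  fun t ht => by linear_combination r * h t ht

theorem hasDerivAt_mobius {t : ℝ} (hγ : γ * t + δ ≠ 0) :
    HasDerivAt (fun t => (α * t + β) / (γ * t + δ)) ((α * δ - β * γ) / (γ * t + δ) ^ 2) t := by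
  have lin : ∀ z v : ℝ, HasDerivAt (fun t : ℝ => z * t + v) z t := fun z v => by
    simpa using ((hasDerivAt_id t).const_mul z).add_const v
  refine ((lin α β).div (lin γ δ) hγ).congr_deriv ?_
  ring

/-- If `F` at the time `(α t + β) / (γ t + δ)` equals `B f / (γ t + δ)`, then a linear equation
for `F` turns into a linear equation of the same shape for `f`. -/
theorem SolvesODE.mobius (hI : IsOpen I) (h : SolvesODE S F a b c e)
    (hF : ∀ s ∈ S, DifferentiableAt ℝ F s) (hγ : ∀ t ∈ I, γ * t + δ ≠ 0)
    (hS : ∀ t ∈ I, (α * t + β) / (γ * t + δ) ∈ S) {B : ℝ} (hB : B ≠ 0)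
    (hf : ∀ t ∈ I, F ((α * t + β) / (γ * t + δ)) = B * (f t / (γ * t + δ))) :
    SolvesODE I f (a * α ^ 2 + b * (α * γ) + c * γ ^ 2)
      (2 * a * (α * β) + b * (α * δ + β * γ) + 2 * c * (γ * δ))
      (a * β ^ 2 + b * (β * δ) + c * δ ^ 2)
      (a * (α * β) + b * (β * γ) + c * (γ * δ) + (α * δ - β * γ) * e) := by
  intro t ht
  have hf' : ∀ t ∈ I, f t = (γ * t + δ) * F ((α * t + β) / (γ * t + δ)) / B := fun t ht => by
    rw [hf t ht]
    field_simp [hγ t ht]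
  have hd : HasDerivAt f ((γ * F ((α * t + β) / (γ * t + δ)) + (γ * t + δ) *
      (deriv F ((α * t + β) / (γ * t + δ)) * ((α * δ - β * γ) / (γ * t + δ) ^ 2))) / B) t := by
    have lin : HasDerivAt (fun t : ℝ => γ * t + δ) γ t := by
      simpa using ((hasDerivAt_id t).const_mul γ).add_const δ
    have hc := (hF _ (hS t ht)).hasDerivAt.comp t (hasDerivAt_mobius (hγ t ht))
    refine ((lin.mul hc).div_const B).congr_of_eventuallyEq ?_
    filter_upwards [hI.mem_nhds ht] with y hy using hf' y hy
  rw [hd.deriv, hf' t ht]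
  have h1 := h _ (hS t ht)
  have h0 := hγ t ht
  -- in terms of the linear form `N` and of `s N`, the identity is homogeneous
  set N := γ * t + δ with hN
  set s := (α * t + β) / N with hs
  have hsN : s * N = α * t + β := div_mul_cancel₀ _ h0
  set X := F s
  set Y := deriv F s
  have e1 : (a * α ^ 2 + b * (α * γ) + c * γ ^ 2) * t ^ 2
      + (2 * a * (α * β) + b * (α * δ + β * γ) + 2 * c * (γ * δ)) * t
      + (a * β ^ 2 + b * (β * δ) + c * δ ^ 2) = (a * s ^ 2 + b * s + c) * N ^ 2 := by
    have : (a * s ^ 2 + b * s + c) * N ^ 2 = a * (s * N) ^ 2 + b * (s * N) * N + c * N ^ 2 := by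
      ring
    rw [this, hsN, hN]
    ring
  have e2 : (a * α ^ 2 + b * (α * γ) + c * γ ^ 2) * t
      + (a * (α * β) + b * (β * γ) + c * (γ * δ) + (α * δ - β * γ) * e)
      = γ * N * (a * s ^ 2 + b * s + c) + (α * δ - β * γ) * (a * s + e) := by
    have h3 : γ * (s * N) + (α * δ - β * γ) = α * N := by rw [hsN, hN]; ring
    have : γ * N * (a * s ^ 2 + b * s + c) + (α * δ - β * γ) * (a * s + e)
        = a * s * (γ * (s * N) + (α * δ - β * γ)) + b * γ * (s * N) + c * γ * N
          + (α * δ - β * γ) * e := by ring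
    rw [this, h3]
    have : a * s * (α * N) = a * α * (s * N) := by ring
    rw [this, hsN, hN]
    ring
  rw [e1, e2]
  field_simp
  linear_combination (α * δ - β * γ) * h1

/-- A fractional linear substitution with nonzero determinant does not annihilate a quadratic
form. -/
theorem mobius_ne_zero (hΔ : α * δ - β * γ ≠ 0) (habc : ¬(a = 0 ∧ b = 0 ∧ c = 0)) :
    ¬(a * α ^ 2 + b * (α * γ) + c * γ ^ 2 = 0 ∧
      2 * a * (α * β) + b * (α * δ + β * γ) + 2 * c * (γ * δ) = 0 ∧
      a * β ^ 2 + b * (β * δ) + c * δ ^ 2 = 0) := by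
  rintro ⟨h1, h2, h3⟩
  have hΔ2 : (α * δ - β * γ) ^ 2 ≠ 0 := pow_ne_zero 2 hΔ
  refine habc ⟨?_, ?_, ?_⟩
  · exact mul_left_cancel₀ hΔ2 (by linear_combination δ ^ 2 * h1 - γ * δ * h2 + γ ^ 2 * h3)
  · exact mul_left_cancel₀ hΔ2 (by
      linear_combination -2 * β * δ * h1 + (α * δ + β * γ) * h2 - 2 * α * γ * h3)
  · exact mul_left_cancel₀ hΔ2 (by linear_combination β ^ 2 * h1 - α * β * h2 + α ^ 2 * h3)

/-- Two solutions of the same nontrivial linear equation are proportional, even across the zeros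
of its leading coefficient. -/
theorem SolvesODE.proportional (hI : IsOpenInterval I) (hf : ContDiffOn ℝ ∞ f I)
    (hg : ContDiffOn ℝ ∞ g I) (hf0 : ∀ t ∈ I, f t ≠ 0) (habc : ¬(a = 0 ∧ b = 0 ∧ c = 0))
    (h : SolvesODE I f a b c e) (h' : SolvesODE I g a b c e) : ∃ C, ∀ t ∈ I, g t = C * f t := by
  have cd : ∀ {g : ℝ → ℝ}, ContDiffOn ℝ ∞ g I → ContinuousOn (deriv g) I := fun hg =>
    (contDiffOn_deriv hI.isOpen hg).continuousOn
  -- the Wronskian vanishes outside the finitely many zeros of the leading coefficient, hence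
  -- everywhere by continuity
  set W := fun t => deriv g t * f t - g t * deriv f t with hWdef
  have hWc : ContinuousOn W I :=
    ((cd hg).mul hf.continuousOn).sub (hg.continuousOn.mul (cd hf))
  have hW : ∀ t ∈ I, W t = 0 := by
    intro t ht
    by_contra hne
    have hev := ((hWc t ht).continuousAt (hI.isOpen.mem_nhds ht)).eventually_ne hne
    refine habc (coeffs_eq_zero_of_infinite (infinite_of_mem_nhds t
      (Filter.inter_mem (hI.isOpen.mem_nhds ht) hev)) fun y hy => ?_)
    exact mul_right_cancel₀ (show W y ≠ 0 from hy.2) (by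
      simp only [hWdef]
      linear_combination f y * h' y hy.1 - g y * h y hy.1)
  obtain ⟨t₀, ht₀⟩ := hI.nonempty
  refine ⟨g t₀ / f t₀, fun t ht => ?_⟩
  have hd : ∀ t ∈ I, HasDerivAt (fun t => g t / f t) 0 t := fun t ht =>
    ((hasDerivAt_of_smoothOn hI.isOpen hg ht).div (hasDerivAt_of_smoothOn hI.isOpen hf ht)
      (hf0 t ht)).congr_deriv (by
        have := hW t ht
        simp only [hWdef] at this
        rw [this, zero_div])
  have := hI.eq_of_hasDerivAt_zero hd ht ht₀
  rw [← this, div_mul_cancel₀ _ (hf0 t ht)]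

theorem IsOpenInterval.exists_sign (hI : IsOpenInterval I) {g : ℝ → ℝ} (hg : ContinuousOn g I)
    (hg0 : ∀ t ∈ I, g t ≠ 0) : ∃ σ : ℝ, (σ = 1 ∨ σ = -1) ∧ ∀ t ∈ I, 0 < σ * g t := by
  by_cases h : ∀ t ∈ I, 0 < g t
  · exact ⟨1, Or.inl rfl, fun t ht => by simpa using h t ht⟩
  · push Not at h
    obtain ⟨t₀, ht₀, h₀⟩ := h
    refine ⟨-1, Or.inr rfl, fun t ht => ?_⟩
    by_contra hneg
    obtain ⟨y, hy, hy0⟩ := hI.isPreconnected.intermediate_value ht₀ ht hg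
      (show (0 : ℝ) ∈ Set.Icc (g t₀) (g t) from ⟨h₀, by linarith⟩)
    exact hg0 y hy hy0

/-- If the linear equation for `f` is, up to a factor, the one obtained from a normal form by a
fractional linear substitution, then the substitution takes `f` to a multiple of the normal form. -/
theorem NormalForm.exists_factor (hI : IsOpenInterval I) (hf : IsCoefficient I f) (n : NormalForm)
    {a' b' c' e' r : ℝ} (hn : SolvesODE n.domain n.fn a b c e) (habc : ¬(a = 0 ∧ b = 0 ∧ c = 0))
    (hγ : ∀ t ∈ I, γ * t + δ ≠ 0) (hS : ∀ t ∈ I, (α * t + β) / (γ * t + δ) ∈ n.domain)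
    (hΔ : α * δ - β * γ ≠ 0) (hfs : SolvesODE I f a' b' c' e')
    (ha : r * a' = a * α ^ 2 + b * (α * γ) + c * γ ^ 2)
    (hb : r * b' = 2 * a * (α * β) + b * (α * δ + β * γ) + 2 * c * (γ * δ))
    (hc : r * c' = a * β ^ 2 + b * (β * δ) + c * δ ^ 2)
    (he : r * e' = a * (α * β) + b * (β * γ) + c * (γ * δ) + (α * δ - β * γ) * e) :
    ∃ B : ℝ, B ≠ 0 ∧ ∀ t ∈ I, n.fn ((α * t + β) / (γ * t + δ)) = B * (f t / (γ * t + δ)) := by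
  have hfs' := hfs.scale r
  rw [ha, hb, hc, he] at hfs'
  set g : ℝ → ℝ := fun t => (γ * t + δ) * n.fn ((α * t + β) / (γ * t + δ))
  have hg : SolvesODE I g _ _ _ _ := hn.mobius (f := g) hI.isOpen
    (fun s hs => (n.contDiffAt_fn hs).differentiableAt (by simp)) hγ hS one_ne_zero
    fun t ht => by
      simp only [g]
      rw [one_mul, mul_div_cancel_left₀ _ (hγ t ht)]
  have hgs : ContDiffOn ℝ ∞ g I := fun t ht => by
    have h1 : ContDiffAt ℝ ∞ (fun t : ℝ => (α * t + β) / (γ * t + δ)) t :=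
      ContDiffAt.div (by fun_prop) (by fun_prop) (hγ t ht)
    exact ((show ContDiffAt ℝ ∞ (fun t : ℝ => γ * t + δ) t by fun_prop).mul
      ((n.contDiffAt_fn (hS t ht)).comp t h1)).contDiffWithinAt
  obtain ⟨B, hB⟩ := hfs'.proportional hI hf.smooth hgs hf.ne_zero (mobius_ne_zero hΔ habc) hg
  refine ⟨B, ?_, fun t ht => ?_⟩
  · rintro rfl
    obtain ⟨t, ht⟩ := hI.nonempty
    have := hB t ht
    rw [zero_mul] at this
    exact mul_ne_zero (hγ t ht) (n.fn_ne_zero (hS t ht)) this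
  · have := hB t ht
    simp only [g] at this
    rw [← mul_div_assoc, ← this, mul_div_cancel_left₀ _ (hγ t ht)]

end Mobius

/-! ### The equivalence groups -/

section Groups

variable {m ε : ℝ} {I : Set ℝ} {f : ℝ → ℝ}

/-- On the coefficient function, the usual group acts by affine changes of time, written here as
fractional linear ones with denominator `0 * t + 1`, and by factors. -/
theorem UsualEquivalent.exists_affine {ε' : ℝ} {I' : Set ℝ} {f' : ℝ → ℝ}
    (h : UsualEquivalent m ε I f ε' I' f') :
    ∃ A d B : ℝ, A ≠ 0 ∧ B ≠ 0 ∧ (∀ t ∈ I, (A * t + d) / (0 * t + 1) ∈ I') ∧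
      ∀ t ∈ I, f' ((A * t + d) / (0 * t + 1)) = B * (f t / (0 * t + 1)) := by
  obtain ⟨s, δ₀, δ₁, δ₂, δ₃, hs, hδ₁, hδ₃, -, hI', hf'⟩ := h
  have hs0 : s ≠ 0 := by rcases hs with rfl | rfl <;> norm_num
  have hpow : ∀ n : ℤ, (∀ k : ℤ, m = k → δ₃ ≠ 0 → δ₃ ^ ((n : ℝ) * (m - 1)) ≠ 0) := by
    rintro n k rfl h0
    rw [show (n : ℝ) * ((k : ℝ) - 1) = ((n * (k - 1) : ℤ) : ℝ) by push_cast; ring,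
      Real.rpow_intCast]
    exact zpow_ne_zero _ h0
  have hpow' : ∀ n : ℤ, δ₃ ^ ((n : ℝ) * (m - 1)) ≠ 0 := by
    intro n
    rcases hδ₃ with h | ⟨h, k, hk⟩
    · exact (Real.rpow_pos_of_pos h _).ne'
    · exact hpow n k hk h.ne
  have h1 : δ₃ ^ (1 - m) ≠ 0 := by
    have := hpow' (-1)
    rwa [show ((-1 : ℤ) : ℝ) * (m - 1) = 1 - m by push_cast; ring] at this
  have h2 : δ₃ ^ (m - 1) ≠ 0 := by simpa using hpow' 1
  refine ⟨s * δ₁ * δ₃ ^ (1 - m), δ₀, s * δ₁ ^ 2 * δ₃ ^ (m - 1), by positivity, by positivity,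
    fun t ht => ?_, fun t ht => ?_⟩
  · rw [← hI', zero_mul, zero_add, div_one]
    exact ⟨(t, 0, 0), ht, rfl⟩
  · rw [zero_mul, zero_add, div_one, div_one]
    exact hf' (t, 0, 0) ht

/-- Every affine change of time and every factor come from the usual group. -/
theorem exists_usualEquivalent (hm₁ : m ≠ 1) {F : ℝ → ℝ} {S : Set ℝ} {A d B : ℝ} (hA : A ≠ 0)
    (hB : B ≠ 0) (hS : ∀ t ∈ I, (A * t + d) / (0 * t + 1) ∈ S)
    (hF : ∀ t ∈ I, F ((A * t + d) / (0 * t + 1)) = B * (f t / (0 * t + 1))) :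
    ∃ (ε' : ℝ) (I' : Set ℝ), I' ⊆ S ∧ UsualEquivalent m ε I f ε' I' F := by
  simp only [zero_mul, zero_add, div_one] at hS hF
  -- `s` is the sign of `B`; then `δ₁` is fixed by `A`, and `δ₃` by `|B|`
  obtain ⟨s, hs, hsB⟩ : ∃ s : ℝ, (s = 1 ∨ s = -1) ∧ s * |B| = B := by
    rcases abs_choice B with h | h
    · exact ⟨1, Or.inl rfl, by rw [h, one_mul]⟩
    · exact ⟨-1, Or.inr rfl, by rw [h]; ring⟩
  have hs2 : s * s = 1 := by rcases hs with rfl | rfl <;> norm_num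
  have hs0 : s ≠ 0 := by rintro rfl; simp at hs2
  have hA2 : 0 < A ^ 2 := by positivity
  have hm1 : m - 1 ≠ 0 := sub_ne_zero.2 hm₁
  have hB0 : 0 < |B| / A ^ 2 := div_pos (abs_pos.2 hB) hA2
  set δ₃ : ℝ := (|B| / A ^ 2) ^ (1 / (3 * (m - 1))) with hδ₃def
  have hδ₃ : 0 < δ₃ := Real.rpow_pos_of_pos hB0 _
  have hq : 0 < δ₃ ^ (m - 1) := Real.rpow_pos_of_pos hδ₃ _
  have hcube : (δ₃ ^ (m - 1)) ^ 3 = |B| / A ^ 2 := by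
    rw [hδ₃def, ← Real.rpow_mul hB0.le, ← Real.rpow_natCast, ← Real.rpow_mul hB0.le]
    convert Real.rpow_one _ using 2
    push_cast
    field_simp
  have hinv : δ₃ ^ (1 - m) = (δ₃ ^ (m - 1))⁻¹ := by
    rw [← Real.rpow_neg hδ₃.le, neg_sub]
  have eA : s * (s * A * δ₃ ^ (m - 1)) * δ₃ ^ (1 - m) = A := by
    rw [hinv]
    field_simp
    linear_combination hs2
  have eB : s * (s * A * δ₃ ^ (m - 1)) ^ 2 * δ₃ ^ (m - 1) = B := by
    have : s * (s * A * δ₃ ^ (m - 1)) ^ 2 * δ₃ ^ (m - 1)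
        = s * (s * s) * (A ^ 2 * (δ₃ ^ (m - 1)) ^ 3) := by ring
    rw [this, hcube, hs2, mul_one, mul_div_cancel₀ _ hA2.ne', hsB]
  refine ⟨s * ε, _, ?_, s, d, s * A * δ₃ ^ (m - 1), 0, δ₃, hs,
    mul_ne_zero (mul_ne_zero hs0 hA) hq.ne', Or.inl hδ₃, rfl, rfl, ?_⟩
  · rintro _ ⟨p, hp, rfl⟩
    simp only [usualMap, eA]
    exact hS _ hp
  · intro p hp
    simp only [usualMap, eA, eB]
    exact hF _ hp

theorem exists_cube_root (x : ℝ) : ∃ y : ℝ, y ^ 3 = x := by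
  have key : ∀ x : ℝ, 0 ≤ x → ∃ y : ℝ, y ^ 3 = x := fun x hx =>
    ⟨x ^ ((3 : ℕ) : ℝ)⁻¹, Real.rpow_inv_natCast_pow hx (by norm_num)⟩
  rcases le_total 0 x with h | h
  · exact key x h
  · obtain ⟨y, hy⟩ := key (-x) (by linarith)
    exact ⟨-y, by linear_combination -hy⟩

/-- Every fractional linear change of time and every factor come from the generalized group. -/
theorem exists_quadraticEquivalent {F : ℝ → ℝ} {S : Set ℝ} {α β γ δ B : ℝ}
    (hΔ : α * δ - β * γ ≠ 0) (hB : B ≠ 0) (hγ : ∀ t ∈ I, γ * t + δ ≠ 0)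
    (hS : ∀ t ∈ I, (α * t + β) / (γ * t + δ) ∈ S)
    (hF : ∀ t ∈ I, F ((α * t + β) / (γ * t + δ)) = B * (f t / (γ * t + δ))) :
    ∃ (ε' : ℝ) (I' : Set ℝ), I' ⊆ S ∧ QuadraticEquivalent ε I f ε' I' F := by
  -- `f` feels only the cube of `κ`, and it does not feel `μ₁`, `μ₀`
  obtain ⟨κ, hκ⟩ := exists_cube_root (B * (α * δ - β * γ))
  have hκ0 : κ ≠ 0 := by
    rintro rfl
    exact mul_ne_zero hB hΔ (by rw [← hκ]; norm_num)
  refine ⟨1 * ε, _, ?_, 1, α, β, γ, δ, κ, 0, 0, Or.inl rfl, mul_ne_zero hκ0 hΔ, hγ, rfl, rfl, ?_⟩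
  · rintro _ ⟨p, hp, rfl⟩
    exact hS _ hp
  · intro p hp
    rw [hκ, mul_div_cancel_right₀ _ hΔ]
    exact hF _ hp

theorem QuadraticEquivalent.exists_mobius {ε' : ℝ} {I' : Set ℝ} {f' : ℝ → ℝ}
    (h : QuadraticEquivalent ε I f ε' I' f') :
    ∃ α β γ δ B : ℝ, α * δ - β * γ ≠ 0 ∧ B ≠ 0 ∧ (∀ t ∈ I, γ * t + δ ≠ 0) ∧
      (∀ t ∈ I, (α * t + β) / (γ * t + δ) ∈ I') ∧
      ∀ t ∈ I, f' ((α * t + β) / (γ * t + δ)) = B * (f t / (γ * t + δ)) := by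
  obtain ⟨s, α, β, γ, δ, κ, μ₁, μ₀, -, hκ, hγ, -, hI', hf'⟩ := h
  have hΔ := right_ne_zero_of_mul hκ
  refine ⟨α, β, γ, δ, _, hΔ, div_ne_zero (pow_ne_zero 3 (left_ne_zero_of_mul hκ)) hΔ, hγ,
    fun t ht => ?_, fun t ht => hf' (t, 0, 0) ht⟩
  rw [← hI']
  exact ⟨(t, 0, 0), ht, rfl⟩

end Groups

/-! ### Classification of the coefficient functions -/

section Classification

variable {m ε : ℝ} {I : Set ℝ} {f : ℝ → ℝ}

theorem solvesODE_one (S : Set ℝ) (b c : ℝ) : SolvesODE S NormalForm.one.fn 0 b c 0 := by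
  intro t _
  change _ * deriv (fun _ : ℝ => (1 : ℝ)) t = _
  simp

theorem solvesODE_power (k b : ℝ) :
    SolvesODE (NormalForm.power k).domain (NormalForm.power k).fn 0 b 0 (k * b) := fun t ht => by
  linear_combination b * deriv_power (k := k) (power_ne_zero ht).1

theorem solvesODE_exp (S : Set ℝ) (c : ℝ) : SolvesODE S NormalForm.exp.fn 0 0 c c := fun t _ => by
  change _ * deriv Real.exp t = _ * Real.exp t
  rw [Real.deriv_exp]
  ring

theorem solvesODE_arctan (S : Set ℝ) (k a : ℝ) :
    SolvesODE S (NormalForm.arctan k).fn a 0 a (a * k) := fun t _ => by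
  linear_combination a * deriv_arctan k t

/-- Every normal form satisfies a nontrivial linear equation; it is of first degree for the normal
forms that occur if `m ≠ 2`. -/
theorem NormalForm.exists_solvesODE (n : NormalForm) : ∃ a b c e : ℝ, ¬(a = 0 ∧ b = 0 ∧ c = 0) ∧
    (n.IsUsual → a = 0) ∧ SolvesODE n.domain n.fn a b c e := by
  cases n with
  | one => exact ⟨0, 1, 0, 0, by simp, fun _ => rfl, solvesODE_one _ 1 0⟩
  | power k => exact ⟨0, 1, 0, k * 1, by simp, fun _ => rfl, solvesODE_power k 1⟩
  | exp => exact ⟨0, 0, 1, 1, by simp, fun _ => rfl, solvesODE_exp _ 1⟩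
  | arctan k => exact ⟨1, 0, 1, 1 * k, by simp, fun h => h.elim, solvesODE_arctan _ k 1⟩

theorem SolvesODE.mono {S T : Set ℝ} {a b c e : ℝ} (h : SolvesODE T f a b c e) (hST : S ⊆ T) :
    SolvesODE S f a b c e := fun t ht => h t (hST ht)

/-- A zero of the leading coefficient is a zero of the right-hand side. -/
theorem SolvesODE.rhs_eq_zero {a b c e t : ℝ} (h : SolvesODE I f a b c e) (hf : IsCoefficient I f)
    (ht : t ∈ I) (h0 : a * t ^ 2 + b * t + c = 0) : a * t + e = 0 := by
  have := h t ht
  rw [h0, zero_mul] at this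
  exact (mul_eq_zero.1 this.symm).resolve_right (hf.ne_zero t ht)

theorem exists_usualEquivalent_of_solvesODE (hm₁ : m ≠ 1) (hI : IsOpenInterval I)
    (hf : IsCoefficient I f) {b c e : ℝ} (hbc : ¬(b = 0 ∧ c = 0)) (h : SolvesODE I f 0 b c e) :
    ∃ (n : NormalForm) (ε' : ℝ) (I' : Set ℝ), n.IsUsual ∧ I' ⊆ n.domain ∧
      UsualEquivalent m ε I f ε' I' n.fn := by
  -- it is enough to reach a normal form up to a factor by an affine change of time
  suffices H : ∃ (n : NormalForm) (A d B : ℝ), n.IsUsual ∧ A ≠ 0 ∧ B ≠ 0 ∧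
      (∀ t ∈ I, (A * t + d) / (0 * t + 1) ∈ n.domain) ∧
      ∀ t ∈ I, n.fn ((A * t + d) / (0 * t + 1)) = B * (f t / (0 * t + 1)) by
    obtain ⟨n, A, d, B, hn, hA, hB, hS, hF⟩ := H
    obtain ⟨ε', I', h1, h2⟩ := exists_usualEquivalent (ε := ε) hm₁ hA hB hS hF
    exact ⟨n, ε', I', hn, h1, h2⟩
  have hγ : ∀ t ∈ I, (0 : ℝ) * t + 1 ≠ 0 := fun t _ => by simp
  by_cases he : e = 0
  · subst he
    obtain ⟨B, hB, hF⟩ := NormalForm.exists_factor (α := 1) (β := 0) (γ := 0) (δ := 1) (r := 1)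
      hI hf .one (solvesODE_one _ b c) (by simpa using hbc) hγ (fun t _ => Set.mem_univ _)
      (by norm_num) h (by ring) (by ring) (by ring) (by ring)
    exact ⟨.one, 1, 0, B, trivial, one_ne_zero, hB, fun t _ => Set.mem_univ _, hF⟩
  by_cases hb : b = 0
  · subst hb
    have hc : c ≠ 0 := fun hc => hbc ⟨rfl, hc⟩
    have hA : e / c ≠ 0 := div_ne_zero he hc
    obtain ⟨B, hB, hF⟩ := NormalForm.exists_factor (α := e / c) (β := 0) (γ := 0) (δ := 1)
      (r := 1 / c) hI hf .exp (solvesODE_exp _ 1) (by norm_num) hγ (fun t _ => Set.mem_univ _)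
      (by simpa using hA) h (by ring) (by ring) (by field_simp; ring) (by ring)
    exact ⟨.exp, e / c, 0, B, trivial, hA, hB, fun t _ => Set.mem_univ _, hF⟩
  · have hne : ∀ t ∈ I, t + c / b ≠ 0 := by
      intro t ht h0
      have h1 : b * t + c = 0 := by
        have : b * (t + c / b) = b * t + c := by field_simp
        rw [← this, h0, mul_zero]
      exact he (by linear_combination h.rhs_eq_zero hf ht (by linear_combination h1))
    obtain ⟨σ, hσ, hpos⟩ := hI.exists_sign (g := fun t => t + c / b) (by fun_prop) hne
    have hσ0 : σ ≠ 0 := by rcases hσ with rfl | rfl <;> norm_num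
    have hS : ∀ t ∈ I, (σ * t + σ * (c / b)) / (0 * t + 1) ∈ (NormalForm.power (e / b)).domain :=
      fun t ht => Or.inl (by rw [zero_mul, zero_add, div_one, ← mul_add]; exact hpos t ht)
    obtain ⟨B, hB, hF⟩ := NormalForm.exists_factor (α := σ) (β := σ * (c / b)) (γ := 0) (δ := 1)
      (r := σ / b) hI hf (.power (e / b)) (solvesODE_power _ 1) (by norm_num) hγ hS
      (by simpa using hσ0) h (by ring) (by field_simp; ring) (by field_simp; ring)
      (by field_simp; ring)
    exact ⟨.power (e / b), σ, _, B, div_ne_zero he hb, hσ0, hB, hS, hF⟩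

/-- The case of two distinct real zeros of the leading coefficient, one of which may be infinite:
`f` is a multiple of `|α t + β| ^ k |γ t + δ| ^ (1 - k)` where the leading coefficient does not
vanish. -/
theorem exists_mobius_of_factors (hI : IsOpenInterval I) (hf : IsCoefficient I f)
    {α β γ δ e : ℝ} (hΔ : α * δ - β * γ ≠ 0)
    (h : SolvesODE I f (α * γ) (α * δ + β * γ) (β * δ) e)
    (hk : 1 / 2 ≤ (e - β * γ) / (α * δ - β * γ)) :
    ∃ (n : NormalForm) (α β γ δ B : ℝ), n.IsQuadratic ∧ α * δ - β * γ ≠ 0 ∧ B ≠ 0 ∧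
      (∀ t ∈ I, γ * t + δ ≠ 0) ∧ (∀ t ∈ I, (α * t + β) / (γ * t + δ) ∈ n.domain) ∧
      ∀ t ∈ I, n.fn ((α * t + β) / (γ * t + δ)) = B * (f t / (γ * t + δ)) := by
  set k := (e - β * γ) / (α * δ - β * γ) with hkdef
  have hke : k * (α * δ - β * γ) = e - β * γ := div_mul_cancel₀ _ hΔ
  have hk0 : k ≠ 0 := by linarith
  -- the exponent at the zero of `α t + β` is `k ≠ 0`
  have hα : ∀ t ∈ I, α * t + β ≠ 0 := by
    intro t ht h0
    have h1 := h.rhs_eq_zero hf ht (by linear_combination (γ * t + δ) * h0)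
    exact mul_ne_zero hk0 hΔ (by linear_combination hke + h1 - γ * h0)
  by_cases hk1 : k = 1
  · -- `f` is a multiple of `α t + β`
    have he : e = α * δ := by rw [hk1] at hke; linear_combination -hke
    have hΔ' : γ * β - δ * α ≠ 0 := fun h0 => hΔ (by linear_combination -h0)
    obtain ⟨B, hB, hF⟩ := NormalForm.exists_factor (α := γ) (β := δ) (γ := α) (δ := β) (r := 1)
      hI hf .one (solvesODE_one _ 1 0) (by norm_num) hα (fun t _ => Set.mem_univ _) hΔ' h
      (by ring) (by ring) (by ring) (by rw [he]; ring)
    exact ⟨.one, γ, δ, α, β, B, trivial, hΔ', hB, hα, fun t _ => Set.mem_univ _, hF⟩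
  · -- the exponent at the zero of `γ t + δ` is `1 - k ≠ 0`
    have hγ : ∀ t ∈ I, γ * t + δ ≠ 0 := by
      intro t ht h0
      have h1 := h.rhs_eq_zero hf ht (by linear_combination (α * t + β) * h0)
      exact mul_ne_zero (sub_ne_zero.2 hk1) hΔ (by linear_combination hke + h1 - α * h0)
    obtain ⟨σ, hσ, hpos⟩ := hI.exists_sign (g := fun t => (α * t + β) / (γ * t + δ))
      (ContinuousOn.div (by fun_prop) (by fun_prop) hγ)
      (fun t ht => div_ne_zero (hα t ht) (hγ t ht))
    have hσ0 : σ ≠ 0 := by rcases hσ with rfl | rfl <;> norm_num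
    have hΔ' : σ * α * δ - σ * β * γ ≠ 0 := fun h0 =>
      mul_ne_zero hσ0 hΔ (by linear_combination h0)
    have hS : ∀ t ∈ I, (σ * α * t + σ * β) / (γ * t + δ) ∈ (NormalForm.power k).domain :=
      fun t ht => Or.inl (by
        have := hpos t ht
        rwa [← mul_div_assoc, mul_add, ← mul_assoc] at this)
    obtain ⟨B, hB, hF⟩ := NormalForm.exists_factor (α := σ * α) (β := σ * β) (γ := γ) (δ := δ)
      (r := σ) hI hf (.power k) (solvesODE_power k 1) (by norm_num) hγ hS hΔ' h
      (by ring) (by ring) (by ring) (by linear_combination -σ * hke)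
    exact ⟨.power k, _, _, _, _, B, ⟨hk0, hk1, hk⟩, hΔ', hB, hγ, hS, hF⟩

/-- The case of a double zero of the leading coefficient, which may be infinite. -/
theorem exists_mobius_of_square (hI : IsOpenInterval I) (hf : IsCoefficient I f)
    {γ δ e : ℝ} (hγδ : 0 < γ ^ 2 + δ ^ 2) (h : SolvesODE I f (γ ^ 2) (2 * (γ * δ)) (δ ^ 2) e) :
    ∃ (n : NormalForm) (α β γ δ B : ℝ), n.IsQuadratic ∧ α * δ - β * γ ≠ 0 ∧ B ≠ 0 ∧
      (∀ t ∈ I, γ * t + δ ≠ 0) ∧ (∀ t ∈ I, (α * t + β) / (γ * t + δ) ∈ n.domain) ∧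
      ∀ t ∈ I, n.fn ((α * t + β) / (γ * t + δ)) = B * (f t / (γ * t + δ)) := by
  by_cases he : e = γ * δ
  · -- `γ t + δ` is a solution, so that `f` is a multiple of it
    have hne : ¬(γ ^ 2 = 0 ∧ 2 * (γ * δ) = 0 ∧ δ ^ 2 = 0) := by
      rintro ⟨h1, -, h3⟩
      linarith
    have hg : SolvesODE I (fun t => γ * t + δ) (γ ^ 2) (2 * (γ * δ)) (δ ^ 2) e := by
      intro t _
      have : HasDerivAt (fun t : ℝ => γ * t + δ) γ t := by
        simpa using ((hasDerivAt_id t).const_mul γ).add_const δ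
      rw [this.deriv, he]
      ring
    obtain ⟨C, hC⟩ := h.proportional hI hf.smooth (by fun_prop) hf.ne_zero hne hg
    have hγ : ∀ t ∈ I, γ * t + δ ≠ 0 := by
      intro t ht h0
      have hC0 : C = 0 := (mul_eq_zero.1 ((hC t ht).symm.trans h0)).resolve_right (hf.ne_zero t ht)
      obtain ⟨-, h1, h2⟩ := coeffs_eq_zero_of_infinite hI.infinite (a := 0) (b := γ) (c := δ)
        fun y hy => by
          have := hC y hy
          rw [hC0] at this
          linear_combination this
      rw [h1, h2] at hγδ
      norm_num at hγδ
    have hΔ : δ * δ - -γ * γ ≠ 0 := by nlinarith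
    obtain ⟨B, hB, hF⟩ := NormalForm.exists_factor (α := δ) (β := -γ) (γ := γ) (δ := δ) (r := 1)
      hI hf .one (solvesODE_one _ 0 1) (by norm_num) hγ (fun t _ => Set.mem_univ _) hΔ h
      (by ring) (by ring) (by ring) (by rw [he]; ring)
    exact ⟨.one, _, _, _, _, B, trivial, hΔ, hB, hγ, fun t _ => Set.mem_univ _, hF⟩
  · set Δ := e - γ * δ with hΔdef
    have hΔ0 : Δ ≠ 0 := sub_ne_zero.2 he
    have hγ : ∀ t ∈ I, γ * t + δ ≠ 0 := by
      intro t ht h0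
      have h1 := h.rhs_eq_zero hf ht (by linear_combination (γ * t + δ) * h0)
      exact hΔ0 (by linear_combination h1 - γ * h0)
    have hdet : Δ * δ / (γ ^ 2 + δ ^ 2) * δ - -(Δ * γ / (γ ^ 2 + δ ^ 2)) * γ = Δ := by
      field_simp
      ring
    have hΔ' : Δ * δ / (γ ^ 2 + δ ^ 2) * δ - -(Δ * γ / (γ ^ 2 + δ ^ 2)) * γ ≠ 0 := by
      rwa [hdet]
    obtain ⟨B, hB, hF⟩ := NormalForm.exists_factor (α := Δ * δ / (γ ^ 2 + δ ^ 2))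
      (β := -(Δ * γ / (γ ^ 2 + δ ^ 2))) (γ := γ) (δ := δ) (r := 1)
      hI hf .exp (solvesODE_exp _ 1) (by norm_num) hγ (fun t _ => Set.mem_univ _) hΔ' h
      (by ring) (by ring) (by ring) (by rw [hdet, hΔdef]; ring)
    exact ⟨.exp, _, _, _, _, B, trivial, hΔ', hB, hγ, fun t _ => Set.mem_univ _, hF⟩

/-- The case of two complex conjugate zeros of the leading coefficient. -/
theorem exists_mobius_of_discrim_neg (hI : IsOpenInterval I) (hf : IsCoefficient I f)
    {a b c e : ℝ} (hD : b ^ 2 - 4 * a * c < 0) (h : SolvesODE I f a b c e) :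
    ∃ (n : NormalForm) (α β γ δ B : ℝ), n.IsQuadratic ∧ α * δ - β * γ ≠ 0 ∧ B ≠ 0 ∧
      (∀ t ∈ I, γ * t + δ ≠ 0) ∧ (∀ t ∈ I, (α * t + β) / (γ * t + δ) ∈ n.domain) ∧
      ∀ t ∈ I, n.fn ((α * t + β) / (γ * t + δ)) = B * (f t / (γ * t + δ)) := by
  have ha : a ≠ 0 := by
    rintro rfl
    nlinarith [sq_nonneg b]
  -- the zeros are `-p ± i w`
  set p := b / (2 * a) with hp
  have hw0 : 0 < c / a - p ^ 2 := by
    have : c / a - p ^ 2 = -(b ^ 2 - 4 * a * c) / (4 * a ^ 2) := by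
      rw [hp]
      field_simp
      ring
    rw [this]
    exact div_pos (by linarith) (by positivity)
  set w := Real.sqrt (c / a - p ^ 2) with hw
  have hwpos : 0 < w := Real.sqrt_pos.2 hw0
  have hw2 : w ^ 2 = c / a - p ^ 2 := Real.sq_sqrt hw0.le
  obtain ⟨σ, hσ, hσk⟩ : ∃ σ : ℝ, (σ = 1 ∨ σ = -1) ∧ σ * |e / a - p| = e / a - p := by
    rcases abs_choice (e / a - p) with h | h
    · exact ⟨1, Or.inl rfl, by rw [h, one_mul]⟩
    · exact ⟨-1, Or.inr rfl, by rw [h]; ring⟩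
  have hσ2 : σ * σ = 1 := by rcases hσ with rfl | rfl <;> norm_num
  have hσ0 : σ ≠ 0 := by rintro rfl; simp at hσ2
  have hΔ : σ * w - σ * p * 0 ≠ 0 := by
    rw [mul_zero, sub_zero]
    exact mul_ne_zero hσ0 hwpos.ne'
  have hγ : ∀ t ∈ I, 0 * t + w ≠ 0 := fun t _ => by
    rw [zero_mul, zero_add]
    exact hwpos.ne'
  have hbp : 1 / a * b = 2 * p := by
    rw [hp]
    field_simp
  have hkw : w * (|e / a - p| / w) = |e / a - p| := mul_div_cancel₀ _ hwpos.ne'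
  obtain ⟨B, hB, hF⟩ := NormalForm.exists_factor (α := σ) (β := σ * p) (γ := 0) (δ := w)
    (r := 1 / a) hI hf (.arctan (|e / a - p| / w)) (solvesODE_arctan _ _ 1) (by norm_num) hγ
    (fun t _ => Set.mem_univ _) hΔ h
    (by rw [one_div_mul_cancel ha]; linear_combination -hσ2)
    (by rw [hbp]; linear_combination -2 * p * hσ2)
    (by linear_combination -p ^ 2 * hσ2 - hw2)
    (by linear_combination -p * hσ2 - σ * hkw - hσk)
  exact ⟨.arctan _, _, _, _, _, B, (by positivity : 0 ≤ |e / a - p| / w), hΔ, hB, hγ,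
    fun t _ => Set.mem_univ _, hF⟩

theorem exists_quadraticEquivalent_of_solvesODE (hI : IsOpenInterval I)
    (hf : IsCoefficient I f) {a b c e : ℝ} (habc : ¬(a = 0 ∧ b = 0 ∧ c = 0))
    (h : SolvesODE I f a b c e) :
    ∃ (n : NormalForm) (ε' : ℝ) (I' : Set ℝ), n.IsQuadratic ∧ I' ⊆ n.domain ∧
      QuadraticEquivalent ε I f ε' I' n.fn := by
  suffices H : ∃ (n : NormalForm) (α β γ δ B : ℝ), n.IsQuadratic ∧ α * δ - β * γ ≠ 0 ∧ B ≠ 0 ∧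
      (∀ t ∈ I, γ * t + δ ≠ 0) ∧ (∀ t ∈ I, (α * t + β) / (γ * t + δ) ∈ n.domain) ∧
      ∀ t ∈ I, n.fn ((α * t + β) / (γ * t + δ)) = B * (f t / (γ * t + δ)) by
    obtain ⟨n, α, β, γ, δ, B, hn, hΔ, hB, hγ, hS, hF⟩ := H
    obtain ⟨ε', I', h1, h2⟩ := exists_quadraticEquivalent (ε := ε) hΔ hB hγ hS hF
    exact ⟨n, ε', I', hn, h1, h2⟩
  rcases lt_trichotomy (b ^ 2 - 4 * a * c) 0 with hD | hD | hD
  · exact exists_mobius_of_discrim_neg hI hf hD h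
  · by_cases ha : a = 0
    · subst ha
      have hb : b = 0 := by simpa using hD
      subst hb
      have hc : c ≠ 0 := fun hc => habc ⟨rfl, rfl, hc⟩
      refine exists_mobius_of_square hI hf (γ := 0) (δ := 1) (e := 1 / c * e) (by norm_num) ?_
      convert h.scale (1 / c) using 1
      · ring
      · ring
      · field_simp
    · refine exists_mobius_of_square hI hf (γ := 1) (δ := b / (2 * a)) (e := 1 / a * e)
        (by positivity) ?_
      convert h.scale (1 / a) using 1
      · field_simp
      · field_simp
      · field_simp
        linear_combination hD
  · -- two distinct factors; the order is chosen such that `k ≥ 1 / 2`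
    obtain ⟨α, β, γ, δ, hΔ, rfl, rfl, rfl⟩ : ∃ α β γ δ : ℝ, α * δ - β * γ ≠ 0 ∧
        a = α * γ ∧ b = α * δ + β * γ ∧ c = β * δ := by
      by_cases ha : a = 0
      · subst ha
        have hb : b ≠ 0 := by
          rintro rfl
          simp at hD
        exact ⟨b, c, 0, 1, by simpa using hb, by ring, by ring, by ring⟩
      · set r := Real.sqrt (b ^ 2 - 4 * a * c)
        have hr : 0 < r := Real.sqrt_pos.2 hD
        have hr2 : r ^ 2 = b ^ 2 - 4 * a * c := Real.sq_sqrt hD.le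
        refine ⟨a, (b - r) / 2, 1, (b + r) / (2 * a), ?_, by ring, ?_, ?_⟩
        · have : a * ((b + r) / (2 * a)) - (b - r) / 2 * 1 = r := by
            field_simp
            ring
          rw [this]
          exact hr.ne'
        · field_simp
          ring
        · field_simp
          linear_combination hr2
    by_cases hk : 1 / 2 ≤ (e - β * γ) / (α * δ - β * γ)
    · exact exists_mobius_of_factors hI hf hΔ h hk
    · have hΔ' : γ * β - δ * α ≠ 0 := fun h0 => hΔ (by linear_combination -h0)
      refine exists_mobius_of_factors hI hf (α := γ) (β := δ) (γ := α) (δ := β) (e := e) hΔ' ?_ ?_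
      · convert h using 1 <;> ring
      · have : (e - δ * α) / (γ * β - δ * α) = 1 - (e - β * γ) / (α * δ - β * γ) := by
          rw [div_eq_iff hΔ']
          linear_combination -div_mul_cancel₀ (e - β * γ) hΔ
        rw [this]
        linarith

/-- Equivalence to a normal form yields a linear equation; for `m ≠ 2` one of first degree. -/
theorem UsualEquivalent.exists_solvesODE (hI : IsOpen I) {n : NormalForm} {ε' : ℝ} {I' : Set ℝ}
    (hn : n.IsUsual) (hI' : I' ⊆ n.domain) (h : UsualEquivalent m ε I f ε' I' n.fn) :
    ∃ b c e : ℝ, ¬(b = 0 ∧ c = 0) ∧ SolvesODE I f 0 b c e := by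
  obtain ⟨A, d, B, hA, hB, hS, hF⟩ := h.exists_affine
  obtain ⟨a, b, c, e, habc, ha, hs⟩ := n.exists_solvesODE
  obtain rfl := ha hn
  have h1 := (hs.mono hI').mobius hI (fun s hs => (n.contDiffAt_fn (hI' hs)).differentiableAt
    (by simp)) (fun t _ => by simp) hS hB hF
  have h2 := mobius_ne_zero (α := A) (β := d) (γ := 0) (δ := 1) (by simpa using hA) habc
  have h0 : 0 * A ^ 2 + b * (A * 0) + c * 0 ^ 2 = 0 := by ring
  rw [h0] at h1 h2
  exact ⟨_, _, _, fun h => h2 ⟨rfl, h⟩, h1⟩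

theorem QuadraticEquivalent.exists_solvesODE (hI : IsOpen I) {n : NormalForm} {ε' : ℝ}
    {I' : Set ℝ} (hI' : I' ⊆ n.domain) (h : QuadraticEquivalent ε I f ε' I' n.fn) :
    ∃ a b c e : ℝ, ¬(a = 0 ∧ b = 0 ∧ c = 0) ∧ SolvesODE I f a b c e := by
  obtain ⟨α, β, γ, δ, B, hΔ, hB, hγ, hS, hF⟩ := h.exists_mobius
  obtain ⟨a, b, c, e, habc, -, hs⟩ := n.exists_solvesODE
  exact ⟨_, _, _, _, mobius_ne_zero hΔ habc, (hs.mono hI').mobius hI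
    (fun s hs => (n.contDiffAt_fn (hI' hs)).differentiableAt (by simp)) hγ hS hB hF⟩

end Classification

/-! ### Inequivalence of the normal forms -/

section Inequivalence

variable {m ε : ℝ} {I : Set ℝ}

/-- An affine change of time with factor `A` multiplies `b` and `e` by `A`, so that `e / b` and the
vanishing of `b` and `e` are invariant. -/
theorem eq_of_usualEquivalent (hI : IsOpenInterval I) {n n' : NormalForm} {ε' : ℝ} {I' : Set ℝ}
    (hn : n.IsUsual) (hn' : n'.IsUsual) (hd : I ⊆ n.domain) (hd' : I' ⊆ n'.domain)
    (h : UsualEquivalent m ε I n.fn ε' I' n'.fn) : n = n' := by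
  obtain ⟨A, d, B, hA, hB, hS, hF⟩ := h.exists_affine
  have pull : ∀ {a b c e : ℝ}, SolvesODE I' n'.fn a b c e → SolvesODE I n.fn _ _ _ _ := fun hs =>
    hs.mobius hI.isOpen (fun s hs => (n'.contDiffAt_fn (hd' hs)).differentiableAt (by simp))
      (fun t _ => by simp) hS hB hF
  cases n' with
  | one =>
    have h1 := pull (solvesODE_one I' 0 1)
    cases n with
    | one => rfl
    | power k =>
      have := ((solvesODE_power_iff hI hn hd).1 h1).2.2
      norm_num at this
    | exp =>
      have := ((solvesODE_exp_iff hI).1 h1).2.2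
      norm_num at this
    | arctan k => exact hn.elim
  | power k' =>
    have h1 := pull ((solvesODE_power k' 1).mono hd')
    cases n with
    | one =>
      have := ((solvesODE_one_iff hI).1 h1).2
      exact absurd this (by simpa using ⟨hA, hn'⟩)
    | power k =>
      have := ((solvesODE_power_iff hI hn hd).1 h1).2.1
      have : k' = k := mul_left_cancel₀ hA (by linear_combination this)
      rw [this]
    | exp =>
      have := ((solvesODE_exp_iff hI).1 h1).2.1
      exact absurd (by linear_combination this) hA
    | arctan k => exact hn.elim
  | exp =>
    have h1 := pull (solvesODE_exp I' 1)
    cases n with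
    | one =>
      have := ((solvesODE_one_iff hI).1 h1).2
      exact absurd (by linear_combination this) hA
    | power k =>
      have := ((solvesODE_power_iff hI hn hd).1 h1).2.1
      exact absurd (by linear_combination this) hA
    | exp => rfl
    | arctan k => exact hn.elim
  | arctan k => exact hn'.elim

/-- The values of the semi-invariants `2 e - b` and `b² - 4 a c` of the linear equation
`(a t² + b t + c) f' = (a t + e) f` for a normal form. -/
def NormalForm.invariants : NormalForm → ℝ × ℝ
  | .one => (-1, 1)
  | .power k => (2 * k - 1, 1)
  | .exp => (2, 0)
  | .arctan k => (2 * k, -4)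

/-- Up to a factor `r`, the linear equations of a normal form have its semi-invariants.  For `f = 1`
the equations form a plane, but the relation between the semi-invariants persists on it. -/
theorem SolvesODE.invariants (hI : IsOpenInterval I) {n : NormalForm} (hn : n.IsQuadratic)
    (hd : I ⊆ n.domain) {a b c e : ℝ} (h : SolvesODE I n.fn a b c e) :
    ∃ r : ℝ, 2 * e - b = r * n.invariants.1 ∧ b ^ 2 - 4 * a * c = r ^ 2 * n.invariants.2 := by
  cases n with
  | one =>
    obtain ⟨rfl, rfl⟩ := (solvesODE_one_iff hI).1 h
    exact ⟨b, by simp [NormalForm.invariants], by simp [NormalForm.invariants]⟩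
  | power k =>
    obtain ⟨h1, rfl, rfl⟩ := (solvesODE_power_iff hI hn.1 hd).1 h
    exact ⟨b, by simp only [NormalForm.invariants]; ring, by simp [NormalForm.invariants]⟩
  | exp =>
    obtain ⟨rfl, rfl, rfl⟩ := (solvesODE_exp_iff hI).1 h
    exact ⟨e, by simp only [NormalForm.invariants]; ring, by simp [NormalForm.invariants]⟩
  | arctan k =>
    obtain ⟨rfl, rfl, rfl⟩ := (solvesODE_arctan_iff hI).1 h
    exact ⟨c, by simp only [NormalForm.invariants]; ring, by
      simp only [NormalForm.invariants]; ring⟩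

theorem NormalForm.exists_solvesODE_invariants (n : NormalForm) : ∃ a b c e : ℝ,
    SolvesODE n.domain n.fn a b c e ∧ 2 * e - b = n.invariants.1 ∧
      b ^ 2 - 4 * a * c = n.invariants.2 := by
  cases n with
  | one => exact ⟨0, 1, 0, 0, solvesODE_one _ 1 0, by norm_num [invariants]⟩
  | power k =>
    exact ⟨0, 1, 0, k * 1, solvesODE_power k 1, by simp [invariants], by norm_num [invariants]⟩
  | exp => exact ⟨0, 0, 1, 1, solvesODE_exp _ 1, by norm_num [invariants]⟩
  | arctan k =>
    exact ⟨1, 0, 1, 1 * k, solvesODE_arctan _ k 1, by simp [invariants], by norm_num [invariants]⟩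

/-- The semi-invariants, up to the factors `r` and `r²`, separate the normal forms.  The sign of the
second one tells real, double and complex zeros apart; the constraints on `k` make the first one
nonnegative for `t ^ k` and `e ^ (k arctan t) √(t² + 1)`, and `k ≠ 0, 1` excludes the value `±1`,
which belongs to constants. -/
theorem NormalForm.eq_of_invariants {n n' : NormalForm} (hn : n.IsQuadratic)
    (hn' : n'.IsQuadratic) {q r : ℝ} (hq : q ≠ 0)
    (h₁ : q * n'.invariants.1 = r * n.invariants.1)
    (h₂ : q ^ 2 * n'.invariants.2 = r ^ 2 * n.invariants.2) : n = n' := by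
  have hq2 : 0 < q ^ 2 := by positivity
  have key : n'.invariants.1 ^ 2 * n.invariants.2 * r ^ 2
      = n.invariants.1 ^ 2 * n'.invariants.2 * r ^ 2 := by
    have e1 : q ^ 2 * n'.invariants.1 ^ 2 = r ^ 2 * n.invariants.1 ^ 2 := by
      rw [← mul_pow, h₁, mul_pow]
    refine mul_left_cancel₀ hq2.ne' ?_
    linear_combination r ^ 2 * n.invariants.2 * e1 - r ^ 2 * n.invariants.1 ^ 2 * h₂
  have hr : r ≠ 0 := by
    rintro rfl
    have e1 : n'.invariants.1 = 0 := by simpa [hq] using h₁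
    have e2 : n'.invariants.2 = 0 := by simpa [hq] using h₂
    cases n' <;> first | norm_num [invariants] at e2; done | norm_num [invariants] at e1
  have hr2 : 0 < r ^ 2 := by positivity
  replace key := mul_right_cancel₀ hr2.ne' key
  cases n with
  | one =>
    cases n' with
    | one => rfl
    | power k =>
      simp only [invariants] at key
      have : k * (k - 1) = 0 := by linear_combination key / 4
      rcases mul_eq_zero.1 this with h | h
      · exact absurd h hn'.1
      · exact absurd (sub_eq_zero.1 h) hn'.2.1
    | exp => norm_num [invariants] at key
    | arctan k =>
      simp only [invariants] at h₂
      linarith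
  | power k =>
    cases n' with
    | one =>
      simp only [invariants] at key
      have : k * (k - 1) = 0 := by linear_combination -key / 4
      rcases mul_eq_zero.1 this with h | h
      · exact absurd h hn.1
      · exact absurd (sub_eq_zero.1 h) hn.2.1
    | power k' =>
      simp only [invariants] at key
      obtain ⟨-, -, hk⟩ := hn
      obtain ⟨-, -, hk'⟩ := hn'
      have : 2 * k' - 1 = 2 * k - 1 :=
        (sq_eq_sq₀ (by linarith) (by linarith)).1 (by linear_combination key)
      rw [show k = k' by linarith]
    | exp =>
      simp only [invariants] at h₂
      linarith
    | arctan k' =>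
      simp only [invariants] at h₂
      linarith
  | exp =>
    cases n' with
    | one => norm_num [invariants, hq] at h₂
    | power k => norm_num [invariants, hq] at h₂
    | exp => rfl
    | arctan k => norm_num [invariants, hq] at h₂
  | arctan k =>
    cases n' with
    | one =>
      simp only [invariants] at h₂
      linarith
    | power k' =>
      simp only [invariants] at h₂
      linarith
    | exp =>
      simp only [invariants] at h₂
      linarith
    | arctan k' =>
      simp only [invariants] at key
      have hk : 0 ≤ k := hn
      have hk' : 0 ≤ k' := hn'
      rw [(sq_eq_sq₀ hk hk').1 (by linear_combination key / 16)]

theorem eq_of_quadraticEquivalent (hI : IsOpenInterval I) {n n' : NormalForm} {ε' : ℝ}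
    {I' : Set ℝ} (hn : n.IsQuadratic) (hn' : n'.IsQuadratic) (hd : I ⊆ n.domain)
    (hd' : I' ⊆ n'.domain) (h : QuadraticEquivalent ε I n.fn ε' I' n'.fn) : n = n' := by
  obtain ⟨α, β, γ, δ, B, hΔ, hB, hγ, hS, hF⟩ := h.exists_mobius
  obtain ⟨a, b, c, e, hs, hi₁, hi₂⟩ := n'.exists_solvesODE_invariants
  obtain ⟨r, hr₁, hr₂⟩ := ((hs.mono hd').mobius hI.isOpen
    (fun s hs => (n'.contDiffAt_fn (hd' hs)).differentiableAt (by simp)) hγ hS hB hF).invariants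
    hI hn hd
  -- the semi-invariants are multiplied by the determinant and by its square
  refine NormalForm.eq_of_invariants (r := r) hn hn' hΔ ?_ ?_
  · rw [← hr₁, ← hi₁]
    ring
  · rw [← hr₂, ← hi₂]
    ring

end Inequivalence

end KmnSymmetry

/-! ### The group classification -/

theorem mainTheorem2 (m ε : ℝ) (hm₀ : m ≠ 0) (hm₁ : m ≠ 1) (hε : ε = 1 ∨ ε = -1)
    (I J U : Set ℝ) (hI : IsOpenInterval I) (hJ : IsOpenInterval J) (hU : IsOpenInterval U)
    (hmU : IsPowerDomain m U) :
    (m ≠ 2 →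
      -- the kernel algebra
      IsBasisOf ![vf fun _ _ _ => (0, 1, 0)] (kernelAlgebra m ε I J U) ∧
      -- the maximal algebras for the special coefficient functions
      IsBasisOf ![vf fun _ _ _ => (1, 0, 0), vf fun _ _ _ => (0, 1, 0),
          vf fun t x u => (3 * (m - 1) * t, (m - 1) * x, -2 * u)]
        (maximalAlgebra m ε (NormalForm.one.fn) (I ×ˢ J ×ˢ U)) ∧
      (∀ k : ℝ, k ≠ 0 → I ⊆ (NormalForm.power k).domain →
        IsBasisOf ![vf fun _ _ _ => (0, 1, 0),
            vf fun t x u => (3 * (m - 1) * t, (m - 1) * (k + 1) * x, (k - 2) * u)]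
          (maximalAlgebra m ε (NormalForm.power k).fn (I ×ˢ J ×ˢ U))) ∧
      IsBasisOf ![vf fun _ _ _ => (0, 1, 0), vf fun _ x u => (3 * (m - 1), (m - 1) * x, u)]
        (maximalAlgebra m ε (NormalForm.exp.fn) (I ×ˢ J ×ˢ U)) ∧
      -- every extension of the kernel algebra is equivalent to one of these
      (∀ f : ℝ → ℝ, IsCoefficient I f →
        (kernelAlgebra m ε I J U ⊂ maximalAlgebra m ε f (I ×ˢ J ×ˢ U) ↔
          ∃ (c : NormalForm) (ε' : ℝ) (I' : Set ℝ), c.IsUsual ∧ I' ⊆ c.domain ∧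
            UsualEquivalent m ε I f ε' I' c.fn)) ∧
      -- they are pairwise inequivalent
      (∀ (c c' : NormalForm) (ε' : ℝ) (I' : Set ℝ), c.IsUsual → c'.IsUsual →
        I ⊆ c.domain → I' ⊆ c'.domain → UsualEquivalent m ε I c.fn ε' I' c'.fn → c = c')) ∧
    (m = 2 →
      -- the kernel algebra
      IsBasisOf ![vf fun _ _ _ => (0, 1, 0), vf fun t _ _ => (0, 2 * ε * t, 1)]
        (kernelAlgebra m ε I J U) ∧
      -- the maximal algebras for the special coefficient functions
      IsBasisOf ![vf fun _ _ _ => (1, 0, 0), vf fun t _ _ => (0, 2 * ε * t, 1),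
          vf fun _ _ _ => (0, 1, 0), vf fun t x u => (3 * t, x, -2 * u)]
        (maximalAlgebra m ε (NormalForm.one.fn) (I ×ˢ J ×ˢ U)) ∧
      (∀ k : ℝ, k ≠ 0 → k ≠ 1 → I ⊆ (NormalForm.power k).domain →
        IsBasisOf ![vf fun _ _ _ => (0, 1, 0), vf fun t _ _ => (0, 2 * ε * t, 1),
            vf fun t x u => (3 * t, (k + 1) * x, (k - 2) * u)]
          (maximalAlgebra m ε (NormalForm.power k).fn (I ×ˢ J ×ˢ U))) ∧
      IsBasisOf ![vf fun _ _ _ => (0, 1, 0), vf fun t _ _ => (0, 2 * ε * t, 1),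
          vf fun _ x u => (3, x, u)]
        (maximalAlgebra m ε (NormalForm.exp.fn) (I ×ˢ J ×ˢ U)) ∧
      (∀ k : ℝ,
        IsBasisOf ![vf fun _ _ _ => (0, 1, 0), vf fun t _ _ => (0, 2 * ε * t, 1),
            vf fun t x u => (6 * ε * (t ^ 2 + 1), 2 * ε * (3 * t + k) * x,
              2 * ε * (k - 3 * t) * u + 3 * x)]
          (maximalAlgebra m ε (NormalForm.arctan k).fn (I ×ˢ J ×ˢ U))) ∧
      -- every extension of the kernel algebra is equivalent to one of these
      (∀ f : ℝ → ℝ, IsCoefficient I f →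
        (kernelAlgebra m ε I J U ⊂ maximalAlgebra m ε f (I ×ˢ J ×ˢ U) ↔
          ∃ (c : NormalForm) (ε' : ℝ) (I' : Set ℝ), c.IsQuadratic ∧ I' ⊆ c.domain ∧
            QuadraticEquivalent ε I f ε' I' c.fn)) ∧
      -- they are pairwise inequivalent
      (∀ (c c' : NormalForm) (ε' : ℝ) (I' : Set ℝ), c.IsQuadratic → c'.IsQuadratic →
        I ⊆ c.domain → I' ⊆ c'.domain → QuadraticEquivalent ε I c.fn ε' I' c'.fn → c = c')) := by
  refine ⟨fun hm₂ => ⟨?_, ?_, ?_, ?_, ?_, ?_⟩, ?_⟩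
  · exact isBasisOf_kernelAlgebra hε hI hJ hU hm₀ hm₁ hm₂ hmU
  · exact isBasisOf_maximalAlgebra_one hε hI hJ hU hm₀ hm₁ hm₂ hmU
  · exact fun k hk hd => isBasisOf_maximalAlgebra_power hε hI hJ hU hm₀ hm₁ hm₂ hmU hk hd
  · exact isBasisOf_maximalAlgebra_exp hε hI hJ hU hm₀ hm₁ hm₂ hmU
  · intro f hf
    rw [kernelAlgebra_ssubset_iff hε hI hJ hU hm₀ hm₁ hm₂ hmU hf]
    constructor
    · rintro ⟨b, c, e, hbc, h⟩
      exact exists_usualEquivalent_of_solvesODE hm₁ hI hf hbc h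
    · rintro ⟨n, ε', I', hn, hI', h⟩
      exact h.exists_solvesODE hI.isOpen hn hI'
  · exact fun n n' ε' I' hn hn' hd hd' h => eq_of_usualEquivalent hI hn hn' hd hd' h
  · rintro rfl
    refine ⟨?_, ?_, ?_, ?_, ?_, ?_, ?_⟩
    · exact isBasisOf_kernelAlgebra_two hε hI hJ hU
    · exact isBasisOf_maximalAlgebra_two_one hε hI hJ hU
    · exact fun k hk hk₁ hd => isBasisOf_maximalAlgebra_two_power hε hI hJ hU hk hk₁ hd
    · exact isBasisOf_maximalAlgebra_two_exp hε hI hJ hU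
    · exact fun k => isBasisOf_maximalAlgebra_two_arctan hε hI hJ hU k
    · intro f hf
      rw [kernelAlgebra_two_ssubset_iff hε hI hJ hU hf]
      constructor
      · rintro ⟨a, b, c, e, habc, h⟩
        exact exists_quadraticEquivalent_of_solvesODE hI hf habc h
      · rintro ⟨n, ε', I', -, hI', h⟩
        exact h.exists_solvesODE hI.isOpen hI'
    · exact fun n n' ε' I' hn hn' hd hd' h => eq_of_quadraticEquivalent hI hn hn' hd hd' h
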